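/- **Setting.** Let $n,\ell\ge 0$, $X=\mathbb C^n$ with coordinates $(z_1,\dots,z_n)$, and let $I_1,\dots,I_\ell\subset\{1,\dots,n\}$ be such that for all $j\ne k$ either $I_j\subsetneq I_k$, or $I_k\subsetneq I_j$, or $I_j\cap I_k=\emptyset$, and such that $\bigcup_{I_k\subsetneq I_j}I_k\subsetneq I_j$ for all $j$. Put $Z_j=\{z\in X: z_i=0 \text{ for } i\in I_j\}$ and $\hat I_j=I_j\setminus\bigcup_{I_k\subsetneq I_j}I_k$. For a set $s$ of indices, $z_s$ denotes the coordinates $z_i$, $i\in s$; $|\cdot|$ is the Euclidean norm. **Multi-cones.** Let $U=B_1\times\dots\times B_\ell\times W\subset X$, where $B_j$ is an open ball centred at $0$ in $\mathbb C^{\hat I_j}$ and $W$ is a non-empty convex open subset of the space of the remaining coordinates; let $G_j$ be a non-empty open proper convex cone in $\mathbb C^{\hat I_j}$ (proper: for $x\neq 0$, not both $x$ and $-x$ lie in $G_j$), and let $\epsilon>0$. The open proper multi-cone $S(U,\{G_j\},\epsilon)$ is the set of $z\in U$ such that for every $j$ one has $z_{\hat I_j}\in G_j$, and $|z_{\hat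 I_k}|<\epsilon|z_{\hat I_j}|$ whenever $I_k\subsetneq I_j$ (it is $U$ if $\ell=0$). A multi-cone $S'=S(U',\{G'_j\},\epsilon')$ is properly contained in $S=S(U,\{G_j\},\epsilon)$ if $\epsilon'<\epsilon$, $U'$ is relatively compact in $U$, and $\overline{G'_j}\setminus\{0\}\subset G_j$ for all $j$. **Multi-asymptotic developability.** For $\emptyset\ne J\subset\{1,\dots,\ell\}$ put $I_J=\bigcup_{j\in J}I_j$, $Z_J=\bigcap_{j\in J}Z_j$ (with coordinates $z_{I_J^c}$), and let $S_J$ be the interior in $Z_J$ of $\overline S\cap Z_J$. Let $\mathbb Z_{\ge0}^{I_J}$ (resp. $\mathbb Z_{\ge0}^{J}$) be the set of multi-indices in $\mathbb Z_{\ge0}^n$ (resp. $\mathbb Z_{\ge0}^\ell$) vanishing outside $I_J$ (resp. $J$). A total family of coefficients on $S$ is a family $F=\{f_{J,\alpha}\}$ of holomorphic functions $f_{J,\alpha}(z_{I_J^c})$ on $S_J$, for $\emptyset\neq J\subset\{1,\dots,\ell\}$ and $\alpha\in\mathbb Z_{\ge0}^{I_J}$. Let $\mu(z,\lambda)=\big((\prod_{j:\,i\in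 I_j}\lambda_j)\,z_i\big)_{1\le i\le n}$ for $\lambda\in\mathbb C^\ell$ and $\exp(z_1,\dots,z_n)=e^{z_1}\cdots e^{z_n}$. For $\beta\in\mathbb Z_{\ge0}^J$, $$T_J^\beta=\frac1{\beta!}\exp(-\mu(z,\lambda))\,\partial_\lambda^\beta\exp(\mu(z,\lambda))\Big|_{\lambda_j=0\,(j\in J),\ \lambda_j=1\,(j\notin J)}$$ is a polynomial in $z_{I_J}$ (explicitly, $T_J^\beta=\sum_\alpha z^\alpha/\alpha!$ over the $\alpha\in\mathbb Z_{\ge0}^{I_J}$ with $\sum_{i\in I_j}\alpha_i=\beta_j$ for all $j\in J$). Let $T_J^\beta(F;z)$ be obtained from it by replacing each monomial $z^\alpha$ by $f_{J,\alpha}(z_{I_J^c})z^\alpha$, and for $N=(n_1,\dots,n_\ell)\in\mathbb Z_{\ge0}^\ell$ put $$\mathrm{App}^{<N}(F;z)=\sum_{\emptyset\ne J}(-1)^{\#J+1}\sum_{\beta\in\mathbb Z_{\ge0}^J,\ \beta_j<n_j\,(j\in J)}T_J^\beta(F;z),\qquad w_j(N)=n_j-\sum_k n_k,$$ the last sum being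 over those $k$ for which $Z_k\supsetneq Z_j$ and there is no $m$ with $Z_k\supsetneq Z_m\supsetneq Z_j$. A function $f$ on $S$ is multi-asymptotically developable along $Z_1\cup\dots\cup Z_\ell$ on $S$ if there is a total family $F$ of coefficients on $S$ such that for every open proper multi-cone $S'$ properly contained in $S$ and every $N\in\mathbb Z_{\ge0}^\ell$ there is a constant $C_{S',N}>0$ with $$|f(z)-\mathrm{App}^{<N}(F;z)|\le C_{S',N}\prod_{1\le j\le\ell}\mathrm{dist}(z,Z_j)^{w_j(N)}\qquad(z\in S').$$ **Theorem.** Let $S=S(U,\{G_j\},\epsilon)$ be an open proper multi-cone and $f$ a holomorphic function on $S$. The following conditions are equivalent. 1. $f$ is multi-asymptotically developable along $Z_1\cup\dots\cup Z_\ell$ on $S$. 2. For every open proper multi-cone $S'$ properly contained in $S$ and every $\alpha\in\mathbb Z_{\ge0}^n$, the derivative $\partial^\alpha f/\partial z^\alpha$ is bounded on $S'$. 3. For every open proper multi-cone $S'$ properly contained in $S$, the restriction $f|_{S'}$ extends to a $C^\infty$ function on $X_{\mathbb R}$, the real manifold underlying $X$. -/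

import Mathlib

open scoped ContDiff

namespace MultiAsymptotic

/-! ### Partial derivatives in `ℂ^m` -/

/-- The holomorphic partial derivative `∂f/∂z_i`. -/
noncomputable def pderiv {m : ℕ} (i : Fin m) (f : EuclideanSpace ℂ (Fin m) → ℂ) :
    EuclideanSpace ℂ (Fin m) → ℂ :=
  fun z => lineDeriv ℂ f z (EuclideanSpace.single i 1)

/-- Iterated partial derivatives along the directions in a list: for `L = [i, k, …]` this is
`∂_i^{α i} (∂_k^{α k} (… f))`. -/
noncomputable def listPartial {m : ℕ} (L : List (Fin m)) (α : Fin m → ℕ)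
    (f : EuclideanSpace ℂ (Fin m) → ℂ) : EuclideanSpace ℂ (Fin m) → ℂ :=
  L.foldr (fun i g => (pderiv i)^[α i] g) f

/-- The higher partial derivative `∂^α f = ∂_0^{α 0} ⋯ ∂_{m-1}^{α (m-1)} f`. -/
noncomputable def mixedPartial {m : ℕ} (α : Fin m → ℕ)
    (f : EuclideanSpace ℂ (Fin m) → ℂ) : EuclideanSpace ℂ (Fin m) → ℂ :=
  listPartial (List.finRange m) α f

/-! ### Families of coordinate subspaces -/

section Indices

variable {n ℓ : ℕ} (I : Fin ℓ → Finset (Fin n))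

/-- The combinatorial condition on the index sets `I_1, …, I_ℓ`: for `j ≠ k` either one of `I_j`,
`I_k` is strictly contained in the other or they are disjoint, and the union of all the `I_k`
strictly contained in `I_j` is strictly contained in `I_j`. -/
structure Admissible : Prop where
  nested : ∀ j k, j ≠ k → I j ⊂ I k ∨ I k ⊂ I j ∨ Disjoint (I j) (I k)
  strict : ∀ j, (Finset.univ.filter fun k => I k ⊂ I j).biUnion I ⊂ I j

/-- `Î_j`, the indices of `I_j` that lie in no strictly smaller `I_k`. -/
def hat (j : Fin ℓ) : Finset (Fin n) :=
  I j \ (Finset.univ.filter fun k => I k ⊂ I j).biUnion I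

/-- The indices that lie in no `I_j`. -/
def rest : Finset (Fin n) := (Finset.univ.biUnion I)ᶜ

/-- `I_J`, the union of the `I_j` with `j ∈ J`. -/
def union (J : Finset (Fin ℓ)) : Finset (Fin n) := J.biUnion I

/-- The submanifold `Z_j = {z_i = 0 for i ∈ I_j}` of `ℂ^n`. -/
def Z (j : Fin ℓ) : Set (EuclideanSpace ℂ (Fin n)) := {z | ∀ i ∈ I j, z i = 0}

/-- The multi-action `μ(z, λ)`, the composite of the actions `μ_j(·, λ_j)` that multiply the
coordinates `z_i`, `i ∈ I_j`, by `λ_j`. -/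
noncomputable def mu (z : EuclideanSpace ℂ (Fin n)) (lam : EuclideanSpace ℂ (Fin ℓ)) :
    EuclideanSpace ℂ (Fin n) :=
  WithLp.toLp 2 fun i => (∏ j ∈ Finset.univ.filter (fun j => i ∈ I j), lam j) * z i

end Indices

/-- `z ↦ z_s`, the projection of `ℂ^n` to the coordinates in `s`. -/
noncomputable def proj {n : ℕ} (s : Finset (Fin n)) (z : EuclideanSpace ℂ (Fin n)) :
    EuclideanSpace ℂ s :=
  WithLp.toLp 2 fun i => z i

/-- The inclusion `ℂ^s → ℂ^n` as the subspace on which the coordinates outside `s` vanish. -/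
noncomputable def incl {n : ℕ} (s : Finset (Fin n)) (w : EuclideanSpace ℂ s) :
    EuclideanSpace ℂ (Fin n) :=
  WithLp.toLp 2 fun i => if h : i ∈ s then w ⟨i, h⟩ else 0

/-! ### Proper multi-cones -/

/-- The data `(U, {G_j}, ε)` of an open proper multi-cone: `U` is the product of open balls `B_j`
in `ℂ^{Î_j}` centred at the origin and a (non-empty) convex open set `W` in the space of the
remaining coordinates, and `G_j` is a (non-empty) open proper convex cone in `ℂ^{Î_j}`. -/
structure MultiCone {n ℓ : ℕ} (I : Fin ℓ → Finset (Fin n)) where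
  radius : Fin ℓ → ℝ
  radius_pos : ∀ j, 0 < radius j
  W : Set (EuclideanSpace ℂ (rest I))
  isOpen_W : IsOpen W
  convex_W : Convex ℝ W
  nonempty_W : W.Nonempty
  G : ∀ j, ConvexCone ℝ (EuclideanSpace ℂ (hat I j))
  isOpen_G : ∀ j, IsOpen (G j : Set (EuclideanSpace ℂ (hat I j)))
  nonempty_G : ∀ j, (G j : Set (EuclideanSpace ℂ (hat I j))).Nonempty
  proper_G : ∀ j, (G j).Salient
  ε : ℝ
  ε_pos : 0 < ε

namespace MultiCone

variable {n ℓ : ℕ} {I : Fin ℓ → Finset (Fin n)} (S : MultiCone I)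

/-- `U = B_1 × ⋯ × B_ℓ × W`. -/
def U : Set (EuclideanSpace ℂ (Fin n)) :=
  {z | (∀ j, proj (hat I j) z ∈ Metric.ball 0 (S.radius j)) ∧ proj (rest I) z ∈ S.W}

/-- `V_j = {z ∈ U : z_{Î_j} ∈ G_j, |z_{Î_β}| < ε |z_{Î_j}| whenever I_β ⊊ I_j}`. -/
def V (j : Fin ℓ) : Set (EuclideanSpace ℂ (Fin n)) :=
  {z | z ∈ S.U ∧ proj (hat I j) z ∈ S.G j ∧
    ∀ b, I b ⊂ I j → ‖proj (hat I b) z‖ < S.ε * ‖proj (hat I j) z‖}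

/-- The open set `S(U, {G_j}, ε) = V_1 ∩ ⋯ ∩ V_ℓ`, which is `U` if `ℓ = 0`. -/
def carrier : Set (EuclideanSpace ℂ (Fin n)) := S.U ∩ ⋂ j, S.V j

/-- `S_J`, the interior in `Z_J = ⋂_{j ∈ J} Z_j` of `closure S ∩ Z_J`; here `Z_J` is identified
with the space of the coordinates outside `I_J`. -/
def face (J : Finset (Fin ℓ)) : Set (EuclideanSpace ℂ ((union I J)ᶜ : Finset (Fin n))) :=
  interior {w | incl (union I J)ᶜ w ∈ closure S.carrier}

/-- `S'` is properly contained in `S`: `ε' < ε`, `U'` is relatively compact in `U`, and the closure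
of each `G'_j` is contained in `G_j` up to the origin. -/
structure ProperlyContained (S' S : MultiCone I) : Prop where
  ε_lt : S'.ε < S.ε
  isCompact_closure_U : IsCompact (closure S'.U)
  closure_U_subset : closure S'.U ⊆ S.U
  closure_G_subset : ∀ j,
    closure (S'.G j : Set (EuclideanSpace ℂ (hat I j))) \ {0} ⊆ (S.G j : Set _)

end MultiCone

/-! ### Multi-asymptotic expansions -/

section Expansion

variable {n ℓ : ℕ} (I : Fin ℓ → Finset (Fin n))

/-- The multi-indices `α ∈ ℤ_{≥0}^{I_J}` with `∑_{i ∈ I_j} α_i = β_j` for all `j ∈ J`.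
(The upper bound only serves to get a finite set; it follows from the other conditions.) -/
noncomputable def indices (J : Finset (Fin ℓ)) (b : Fin ℓ → ℕ) : Finset (Fin n →₀ ℕ) :=
  (Finset.Iic (Finsupp.equivFunOnFinite.symm fun i => if i ∈ union I J then ∑ j, b j else 0)).filter
    fun α => ∀ j ∈ J, ∑ i ∈ I j, α i = b j

/-- The polynomial `T_J^β(z)` in the variables `z_i`, `i ∈ I_J`. As `eval_taylorPoly` below shows,
it is `(1/β!) exp(-μ(z, λ)) ∂_λ^β exp(μ(z, λ))` at the point `λ` with `λ_j = 0` for `j ∈ J` and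
`λ_j = 1` for `j ∉ J`, where `exp(z_1, …, z_n) = e^{z_1} ⋯ e^{z_n}`. -/
noncomputable def taylorPoly (J : Finset (Fin ℓ)) (b : Fin ℓ → ℕ) : MvPolynomial (Fin n) ℂ :=
  ∑ α ∈ indices I J b, MvPolynomial.monomial α (∏ i, ((α i).factorial : ℂ))⁻¹

section Formula

variable {I}

theorem mem_indices {J : Finset (Fin ℓ)} {b : Fin ℓ → ℕ} {α : Fin n →₀ ℕ} :
    α ∈ indices I J b ↔ α.support ⊆ union I J ∧ ∀ j ∈ J, ∑ i ∈ I j, α i = b j := by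
  simp only [indices, Finset.mem_filter, Finset.mem_Iic]
  refine and_congr_left fun h => ?_
  constructor
  · intro hle i hi
    by_contra hn
    have := hle i
    simp [hn] at this
    simp [this] at hi
  · intro hs i
    simp only [Finsupp.equivFunOnFinite_symm_apply_apply]
    split_ifs with hi
    · obtain ⟨j, hj, hij⟩ := Finset.mem_biUnion.1 hi
      calc α i ≤ ∑ i ∈ I j, α i := Finset.single_le_sum (fun _ _ => Nat.zero_le _) hij
        _ = b j := h j hj
        _ ≤ ∑ j, b j := Finset.single_le_sum (fun _ _ => Nat.zero_le _) (Finset.mem_univ j)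
    · have : i ∉ α.support := fun h' => hi (hs h')
      simpa using this

theorem iterate_pderiv {m : ℕ} (i : Fin m) (b : ℕ) (g : EuclideanSpace ℂ (Fin m) → ℂ)
    (x : EuclideanSpace ℂ (Fin m)) :
    (pderiv i)^[b] g x = iteratedDeriv b (fun t : ℂ => g (x + t • EuclideanSpace.single i 1)) 0 := by
  induction b generalizing x with
  | zero => simp
  | succ b ih =>
    rw [Function.iterate_succ_apply', pderiv, lineDeriv, iteratedDeriv_succ]
    congr 1
    funext t
    rw [ih]
    have := congrFun (iteratedDeriv_comp_add_const b
      (fun t : ℂ => g (x + t • EuclideanSpace.single i 1)) t) 0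
    simp only [zero_add] at this
    rw [← this]
    congr 1
    funext s
    rw [add_smul, add_assoc, add_comm (s • _)]

theorem iteratedDeriv_pow_mul_exp (b m : ℕ) (R B : ℂ) :
    iteratedDeriv b (fun t : ℂ => t ^ m * Complex.exp (R + t * B)) 0 =
      if m ≤ b then b.factorial * (Complex.exp R * (B ^ (b - m) / (b - m).factorial)) else 0 := by
  have h1 : (fun t : ℂ => t ^ m * Complex.exp (R + t * B)) =
      fun t => Complex.exp R * (t ^ m * Complex.exp (B * t)) := by
    funext t; rw [Complex.exp_add, mul_comm t B]; ring
  rw [h1, iteratedDeriv_const_mul_field, iteratedDeriv_fun_mul (by fun_prop) (by fun_prop)]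
  simp only [iteratedDeriv_fun_pow_zero, iteratedDeriv_cexp_const_mul, mul_zero, Complex.exp_zero,
    mul_one]
  split_ifs with h
  · rw [Finset.sum_eq_single m]
    · have h2 : ((b.choose m : ℂ) * m.factorial) = b.factorial / (b - m).factorial := by
        rw [eq_div_iff (by exact_mod_cast (b - m).factorial_ne_zero)]
        exact_mod_cast Nat.choose_mul_factorial_mul_factorial h
      simp only [if_true]
      rw [h2]; ring
    · intro k _ hk; simp [hk]
    · intro hk; simp at hk; omega
  · rw [Finset.sum_eq_zero, mul_zero]
    intro k hk
    have : k ≠ m := by simp at hk; omega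
    simp [this]

theorem sum_pow_div (s : Finset (Fin n)) (f : Fin n → ℂ) (m : ℕ) :
    (∑ i ∈ s, f i) ^ m / (m.factorial : ℂ) =
      ∑ γ ∈ Finset.piAntidiag s m, ∏ i ∈ s, f i ^ γ i / ((γ i).factorial : ℂ) := by
  rw [Finset.sum_pow_eq_sum_piAntidiag, Finset.sum_div]
  refine Finset.sum_congr rfl fun γ hγ => ?_
  have h := Nat.multinomial_spec s γ
  rw [(Finset.mem_piAntidiag.1 hγ).1] at h
  rw [Finset.prod_div_distrib, div_eq_div_iff (by exact_mod_cast m.factorial_ne_zero)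
    (Finset.prod_ne_zero_iff.2 fun i _ => by exact_mod_cast (γ i).factorial_ne_zero), ← h]
  push_cast; ring

theorem sum_indices_insert {J : Finset (Fin ℓ)} {j : Fin ℓ} {b : Fin ℓ → ℕ}
    (h : (Fin n →₀ ℕ) → ℂ) :
    ∑ α ∈ indices I (insert j J) b, h α =
      ∑ α ∈ indices I J b, if ∑ i ∈ I j, α i ≤ b j then
        ∑ γ ∈ Finset.piAntidiag (I j \ union I J) (b j - ∑ i ∈ I j, α i),
          h (α + Finsupp.equivFunOnFinite.symm γ) else 0 := by
  rw [← Finset.sum_filter, Finset.sum_sigma']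
  symm
  refine Finset.sum_bij' (fun x _ => x.1 + Finsupp.equivFunOnFinite.symm x.2)
    (fun α _ => ⟨α.filter (· ∈ union I J), fun i => if i ∈ I j \ union I J then α i else 0⟩)
    ?_ ?_ ?_ ?_ ?_
  · rintro ⟨α, γ⟩ hx
    simp only [Finset.mem_sigma, Finset.mem_filter, mem_indices, Finset.mem_piAntidiag] at hx
    obtain ⟨⟨⟨hs, hJ⟩, hle⟩, hsum, hγ⟩ := hx
    rw [mem_indices]
    refine ⟨fun i hi => ?_, fun k hk => ?_⟩
    · by_cases hα : α i = 0
      · have : γ i ≠ 0 := by simpa [hα] using hi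
        have := hγ i this
        simp only [Finset.mem_sdiff] at this
        exact Finset.mem_biUnion.2 ⟨j, by simp, this.1⟩
      · obtain ⟨k, hk, hik⟩ := Finset.mem_biUnion.1 (hs (Finsupp.mem_support_iff.2 hα))
        exact Finset.mem_biUnion.2 ⟨k, by simp [hk], hik⟩
    · simp only [Finsupp.coe_add, Pi.add_apply, Finsupp.equivFunOnFinite_symm_apply_apply,
        Finset.sum_add_distrib]
      by_cases hkJ : k ∈ J
      · rw [hJ k hkJ, Finset.sum_eq_zero, add_zero]
        intro i hi
        by_contra h0
        have := hγ i h0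
        simp only [Finset.mem_sdiff] at this
        exact this.2 (Finset.mem_biUnion.2 ⟨k, hkJ, hi⟩)
      · obtain rfl : k = j := by simpa [hkJ] using hk
        have : ∑ i ∈ I k, γ i = ∑ i ∈ I k \ union I J, γ i := by
          symm
          apply Finset.sum_subset Finset.sdiff_subset
          intro i _ hi
          by_contra h0
          exact hi (hγ i h0)
        rw [this, hsum]; omega
  · intro α hα
    rw [mem_indices] at hα
    obtain ⟨hs, hJ⟩ := hα
    have key : ∑ i ∈ I j, α i = ∑ i ∈ I j, (α.filter (· ∈ union I J)) i +
        ∑ i ∈ I j \ union I J, α i := by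
      have : ∑ i ∈ I j, (α.filter (· ∈ union I J)) i = ∑ i ∈ I j ∩ union I J, α i := by
        rw [← Finset.filter_mem_eq_inter, Finset.sum_filter]
        exact Finset.sum_congr rfl fun i _ => Finsupp.filter_apply _ _ _
      rw [this, add_comm, ← Finset.sum_union (Finset.disjoint_left.2 fun i hi hi' =>
        (Finset.mem_sdiff.1 hi).2 (Finset.mem_inter.1 hi').2), Finset.sdiff_union_inter]
    have hj := hJ j (by simp)
    simp only [Finset.mem_sigma, Finset.mem_filter, mem_indices, Finset.mem_piAntidiag]
    refine ⟨⟨⟨?_, ?_⟩, by omega⟩, ?_, ?_⟩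
    · intro i hi
      simp [Finsupp.support_filter] at hi
      exact hi.2
    · intro k hk
      rw [← hJ k (by simp [hk])]
      refine Finset.sum_congr rfl fun i hi => ?_
      rw [Finsupp.filter_apply_pos]
      exact Finset.mem_biUnion.2 ⟨k, hk, hi⟩
    · rw [Finset.sum_congr rfl fun i hi => if_pos hi, ← hj, key]
      exact (Nat.add_sub_cancel_left _ _).symm
    · intro i hi
      by_contra h0
      simp [h0] at hi
  · rintro ⟨α, γ⟩ hx
    simp only [Finset.mem_sigma, Finset.mem_filter, mem_indices, Finset.mem_piAntidiag] at hx
    obtain ⟨⟨⟨hs, hJ⟩, hle⟩, hsum, hγ⟩ := hx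
    have hα0 : ∀ i, i ∉ union I J → α i = 0 := fun i hi => by
      by_contra h0; exact hi (hs (Finsupp.mem_support_iff.2 h0))
    have hγ0 : ∀ i, i ∉ I j \ union I J → γ i = 0 := fun i hi => by
      by_contra h0; exact hi (hγ i h0)
    refine Sigma.ext ?_ (heq_of_eq ?_)
    · ext i
      by_cases hi : i ∈ union I J
      · simp [hi, hγ0 i (by simp [hi])]
      · simp [hi, hα0 i hi]
    · funext i
      by_cases hi : i ∈ I j \ union I J
      · simp only [if_pos hi]
        simp [hα0 i (Finset.mem_sdiff.1 hi).2]
      · simp only [if_neg hi]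
        exact (hγ0 i hi).symm
  · intro α hα
    rw [mem_indices] at hα
    obtain ⟨hs, hJ⟩ := hα
    ext i
    by_cases hi : i ∈ union I J
    · simp [hi]
    · by_cases hij : i ∈ I j
      · simp [hi, hij]
      · have : α i = 0 := by
          by_contra h0
          obtain ⟨k, hk, hik⟩ := Finset.mem_biUnion.1 (hs (Finsupp.mem_support_iff.2 h0))
          rcases Finset.mem_insert.1 hk with rfl | hk
          · exact hij hik
          · exact hi (Finset.mem_biUnion.2 ⟨k, hk, hik⟩)
        simp [hi, hij, this]
  · intro x _; rfl

theorem listPartial_exp_mu (z : EuclideanSpace ℂ (Fin n)) (b : Fin ℓ → ℕ) (L : List (Fin ℓ))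
    (hL : L.Nodup) (lam : EuclideanSpace ℂ (Fin ℓ)) (h0 : ∀ j ∈ L, lam j = 0) :
    listPartial L b (fun x => Complex.exp (∑ i, mu I z x i)) lam =
      (∏ j ∈ L.toFinset, ((b j).factorial : ℂ)) *
      ((∑ α ∈ indices I L.toFinset b, (∏ i, z i ^ α i / ((α i).factorial : ℂ)) *
        ∏ k ∈ (L.toFinset)ᶜ, lam k ^ (∑ i ∈ I k, α i)) *
      Complex.exp (∑ i ∈ (union I L.toFinset)ᶜ, mu I z lam i)) := by
  induction L generalizing lam with
  | nil =>
    have : indices I ∅ b = {0} := by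
      ext α
      simp [mem_indices, union]
    simp [listPartial, this, union]
  | cons j L ih =>
    rw [List.nodup_cons] at hL
    have hjJ : j ∉ L.toFinset := by simpa using hL.1
    set J := L.toFinset with hJ
    have hcons : (j :: L).toFinset = insert j J := by simp [hJ]
    have hj0 : lam j = 0 := h0 j (by simp)
    set q : Fin n → ℂ := fun i =>
      ∏ k ∈ (Finset.univ.filter (fun k => i ∈ I k)).erase j, lam k with hq
    have hcompl : Jᶜ = insert j (insert j J)ᶜ := by
      ext k; by_cases hk : k = j
      · subst hk; simp [hjJ]
      · simp [hk]
    have hlam : ∀ (t : ℂ) k, (lam + t • EuclideanSpace.single j (1 : ℂ)) k =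
        if k = j then t else lam k := by
      intro t k
      by_cases hk : k = j
      · subst hk; simp [hj0]
      · simp [hk]
    have hmu : ∀ (t : ℂ) i, mu I z (lam + t • EuclideanSpace.single j (1 : ℂ)) i =
        if i ∈ I j then t * (q i * z i) else mu I z lam i := by
      intro t i
      simp only [mu, hlam]
      split_ifs with hi
      · rw [← Finset.mul_prod_erase _ _ (by simpa using hi : j ∈ Finset.univ.filter (i ∈ I ·))]
        rw [Finset.prod_congr rfl fun k hk => if_neg (Finset.ne_of_mem_erase hk)]
        simp [hq]; ring
      · congr 1
        refine Finset.prod_congr rfl fun k hk => if_neg ?_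
        rintro rfl
        exact hi (by simpa using hk)
    have hunion : (union I J)ᶜ = (I j \ union I J) ∪ (union I (insert j J))ᶜ := by
      ext i; simp only [union, Finset.biUnion_insert, Finset.mem_compl, Finset.mem_union,
        Finset.mem_sdiff]; tauto
    have hdisj : Disjoint (I j \ union I J) (union I (insert j J))ᶜ := by
      rw [Finset.disjoint_left]; intro i
      simp only [union, Finset.biUnion_insert, Finset.mem_compl, Finset.mem_union,
        Finset.mem_sdiff]; tauto
    have hsum : ∀ t : ℂ, ∑ i ∈ (union I J)ᶜ,
        mu I z (lam + t • EuclideanSpace.single j (1 : ℂ)) i =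
        ∑ i ∈ (union I (insert j J))ᶜ, mu I z lam i + t * ∑ i ∈ I j \ union I J, q i * z i := by
      intro t
      rw [hunion, Finset.sum_union hdisj, add_comm, Finset.mul_sum]
      congr 1
      · refine Finset.sum_congr rfl fun i hi => ?_
        rw [hmu, if_neg]
        simp only [union, Finset.biUnion_insert, Finset.mem_compl, Finset.mem_union] at hi; tauto
      · refine Finset.sum_congr rfl fun i hi => ?_
        rw [hmu, if_pos (Finset.mem_sdiff.1 hi).1]
    have hstep : listPartial (j :: L) b (fun x => Complex.exp (∑ i, mu I z x i)) =
        (pderiv j)^[b j] (listPartial L b (fun x => Complex.exp (∑ i, mu I z x i))) := rfl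
    have hfun : (fun t : ℂ => listPartial L b (fun x => Complex.exp (∑ i, mu I z x i))
        (lam + t • EuclideanSpace.single j 1)) = fun t =>
        (∏ k ∈ J, ((b k).factorial : ℂ)) * ∑ α ∈ indices I J b,
          ((∏ i, z i ^ α i / ((α i).factorial : ℂ)) *
            ∏ k ∈ (insert j J)ᶜ, lam k ^ (∑ i ∈ I k, α i)) *
          (t ^ (∑ i ∈ I j, α i) * Complex.exp (∑ i ∈ (union I (insert j J))ᶜ, mu I z lam i +
            t * ∑ i ∈ I j \ union I J, q i * z i)) := by
      funext t
      rw [ih hL.2 _ fun k hk => by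
        rw [hlam, if_neg (by rintro rfl; exact hL.1 hk)]; exact h0 k (by simp [hk])]
      rw [hsum, Finset.sum_mul]
      congr 1
      refine Finset.sum_congr rfl fun α _ => ?_
      rw [hcompl, Finset.prod_insert (by simp), hlam, if_pos rfl]
      have e0 : ∏ k ∈ (insert j J)ᶜ,
          (lam + t • EuclideanSpace.single j (1 : ℂ)) k ^ (∑ i ∈ I k, α i) =
          ∏ k ∈ (insert j J)ᶜ, lam k ^ (∑ i ∈ I k, α i) :=
        Finset.prod_congr rfl fun k hk => by
          rw [hlam, if_neg (by rintro rfl; simp at hk)]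
      rw [e0]
      ring
    rw [hstep, iterate_pderiv, hfun, iteratedDeriv_const_mul_field,
      iteratedDeriv_fun_sum (fun α _ => by fun_prop)]
    simp only [iteratedDeriv_const_mul_field, iteratedDeriv_pow_mul_exp]
    rw [hcons, Finset.prod_insert hjJ, sum_indices_insert, Finset.mul_sum, Finset.sum_mul,
      Finset.mul_sum]
    refine Finset.sum_congr rfl fun α hα => ?_
    split_ifs with hle
    · rw [sum_pow_div, Finset.mul_sum, Finset.mul_sum, Finset.mul_sum, Finset.mul_sum,
        Finset.sum_mul, Finset.mul_sum]
      refine Finset.sum_congr rfl fun γ hγ => ?_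
      rw [mem_indices] at hα
      rw [Finset.mem_piAntidiag] at hγ
      have hα0 : ∀ i, i ∉ union I J → α i = 0 := fun i hi => by
        by_contra h0; exact hi (hα.1 (Finsupp.mem_support_iff.2 h0))
      have hγ0 : ∀ i, i ∉ I j \ union I J → γ i = 0 := fun i hi => by
        by_contra h0; exact hi (hγ.2 i h0)
      have e1 : ∏ i, z i ^ (α + Finsupp.equivFunOnFinite.symm γ) i /
          (((α + Finsupp.equivFunOnFinite.symm γ) i).factorial : ℂ) =
          (∏ i, z i ^ α i / ((α i).factorial : ℂ)) *
            ∏ i ∈ I j \ union I J, z i ^ γ i / ((γ i).factorial : ℂ) := by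
        rw [Finset.prod_subset (Finset.subset_univ (I j \ union I J))
          (fun i _ hi => by simp [hγ0 i hi]), ← Finset.prod_mul_distrib]
        refine Finset.prod_congr rfl fun i _ => ?_
        by_cases hi : i ∈ I j \ union I J
        · simp [hα0 i (Finset.mem_sdiff.1 hi).2]
        · simp [hγ0 i hi]
      have e2 : ∏ k ∈ (insert j J)ᶜ,
          lam k ^ (∑ i ∈ I k, (α + Finsupp.equivFunOnFinite.symm γ) i) =
          (∏ k ∈ (insert j J)ᶜ, lam k ^ (∑ i ∈ I k, α i)) *
            ∏ i ∈ I j \ union I J, q i ^ γ i := by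
        simp only [Finsupp.coe_add, Pi.add_apply, Finsupp.equivFunOnFinite_symm_apply_apply,
          Finset.sum_add_distrib, pow_add, Finset.prod_mul_distrib]
        congr 1
        have e3 : ∀ k, lam k ^ (∑ i ∈ I k, γ i) =
            ∏ i ∈ I j \ union I J, if i ∈ I k then lam k ^ γ i else 1 := by
          intro k
          rw [← Finset.prod_pow_eq_pow_sum, ← Finset.prod_filter]
          symm
          apply Finset.prod_subset
          · intro i hi; exact (Finset.mem_filter.1 hi).2
          · intro i hik hi
            rw [hγ0 i fun h => hi (Finset.mem_filter.2 ⟨h, hik⟩), pow_zero]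
        simp only [e3]
        rw [Finset.prod_comm]
        refine Finset.prod_congr rfl fun i hi => ?_
        rw [← Finset.prod_filter, hq, ← Finset.prod_pow]
        refine Finset.prod_congr ?_ fun _ _ => rfl
        ext k
        simp only [Finset.mem_filter, Finset.mem_compl, Finset.mem_insert, Finset.mem_erase,
          Finset.mem_univ, true_and]
        have : i ∈ I k → k ∉ J := fun hik hkJ =>
          (Finset.mem_sdiff.1 hi).2 (Finset.mem_biUnion.2 ⟨k, hkJ, hik⟩)
        tauto
      rw [e1, e2]
      simp only [mul_pow, Finset.prod_mul_distrib, Finset.prod_div_distrib]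
      ring
    · simp


theorem listPartial_filter {m : ℕ} (L : List (Fin m)) (J : Finset (Fin m)) (b : Fin m → ℕ)
    (hb : ∀ j ∉ J, b j = 0) (g : EuclideanSpace ℂ (Fin m) → ℂ) :
    listPartial L b g = listPartial (L.filter (· ∈ J)) b g := by
  induction L with
  | nil => rfl
  | cons j L ih =>
    change (pderiv j)^[b j] (listPartial L b g) = _
    rw [ih]
    by_cases hj : j ∈ J
    · rw [List.filter_cons_of_pos (by simpa using hj)]; rfl
    · rw [List.filter_cons_of_neg (by simpa using hj), hb j hj]; rfl

variable (I) in
/-- The polynomial `T_J^β` is `(1/β!) exp(-μ(z, λ)) ∂_λ^β exp(μ(z, λ))`, evaluated at the point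
`λ` with `λ_j = 0` for `j ∈ J` and `λ_j = 1` for `j ∉ J`. -/
theorem eval_taylorPoly (J : Finset (Fin ℓ)) (b : Fin ℓ → ℕ) (hb : ∀ j ∉ J, b j = 0)
    (z : EuclideanSpace ℂ (Fin n)) (e : EuclideanSpace ℂ (Fin ℓ))
    (he : ∀ j, e j = if j ∈ J then 0 else 1) :
    MvPolynomial.eval (fun i => z i) (taylorPoly I J b) =
      (∏ j, ((b j).factorial : ℂ))⁻¹ * Complex.exp (-∑ i, mu I z e i) *
        mixedPartial b (fun lam => Complex.exp (∑ i, mu I z lam i)) e := by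
  have hJ : ((List.finRange ℓ).filter (· ∈ J)).toFinset = J := by ext; simp
  rw [mixedPartial, listPartial_filter _ J b hb, listPartial_exp_mu z b _
    ((List.nodup_finRange ℓ).filter _) e (fun j hj => by
      rw [he, if_pos (by simpa using hj)]), hJ]
  have h1 : ∑ i ∈ (union I J)ᶜ, mu I z e i = ∑ i, mu I z e i := by
    refine Finset.sum_subset (Finset.subset_univ _) fun i _ hi => ?_
    simp only [Finset.mem_compl, not_not] at hi
    obtain ⟨j, hj, hij⟩ := Finset.mem_biUnion.1 hi
    simp only [mu]
    rw [Finset.prod_eq_zero (by simpa using hij : j ∈ Finset.univ.filter (i ∈ I ·))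
      (by rw [he, if_pos hj]), zero_mul]
  have h2 : ∏ j ∈ J, ((b j).factorial : ℂ) = ∏ j, ((b j).factorial : ℂ) :=
    Finset.prod_subset (Finset.subset_univ _) fun j _ hj => by simp [hb j hj]
  have h3 : (∏ j, ((b j).factorial : ℂ)) ≠ 0 :=
    Finset.prod_ne_zero_iff.2 fun j _ => by exact_mod_cast (b j).factorial_ne_zero
  have h4 : ∀ α : Fin n →₀ ℕ, ∏ k ∈ Jᶜ, e k ^ (∑ i ∈ I k, α i) = 1 := fun α =>
    Finset.prod_eq_one fun k hk => by rw [he, if_neg (Finset.mem_compl.1 hk), one_pow]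
  rw [h1, h2]
  simp only [h4, mul_one]
  set E := ∑ i, mu I z e i
  set P := ∏ j, ((b j).factorial : ℂ)
  have h5 : ∀ A : ℂ, P⁻¹ * Complex.exp (-E) * (P * (A * Complex.exp E)) = A := by
    intro A
    have : Complex.exp (-E) * Complex.exp E = 1 := by rw [← Complex.exp_add]; simp
    calc _ = (P⁻¹ * P) * A * (Complex.exp (-E) * Complex.exp E) := by ring
      _ = A := by rw [this, inv_mul_cancel₀ h3]; ring
  rw [h5, taylorPoly, map_sum]
  refine Finset.sum_congr rfl fun α _ => ?_
  rw [MvPolynomial.eval_monomial, Finsupp.prod_fintype _ _ (by simp), Finset.prod_div_distrib]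
  ring

end Formula

/-- The multi-indices `β ∈ ℤ_{≥0}^J` with `β_j < n_j` for all `j ∈ J`. -/
def indicesLT (J : Finset (Fin ℓ)) (N : Fin ℓ → ℕ) : Finset (Fin ℓ → ℕ) :=
  Fintype.piFinset fun j => if j ∈ J then Finset.range (N j) else {0}

/-- A family `{f_{J,α}}` of functions on `Z_J`, identified with the space of the coordinates outside
`I_J`. Only the indices with `J ≠ ∅` and `α ∈ ℤ_{≥0}^{I_J}` are relevant, and only the values of
`f_{J,α}` on `S_J`. -/
abbrev CoeffFamily : Type :=
  (J : Finset (Fin ℓ)) → (Fin n →₀ ℕ) → EuclideanSpace ℂ ((union I J)ᶜ : Finset (Fin n)) → ℂ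

variable {I}

/-- `F` is a total family of coefficients of multi-asymptotic expansion on `S`: each `f_{J,α}` is
holomorphic on `S_J`. -/
def IsTotalFamily (S : MultiCone I) (F : CoeffFamily I) : Prop :=
  ∀ J : Finset (Fin ℓ), J.Nonempty → ∀ α : Fin n →₀ ℕ, α.support ⊆ union I J →
    DifferentiableOn ℂ (F J α) (S.face J)

/-- `τ_{F,J}(p)`: each monomial `z^α` of the polynomial `p` is replaced by
`f_{J,α}(z_{I_J^c}) z^α`. -/
noncomputable def tau (F : CoeffFamily I) (J : Finset (Fin ℓ)) (p : MvPolynomial (Fin n) ℂ)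
    (z : EuclideanSpace ℂ (Fin n)) : ℂ :=
  ∑ α ∈ p.support, p.coeff α * F J α (proj (union I J)ᶜ z) * ∏ i, z i ^ α i

/-- `T_J^{<N}(F; z)`, the sum of `T_J^β(F; z) = τ_{F,J}(T_J^β)(z)` over `β ∈ ℤ_{≥0}^J` with
`β_j < n_j` for all `j ∈ J`. -/
noncomputable def taylorSum (F : CoeffFamily I) (J : Finset (Fin ℓ)) (N : Fin ℓ → ℕ)
    (z : EuclideanSpace ℂ (Fin n)) : ℂ :=
  ∑ b ∈ indicesLT J N, tau F J (taylorPoly I J b) z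

/-- `App^{<N}(F; z) = ∑_{J ≠ ∅} (-1)^{#J+1} T_J^{<N}(F; z)`. -/
noncomputable def App (F : CoeffFamily I) (N : Fin ℓ → ℕ) (z : EuclideanSpace ℂ (Fin n)) : ℂ :=
  ∑ J ∈ Finset.univ.filter (fun J : Finset (Fin ℓ) => J.Nonempty),
    (-1) ^ (J.card + 1) * taylorSum F J N z

variable (I) in
open Classical in
/-- `w_j(N) = n_j - ∑_k n_k`, the sum over the `k` for which `Z_k` is minimal among the submanifolds
of the family strictly containing `Z_j`. -/
noncomputable def weight (j : Fin ℓ) (N : Fin ℓ → ℕ) : ℤ :=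
  (N j : ℤ) - ∑ k ∈ Finset.univ.filter
    (fun k => Z I j ⊂ Z I k ∧ ¬ ∃ m, Z I j ⊂ Z I m ∧ Z I m ⊂ Z I k), (N k : ℤ)

/-- `f` is multi-asymptotically developable along `Z_1 ∪ ⋯ ∪ Z_ℓ` on `S`. -/
def Developable (S : MultiCone I) (f : EuclideanSpace ℂ (Fin n) → ℂ) : Prop :=
  ∃ F : CoeffFamily I, IsTotalFamily S F ∧
    ∀ S' : MultiCone I, S'.ProperlyContained S → ∀ N : Fin ℓ → ℕ,
      ∃ C : ℝ, 0 < C ∧ ∀ z ∈ S'.carrier,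
        ‖f z - App F N z‖ ≤ C * ∏ j, Metric.infDist z (Z I j) ^ weight I j N

/-- All derivatives of `f` are bounded on every multi-cone properly contained in `S`. -/
def DerivativesBounded (S : MultiCone I) (f : EuclideanSpace ℂ (Fin n) → ℂ) : Prop :=
  ∀ S' : MultiCone I, S'.ProperlyContained S → ∀ α : Fin n → ℕ,
    ∃ C : ℝ, ∀ z ∈ S'.carrier, ‖mixedPartial α f z‖ ≤ C

/-- On every multi-cone properly contained in `S`, the function `f` extends to a `C^∞` function on
the real manifold underlying `ℂ^n`. -/
def SmoothlyExtendable (S : MultiCone I) (f : EuclideanSpace ℂ (Fin n) → ℂ) : Prop :=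
  ∀ S' : MultiCone I, S'.ProperlyContained S →
    ∃ φ : EuclideanSpace ℂ (Fin n) → ℂ, ContDiff ℝ ∞ φ ∧ Set.EqOn φ f S'.carrier

end Expansion

end MultiAsymptotic

/-!
Write `ρ_j` for the ratio of `|z_{Î_j}|` to `|z_{Î_k}|`, `I_k` being the smallest index set strictly
containing `I_j` (or for `|z_{Î_j}|` alone if there is none). On a multi-cone `dist(z, Z_j)` is
comparable with `|z_{Î_j}|`, so that `∏_j dist(z, Z_j)^{w_j(N)}` is comparable with the monomial
`∏_j ρ_j^{n_j}` in bounded quantities (`MultiCone.prod_infDist_comparable`,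
`MultiCone.prod_norm_zpow_weight`, `MultiCone.ratio_le`). The equivalence is proved as a cycle.

*Developable implies bounded derivatives.* The remainder `f - App^{<N}` satisfies the weighted bound
for every `N`, hence so do its iterated differences with respect to the `n_j`, `j ∈ J`
(`remainder_insert`, `weightedBound_remainder`). Such a difference is `T_J^N` plus terms that only
involve the `f_{K, α}` with `K ⊋ J`. By Cauchy's estimates, differentiation with respect to `z_i`,
`i ∈ Î_b`, costs a factor `|z_{Î_b}|` (`WeightedBound.pderiv`). If `n_j` is the total order of a
derivative in the variables of `I_j`, then `w_j(N)` is its total order in those of `Î_j`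
(`Admissible.weight_sum`), so this derivative of the difference is bounded. On the other hand it
reproduces a given derivative of the coefficient `f_{J, α}` (`wordDeriv_taylorTerm`). Downward
induction on `J` shows that all derivatives of the coefficients are bounded (`boundedDerivs_coeff`);
for `J = ∅`, with `f_{∅, 0} = f`, this is the claim.

*Bounded derivatives imply extendable.* A multi-cone properly contained in another one is pushed
into the interior of the larger one by small translations along a fixed vector
(`MultiCone.ProperlyContained.exists_push`). A function with bounded derivatives then extends: the
Taylor polynomials at the translated points are patched together by cutoff functions living at the
scale of the translation (`exists_contDiff_extension`).

*Extendable implies developable.* The coefficients are the boundary values of the derivatives of `f`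
on the faces, computed from the extensions `φ` (`SmoothlyExtendable.exists_boundaryValues`); the
faces are the projections of the multi-cone (`MultiCone.face_eq_image`). Then `App^{<N}` consists of
the partial Taylor polynomials of `σ ↦ φ(μ(z, σ))` at `σ_j = 0`, evaluated at `σ = (1, …, 1)`
(`taylorOp_scaleTaylor`), and by inclusion-exclusion `f - App^{<N}` is the multiple Taylor remainder
(`remList_eq_sum`, `sub_App_eq_sum`). It is bounded by the mixed derivative of order `N` on the unit
box (`norm_remList_le`). Since `μ(z, σ) = μ(z̃, ρσ)` with `z̃` bounded
(`MultiCone.scale_ratio_normalized`), the chain rule produces the factor `∏_j ρ_j^{n_j}`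
(`MultiCone.norm_foldl_dirDeriv_scale_le`).
-/

namespace MultiAsymptotic

/-! ### Holomorphic functions of several variables -/

section Holomorphic

open Metric

variable {m : ℕ} {U : Set (EuclideanSpace ℂ (Fin m))} {f g : EuclideanSpace ℂ (Fin m) → ℂ}

theorem differentiableOn_comp_line {E : Type*} [NormedAddCommGroup E] [NormedSpace ℂ E] {U : Set E}
    {f : E → ℂ} (hf : DifferentiableOn ℂ f U) (z v : E) :
    DifferentiableOn ℂ (fun ζ : ℂ => f (z + ζ • v)) {ζ | z + ζ • v ∈ U} :=
  hf.comp (by fun_prop) fun _ h => h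

theorem deriv_comp_line {E : Type*} [NormedAddCommGroup E] [NormedSpace ℂ E] {U : Set E}
    (hU : IsOpen U) {f : E → ℂ} (hf : DifferentiableOn ℂ f U) {z : E} (v : E) (hz : z ∈ U) :
    deriv (fun ζ : ℂ => f (z + ζ • v)) 0 = fderiv ℂ f z v :=
  ((hf.differentiableAt (hU.mem_nhds hz)).lineDeriv_eq_fderiv (v := v))

/-- Cauchy's estimate along a complex line. -/
theorem norm_fderiv_apply_le {E : Type*} [NormedAddCommGroup E] [NormedSpace ℂ E] {U : Set E}
    (hU : IsOpen U) {f : E → ℂ} (hf : DifferentiableOn ℂ f U) {z v : E} {r C : ℝ} (hr : 0 < r)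
    (hz : ∀ ζ : ℂ, ‖ζ‖ ≤ r → z + ζ • v ∈ U) (hC : ∀ ζ : ℂ, ‖ζ‖ ≤ r → ‖f (z + ζ • v)‖ ≤ C) :
    ‖fderiv ℂ f z v‖ ≤ C / r := by
  have h0 : z ∈ U := by simpa using hz 0 (by simpa using hr.le)
  rw [← deriv_comp_line hU hf v h0]
  refine Complex.norm_deriv_le_of_forall_mem_sphere_norm_le hr ?_ fun ζ hζ => hC ζ ?_
  · refine DifferentiableOn.diffContOnCl ?_
    rw [closure_ball _ hr.ne']
    exact (differentiableOn_comp_line hf z v).mono fun ζ hζ => hz ζ (by simpa using hζ)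
  · simpa using (mem_sphere_zero_iff_norm.1 hζ).le

/-- Cauchy's formula for a directional derivative, on a circle of fixed radius. -/
theorem fderiv_apply_eq_circleIntegral {E : Type*} [NormedAddCommGroup E] [NormedSpace ℂ E]
    {U : Set E} (hU : IsOpen U) {f : E → ℂ} (hf : DifferentiableOn ℂ f U) {z v : E} {r : ℝ}
    (hr : 0 < r) (hz : ∀ ζ : ℂ, ‖ζ‖ ≤ r → z + ζ • v ∈ U) :
    fderiv ℂ f z v = ∫ θ in (0 : ℝ)..2 * Real.pi,
      ((2 * Real.pi * Complex.I : ℂ)⁻¹ * deriv (circleMap 0 r) θ * (circleMap 0 r θ ^ 2)⁻¹) *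
        f (z + circleMap 0 r θ • v) := by
  have h0 : z ∈ U := by simpa using hz 0 (by simpa using hr.le)
  have hV : IsOpen {ζ : ℂ | z + ζ • v ∈ U} := hU.preimage (by fun_prop)
  have := Complex.two_pi_I_inv_smul_circleIntegral_sub_sq_inv_smul_of_differentiable hV
    (c := 0) (R := r) (w₀ := 0) (fun ζ hζ => hz ζ (by simpa using hζ))
    (differentiableOn_comp_line hf z v) (by simpa using hr)
  rw [← deriv_comp_line hU hf v h0, ← this, circleIntegral, smul_eq_mul,
    ← intervalIntegral.integral_const_mul]
  congr 1
  funext θ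
  simp only [smul_eq_mul, sub_zero]
  ring

/-- A complex differentiable function on an open subset of `ℂ^m` has complex differentiable
directional derivatives: differentiate Cauchy's formula on a line under the integral sign. -/
theorem differentiableOn_fderiv_apply (hU : IsOpen U) (hf : DifferentiableOn ℂ f U)
    (v : EuclideanSpace ℂ (Fin m)) : DifferentiableOn ℂ (fun z => fderiv ℂ f z v) U := by
  intro z hz
  refine DifferentiableAt.differentiableWithinAt ?_
  obtain ⟨ε, hε, hεU, M, hM⟩ : ∃ ε > 0, ball z ε ⊆ U ∧ ∃ M, ∀ y ∈ ball z ε, ‖f y‖ ≤ M := by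
    obtain ⟨ε₁, h₁, hb₁⟩ := isOpen_iff.1 hU z hz
    have hc : ContinuousAt f z := (hf.differentiableAt (hU.mem_nhds hz)).continuousAt
    obtain ⟨ε₂, h₂, hb₂⟩ := continuousAt_iff.1 hc 1 one_pos
    refine ⟨min ε₁ ε₂, lt_min h₁ h₂, (ball_subset_ball (min_le_left _ _)).trans hb₁,
      ‖f z‖ + 1, fun y hy => ?_⟩
    have := hb₂ (ball_subset_ball (min_le_right _ _) hy)
    rw [dist_eq_norm] at this
    have := norm_sub_norm_le (f y) (f z)
    linarith
  -- the circles of radius `r` around points of the ball of radius `ε / 4` stay in the ball of radius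
  -- `ε / 2`, on which the derivative of `f` is bounded by Cauchy's estimate
  set r : ℝ := ε / (4 * (‖v‖ + 1)) with hrdef
  have hv : 0 < ‖v‖ + 1 := by positivity
  have hr : 0 < r := by positivity
  have hrv : r * ‖v‖ ≤ ε / 4 := by
    rw [hrdef, div_mul_eq_mul_div, div_le_div_iff₀ (by positivity) (by norm_num)]
    nlinarith [norm_nonneg v]
  have hin : ∀ y ∈ ball z (ε / 4), ∀ ζ : ℂ, ‖ζ‖ ≤ r → y + ζ • v ∈ ball z (ε / 2) := by
    intro y hy ζ hζ
    rw [mem_ball_iff_norm] at hy ⊢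
    calc ‖y + ζ • v - z‖ = ‖(y - z) + ζ • v‖ := by congr 1; abel
      _ ≤ ‖y - z‖ + ‖ζ‖ * ‖v‖ := (norm_add_le _ _).trans (by rw [norm_smul])
      _ ≤ ‖y - z‖ + r * ‖v‖ := by gcongr
      _ < ε / 2 := by linarith
  have hhalf : ball z (ε / 2) ⊆ U := (ball_subset_ball (by linarith)).trans hεU
  have hbd : ∀ y ∈ ball z (ε / 2), ‖fderiv ℂ f y‖ ≤ M / (ε / 4) := by
    intro y hy
    have hM0 : 0 ≤ M := (norm_nonneg _).trans (hM z (mem_ball_self hε))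
    refine ContinuousLinearMap.opNorm_le_of_unit_norm (by positivity) fun w hw => ?_
    have hmem : ∀ ζ : ℂ, ‖ζ‖ ≤ ε / 4 → y + ζ • w ∈ ball z ε := by
      intro ζ hζ
      rw [mem_ball_iff_norm] at hy ⊢
      calc ‖y + ζ • w - z‖ = ‖(y - z) + ζ • w‖ := by congr 1; abel
        _ ≤ ‖y - z‖ + ‖ζ‖ * ‖w‖ := (norm_add_le _ _).trans (by rw [norm_smul])
        _ < ε := by rw [hw]; linarith
    exact norm_fderiv_apply_le hU hf (by positivity) (fun ζ hζ => hεU (hmem ζ hζ))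
      fun ζ hζ => hM _ (hmem ζ hζ)
  set k : ℝ → ℂ := fun θ =>
    (2 * Real.pi * Complex.I : ℂ)⁻¹ * deriv (circleMap 0 r) θ * (circleMap 0 r θ ^ 2)⁻¹ with hk
  have hkc : Continuous k := by
    have h1 : Continuous fun θ => circleMap 0 r θ := continuous_circleMap 0 r
    have h2 : Continuous fun θ => (circleMap 0 r θ ^ 2)⁻¹ :=
      (h1.pow 2).inv₀ fun θ => pow_ne_zero _ (circleMap_ne_center hr.ne')
    have h3 : deriv (circleMap 0 r) = fun θ => circleMap 0 r θ * Complex.I := by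
      funext θ; rw [deriv_circleMap]
    rw [hk, h3]
    exact (continuous_const.mul (h1.mul continuous_const)).mul h2
  have hcm : ∀ θ : ℝ, ‖circleMap 0 r θ‖ ≤ r := fun θ => by simp [abs_of_pos hr]
  have heq : (fun y => fderiv ℂ f y v) =ᶠ[nhds z] fun y =>
      ∫ θ in (0 : ℝ)..2 * Real.pi, k θ * f (y + circleMap 0 r θ • v) := by
    filter_upwards [ball_mem_nhds z (show 0 < ε / 4 by positivity)] with y hy
    exact fderiv_apply_eq_circleIntegral hU hf hr fun ζ hζ => hhalf (hin y hy ζ hζ)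
  refine DifferentiableAt.congr_of_eventuallyEq ?_ heq
  have hcont : ∀ y ∈ ball z (ε / 4), Continuous fun θ => k θ * f (y + circleMap 0 r θ • v) := by
    intro y hy
    refine hkc.mul ?_
    refine continuous_iff_continuousAt.2 fun θ => ?_
    have h1 : y + circleMap 0 r θ • v ∈ U := hhalf (hin y hy _ (hcm θ))
    have h2 : ContinuousAt f (y + circleMap 0 r θ • v) :=
      (hf.differentiableAt (hU.mem_nhds h1)).continuousAt
    have h3 : ContinuousAt (fun θ => y + circleMap 0 r θ • v) θ :=
      (continuous_const.add ((continuous_circleMap 0 r).smul continuous_const)).continuousAt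
    exact ContinuousAt.comp (g := f) h2 h3
  have hz4 : z ∈ ball z (ε / 4) := mem_ball_self (by positivity)
  refine HasFDerivAt.differentiableAt
    (intervalIntegral.hasFDerivAt_integral_of_dominated_of_fderiv_le
      (F' := fun y θ => k θ • fderiv ℂ f (y + circleMap 0 r θ • v))
      (bound := fun θ => ‖k θ‖ * (M / (ε / 4)))
      (ball_mem_nhds z (show 0 < ε / 4 by positivity)) ?_ ?_ ?_ ?_ ?_ ?_)
  · filter_upwards [ball_mem_nhds z (show 0 < ε / 4 by positivity)] with y hy
    exact (hcont y hy).aestronglyMeasurable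
  · exact (hcont z hz4).intervalIntegrable _ _
  · refine (hkc.aestronglyMeasurable).smul ?_
    have h1 : Measurable (fun θ : ℝ => fderiv ℂ f (z + circleMap 0 r θ • v)) :=
      (measurable_fderiv ℂ f).comp
        ((continuous_const.add ((continuous_circleMap 0 r).smul continuous_const)).measurable)
    exact h1.aestronglyMeasurable
  · refine Filter.Eventually.of_forall fun θ _ y hy => ?_
    rw [norm_smul]
    gcongr
    exact hbd _ (hin y hy _ (hcm θ))
  · exact (hkc.norm.mul continuous_const).intervalIntegrable _ _
  · refine Filter.Eventually.of_forall fun θ _ y hy => ?_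
    have h1 : y + circleMap 0 r θ • v ∈ U := hhalf (hin y hy _ (hcm θ))
    have h2 := (hf.differentiableAt (hU.mem_nhds h1)).hasFDerivAt
    have h3 : HasFDerivAt (fun y => f (y + circleMap 0 r θ • v))
        (fderiv ℂ f (y + circleMap 0 r θ • v)) y :=
      h2.comp y ((hasFDerivAt_id y).add_const _)
    exact h3.const_mul (k θ)

theorem pderiv_eq (hU : IsOpen U) (hf : DifferentiableOn ℂ f U) (i : Fin m)
    {z : EuclideanSpace ℂ (Fin m)} (hz : z ∈ U) :
    pderiv i f z = fderiv ℂ f z (EuclideanSpace.single i 1) :=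
  (hf.differentiableAt (hU.mem_nhds hz)).lineDeriv_eq_fderiv

theorem pderiv_congr (hU : IsOpen U) (hfg : Set.EqOn f g U) (i : Fin m) :
    Set.EqOn (pderiv i f) (pderiv i g) U := by
  intro z hz
  exact Filter.EventuallyEq.lineDeriv_eq (hfg.eventuallyEq_of_mem (hU.mem_nhds hz))

theorem differentiableOn_pderiv (hU : IsOpen U) (hf : DifferentiableOn ℂ f U) (i : Fin m) :
    DifferentiableOn ℂ (pderiv i f) U :=
  (differentiableOn_fderiv_apply hU hf _).congr fun _ hz => pderiv_eq hU hf i hz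

/-- Complex differentiability is inherited by the directional derivatives, hence implies smoothness. -/
theorem contDiffOn_of_differentiableOn (hU : IsOpen U) (hf : DifferentiableOn ℂ f U) :
    ContDiffOn ℂ ∞ f U := by
  refine contDiffOn_infty.2 fun k => ?_
  induction k generalizing f with
  | zero => exact contDiffOn_zero.2 hf.continuousOn
  | succ k ih =>
    rw [Nat.cast_add, Nat.cast_one, contDiffOn_succ_iff_fderiv_of_isOpen hU]
    refine ⟨hf, by simp, ?_⟩
    rw [contDiffOn_clm_apply]
    exact fun v => ih (differentiableOn_fderiv_apply hU hf v)

theorem pderiv_comm (hU : IsOpen U) (hf : DifferentiableOn ℂ f U) (i k : Fin m) :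
    Set.EqOn (pderiv i (pderiv k f)) (pderiv k (pderiv i f)) U := by
  intro z hz
  have hc : ContDiffAt ℂ ∞ f z :=
    (contDiffOn_of_differentiableOn hU hf).contDiffAt (hU.mem_nhds hz)
  have key : ∀ a b : Fin m, pderiv a (pderiv b f) z =
      fderiv ℂ (fderiv ℂ f) z (EuclideanSpace.single a 1) (EuclideanSpace.single b 1) := by
    intro a b
    rw [pderiv_eq hU (differentiableOn_pderiv hU hf b) a hz]
    have h1 : pderiv b f =ᶠ[nhds z] fun y => fderiv ℂ f y (EuclideanSpace.single b 1) := by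
      filter_upwards [hU.mem_nhds hz] with y hy using pderiv_eq hU hf b hy
    have hd : DifferentiableAt ℂ (fderiv ℂ f) z :=
      (hc.fderiv_right (m := 1) (by norm_cast)).differentiableAt (by norm_num)
    rw [h1.fderiv_eq, fderiv_clm_apply hd (differentiableAt_const _)]
    simp
  rw [key, key]
  exact (hc.isSymmSndFDerivAt (by simp; norm_cast)) _ _

/-- The iterated partial derivative `∂_i ∂_k ⋯ f` along the word `[i, k, …]`. -/
noncomputable def wordDeriv (L : List (Fin m)) (f : EuclideanSpace ℂ (Fin m) → ℂ) :
    EuclideanSpace ℂ (Fin m) → ℂ :=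
  L.foldr pderiv f

@[simp] theorem wordDeriv_nil : wordDeriv [] f = f := rfl

@[simp] theorem wordDeriv_cons (i : Fin m) (L : List (Fin m)) :
    wordDeriv (i :: L) f = pderiv i (wordDeriv L f) := rfl

theorem wordDeriv_append (L L' : List (Fin m)) :
    wordDeriv (L ++ L') f = wordDeriv L (wordDeriv L' f) := List.foldr_append

theorem differentiableOn_wordDeriv (hU : IsOpen U) (hf : DifferentiableOn ℂ f U)
    (L : List (Fin m)) : DifferentiableOn ℂ (wordDeriv L f) U := by
  induction L with
  | nil => exact hf
  | cons i L ih => exact differentiableOn_pderiv hU ih i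

theorem wordDeriv_congr (hU : IsOpen U) (hfg : Set.EqOn f g U) (L : List (Fin m)) :
    Set.EqOn (wordDeriv L f) (wordDeriv L g) U := by
  induction L with
  | nil => exact hfg
  | cons i L ih => exact pderiv_congr hU ih i

/-- The order of the differentiations does not matter for holomorphic functions. -/
theorem wordDeriv_perm (hU : IsOpen U) (hf : DifferentiableOn ℂ f U) {L L' : List (Fin m)}
    (h : L.Perm L') : Set.EqOn (wordDeriv L f) (wordDeriv L' f) U := by
  induction h with
  | nil => exact fun _ _ => rfl
  | cons i _ ih => exact pderiv_congr hU ih i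
  | swap i k L => exact pderiv_comm hU (differentiableOn_wordDeriv hU hf L) k i
  | trans _ _ ih₁ ih₂ => exact ih₁.trans ih₂

theorem wordDeriv_replicate (i : Fin m) (a : ℕ) :
    wordDeriv (List.replicate a i) f = (pderiv i)^[a] f := by
  induction a with
  | zero => rfl
  | succ a ih => rw [List.replicate_succ, wordDeriv_cons, ih, Function.iterate_succ_apply']

theorem listPartial_eq_wordDeriv (L : List (Fin m)) (α : Fin m → ℕ) :
    listPartial L α f = wordDeriv (L.flatMap fun i => List.replicate (α i) i) f := by
  induction L with
  | nil => rfl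
  | cons i L ih =>
    rw [List.flatMap_cons, wordDeriv_append, wordDeriv_replicate, ← ih]
    rfl

/-- The multi-index `α` as a word. -/
def wordOf (α : Fin m → ℕ) : List (Fin m) :=
  (List.finRange m).flatMap fun i => List.replicate (α i) i

theorem mixedPartial_eq_wordDeriv (α : Fin m → ℕ) :
    mixedPartial α f = wordDeriv (wordOf α) f :=
  listPartial_eq_wordDeriv _ _

theorem count_wordOf (α : Fin m → ℕ) (i : Fin m) : (wordOf α).count i = α i := by
  have : ∀ L : List (Fin m), L.Nodup →
      (L.flatMap fun i => List.replicate (α i) i).count i = if i ∈ L then α i else 0 := by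
    intro L hL
    induction L with
    | nil => simp
    | cons k L ih =>
      rw [List.nodup_cons] at hL
      rw [List.flatMap_cons, List.count_append, ih hL.2, List.count_replicate]
      by_cases h : k = i
      · subst h; simp [hL.1]
      · simp [h, Ne.symm h]
  rw [wordOf, this _ (List.nodup_finRange m)]
  simp

theorem wordDeriv_eq_mixedPartial (hU : IsOpen U) (hf : DifferentiableOn ℂ f U)
    (L : List (Fin m)) :
    Set.EqOn (wordDeriv L f) (mixedPartial (fun i => L.count i) f) U := by
  rw [mixedPartial_eq_wordDeriv]
  refine wordDeriv_perm hU hf (List.perm_iff_count.2 fun i => ?_)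
  rw [count_wordOf]

end Holomorphic

/-! ### Smooth cutoff functions with uniform derivative bounds -/

section Cutoff

open MeasureTheory Metric Convolution

/-- The derivatives of the convolution with a function bounded by `1` are bounded by the `L¹` norms
of the derivatives of the smooth factor. -/
theorem norm_iteratedFDeriv_convolution_le {G E E' F : Type} [NormedAddCommGroup G]
    [NormedSpace ℝ G] [FiniteDimensional ℝ G] [MeasurableSpace G] [BorelSpace G]
    [NormedAddCommGroup E] [NormedSpace ℝ E]
    [NormedAddCommGroup E'] [NormedSpace ℝ E'] [NormedAddCommGroup F] [NormedSpace ℝ F]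
    (μ : Measure G) [μ.IsAddHaarMeasure]
    (L : E →L[ℝ] E' →L[ℝ] F) {f : G → E} (hf : LocallyIntegrable f μ) (hf1 : ∀ x, ‖f x‖ ≤ 1)
    {g : G → E'} (hg : ContDiff ℝ ∞ g) (hgc : HasCompactSupport g) (m : ℕ) (x : G) :
    ‖iteratedFDeriv ℝ m (f ⋆[L, μ] g) x‖ ≤ ‖L‖ * ∫ y, ‖iteratedFDeriv ℝ m g y‖ ∂μ := by
  induction m generalizing E' F g with
  | zero =>
    simp only [norm_iteratedFDeriv_zero]
    rw [convolution_def]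
    have h1 : ∫ y, ‖g y‖ ∂μ = ∫ t, ‖g (x - t)‖ ∂μ :=
      (integral_sub_left_eq_self (fun y => ‖g y‖) μ x).symm
    rw [h1, ← integral_const_mul]
    refine norm_integral_le_of_norm_le ?_ (Filter.Eventually.of_forall fun t => ?_)
    · have h2 : Integrable (fun y => ‖g y‖) μ :=
        (hg.continuous.integrable_of_hasCompactSupport hgc).norm
      exact ((integrable_comp_sub_left (fun y => ‖g y‖) x).2 h2).const_mul _
    · calc ‖L (f t) (g (x - t))‖ ≤ ‖L‖ * ‖f t‖ * ‖g (x - t)‖ := L.le_opNorm₂ _ _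
        _ ≤ ‖L‖ * 1 * ‖g (x - t)‖ := by gcongr; exact hf1 t
        _ = _ := by ring
  | succ m ih =>
    have h1 : fderiv ℝ (f ⋆[L, μ] g) = f ⋆[L.precompR G, μ] fderiv ℝ g := by
      funext y
      exact (hgc.hasFDerivAt_convolution_right L hf (hg.of_le (by norm_cast)) y).fderiv
    rw [← norm_iteratedFDeriv_fderiv, h1]
    refine (ih (L.precompR G) (hg.fderiv_right (by simp)) (hgc.fderiv (𝕜 := ℝ))).trans ?_
    simp only [norm_iteratedFDeriv_fderiv]
    gcongr
    exact L.norm_precompR_le G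

/-- There are cutoff functions which are `1` on an arbitrary set `A` and vanish outside its
`r`-neighbourhood, with derivatives of order `m` bounded by `K m / r ^ m`, `K` not depending on
`A` and `r`. They are mollified indicator functions. -/
theorem exists_cutoff (E : Type) [NormedAddCommGroup E] [NormedSpace ℝ E]
    [FiniteDimensional ℝ E] :
    ∃ K : ℕ → ℝ, (∀ m, 0 ≤ K m) ∧ ∀ (A : Set E) (r : ℝ), 0 < r →
      ∃ χ : E → ℝ, ContDiff ℝ ∞ χ ∧ (∀ x ∈ A, χ x = 1) ∧
        (∀ x, χ x ≠ 0 → ∃ a ∈ A, dist x a < r) ∧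
        ∀ m x, ‖iteratedFDeriv ℝ m χ x‖ ≤ K m / r ^ m := by
  borelize E
  let μ : Measure E := Measure.addHaar
  let φ : ContDiffBump (0 : E) := ⟨1 / 4, 1 / 2, by norm_num, by norm_num⟩
  set ρ : E → ℝ := φ.normed μ with hρ
  have hρs : ContDiff ℝ ∞ ρ := φ.contDiff_normed
  have hρc : HasCompactSupport ρ := φ.hasCompactSupport_normed
  refine ⟨fun m => ‖ContinuousLinearMap.mul ℝ ℝ‖ * ∫ y, ‖iteratedFDeriv ℝ m ρ y‖ ∂μ,
    fun m => by positivity, fun A r hr => ?_⟩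
  -- mollify the indicator function of the `1 / 2`-neighbourhood of `A / r`, and rescale by `r`
  set B : Set E := {y | ∃ a ∈ A, dist y (r⁻¹ • a) < 1 / 2} with hB
  have hBo : IsOpen B := by
    have : B = ⋃ a ∈ A, ball (r⁻¹ • a) (1 / 2) := by ext y; simp [hB]
    rw [this]
    exact isOpen_biUnion fun _ _ => isOpen_ball
  set h : E → ℝ := B.indicator 1 with hh
  have hhi : LocallyIntegrable h μ :=
    (locallyIntegrable_const (1 : ℝ)).indicator hBo.measurableSet
  have hh1 : ∀ x, ‖h x‖ ≤ 1 := fun x => by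
    by_cases hx : x ∈ B <;> simp [hh, hx]
  set η : E → ℝ := h ⋆[ContinuousLinearMap.mul ℝ ℝ, μ] ρ with hη
  have hηs : ContDiff ℝ ∞ η := hρc.contDiff_convolution_right _ hhi hρs
  have hρ0 : ∀ y, ρ y ≠ 0 → ‖y‖ < 1 / 2 := fun y hy => by
    have : y ∈ Function.support ρ := hy
    rw [hρ, φ.support_normed_eq] at this
    exact mem_ball_zero_iff.1 this
  have hηx : ∀ x, η x = ∫ t, h t * ρ (x - t) ∂μ := fun x => by
    rw [hη, convolution_def]; rfl
  refine ⟨fun x => η (r⁻¹ • x), hηs.comp (contDiff_const_smul _), fun x hx => ?_, fun x hx => ?_,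
    fun m x => ?_⟩
  · have h1 : ∀ t, h t * ρ (r⁻¹ • x - t) = ρ (r⁻¹ • x - t) := fun t => by
      by_cases h0 : ρ (r⁻¹ • x - t) = 0
      · rw [h0, mul_zero]
      · have : t ∈ B := ⟨x, hx, by rw [dist_comm, dist_eq_norm]; exact hρ0 _ h0⟩
        simp [hh, this]
    simp only [hηx, h1]
    rw [integral_sub_left_eq_self (fun y => ρ y) μ (r⁻¹ • x)]
    exact φ.integral_normed
  · obtain ⟨t, ht⟩ : ∃ t, h t * ρ (r⁻¹ • x - t) ≠ 0 := by
      by_contra! h0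
      exact hx (by simp [hηx, h0])
    have htB : t ∈ B := by
      by_contra h0
      exact ht (by simp [hh, h0])
    obtain ⟨a, ha, hta⟩ := htB
    refine ⟨a, ha, ?_⟩
    have h2 : dist (r⁻¹ • x) t < 1 / 2 := by
      rw [dist_eq_norm]; exact hρ0 _ (right_ne_zero_of_mul ht)
    have h3 : dist (r⁻¹ • x) (r⁻¹ • a) < 1 :=
      (dist_triangle _ t _).trans_lt (by linarith)
    rwa [dist_smul₀, Real.norm_of_nonneg (by positivity), inv_mul_lt_iff₀ hr, mul_one] at h3
  · set T : E →L[ℝ] E := r⁻¹ • ContinuousLinearMap.id ℝ E with hT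
    have h4 : (fun x => η (r⁻¹ • x)) = η ∘ T := by funext y; simp [hT]
    have h5 : ‖T‖ ≤ r⁻¹ := by
      refine T.opNorm_le_bound (by positivity) fun y => ?_
      simp [hT, norm_smul, abs_of_pos hr]
    rw [h4, T.iteratedFDeriv_comp_right hηs x (by norm_cast; exact le_top)]
    refine (ContinuousMultilinearMap.norm_compContinuousLinearMap_le _ _).trans ?_
    rw [Finset.prod_const, Finset.card_univ, Fintype.card_fin, div_eq_mul_inv, ← inv_pow]
    gcongr
    exact norm_iteratedFDeriv_convolution_le μ _ hhi hh1 hρs hρc m _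

end Cutoff

/-! ### Directional Taylor polynomials -/

section Jet

variable {E : Type} [NormedAddCommGroup E] [NormedSpace ℝ E]
  {F : Type} [NormedAddCommGroup F] [NormedSpace ℝ F]

/-- The derivative of `f` in the direction `v`. -/
noncomputable def dirDeriv (v : E) (f : E → F) : E → F := fun x => fderiv ℝ f x v

variable {O : Set E} {f g : E → F}

theorem contDiffOn_dirDeriv (hO : IsOpen O) (hf : ContDiffOn ℝ ∞ f O) (v : E) :
    ContDiffOn ℝ ∞ (dirDeriv v f) O :=
  (hf.fderiv_of_isOpen hO (by simp)).clm_apply contDiffOn_const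

theorem contDiffOn_iterate_dirDeriv (hO : IsOpen O) (hf : ContDiffOn ℝ ∞ f O) (v : E) (p : ℕ) :
    ContDiffOn ℝ ∞ ((dirDeriv v)^[p] f) O := by
  induction p generalizing f with
  | zero => exact hf
  | succ p ih => exact ih (contDiffOn_dirDeriv hO hf v)

theorem dirDeriv_congr (hO : IsOpen O) (hfg : Set.EqOn f g O) (v : E) :
    Set.EqOn (dirDeriv v f) (dirDeriv v g) O := fun x hx => by
  rw [dirDeriv, dirDeriv, (hfg.eventuallyEq_of_mem (hO.mem_nhds hx)).fderiv_eq]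

theorem iterate_dirDeriv_congr (hO : IsOpen O) (hfg : Set.EqOn f g O) (v : E) (p : ℕ) :
    Set.EqOn ((dirDeriv v)^[p] f) ((dirDeriv v)^[p] g) O := by
  induction p generalizing f g with
  | zero => exact hfg
  | succ p ih => exact ih (dirDeriv_congr hO hfg v)

theorem fderiv_dirDeriv (hO : IsOpen O) (hf : ContDiffOn ℝ ∞ f O) (v : E) :
    Set.EqOn (fderiv ℝ (dirDeriv v f)) (dirDeriv v (fderiv ℝ f)) O := by
  intro x hx
  have hc : ContDiffAt ℝ ∞ f x := hf.contDiffAt (hO.mem_nhds hx)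
  have hd : DifferentiableAt ℝ (fderiv ℝ f) x :=
    (hc.fderiv_right (m := 1) (by norm_cast)).differentiableAt (by norm_num)
  ext w
  have h1 : fderiv ℝ (dirDeriv v f) x w = fderiv ℝ (fderiv ℝ f) x w v := by
    change fderiv ℝ (fun y => fderiv ℝ f y v) x w = _
    rw [fderiv_clm_apply hd (differentiableAt_const _)]
    simp
  rw [h1]
  exact (hc.isSymmSndFDerivAt (by simp; norm_cast)) _ _

theorem fderiv_iterate_dirDeriv (hO : IsOpen O) (hf : ContDiffOn ℝ ∞ f O) (v : E) (p : ℕ) :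
    Set.EqOn (fderiv ℝ ((dirDeriv v)^[p] f)) ((dirDeriv v)^[p] (fderiv ℝ f)) O := by
  induction p generalizing f with
  | zero => exact fun _ _ => rfl
  | succ p ih =>
    exact (ih (contDiffOn_dirDeriv hO hf v)).trans
      (iterate_dirDeriv_congr hO (fderiv_dirDeriv hO hf v) v p)

theorem norm_iteratedFDeriv_dirDeriv_le (hO : IsOpen O) (hf : ContDiffOn ℝ ∞ f O) (v : E)
    (m p : ℕ) {x : E} (hx : x ∈ O) :
    ‖iteratedFDeriv ℝ m ((dirDeriv v)^[p] f) x‖ ≤ ‖v‖ ^ p * ‖iteratedFDeriv ℝ (m + p) f x‖ := by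
  induction p generalizing m with
  | zero => simp
  | succ p ih =>
    rw [Function.iterate_succ_apply']
    have hc := contDiffOn_iterate_dirDeriv hO hf v p
    have h1 : ‖iteratedFDeriv ℝ m (dirDeriv v ((dirDeriv v)^[p] f)) x‖ ≤
        ‖v‖ * ‖iteratedFDeriv ℝ m (fderiv ℝ ((dirDeriv v)^[p] f)) x‖ :=
      norm_iteratedFDeriv_clm_apply_const (N := ∞)
        ((hc.fderiv_of_isOpen hO (by simp)).contDiffAt (hO.mem_nhds hx)) (by norm_cast; exact le_top)
    rw [norm_iteratedFDeriv_fderiv] at h1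
    calc _ ≤ ‖v‖ * (‖v‖ ^ p * ‖iteratedFDeriv ℝ (m + 1 + p) f x‖) := h1.trans (by gcongr; exact ih _)
      _ = _ := by rw [show m + 1 + p = m + (p + 1) by ring]; ring

/-- The Taylor polynomial of order `M` of `s ↦ f (x + s v)` at `s = a`, evaluated at `s = 0`. It
recovers `f x` approximately from the values of `f` near `x + a v`. -/
noncomputable def jet (v : E) (M : ℕ) (a : ℝ) (f : E → F) (x : E) : F :=
  ∑ p ∈ Finset.range (M + 1), ((-a) ^ p / (p.factorial : ℝ)) • (dirDeriv v)^[p] f (x + a • v)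

theorem jet_zero (v : E) (M : ℕ) (f : E → F) (x : E) : jet v M 0 f x = f x := by
  rw [jet, Finset.sum_eq_single 0]
  · simp
  · intro p _ hp; simp [hp]
  · simp

theorem contDiffOn_shift (hf : ContDiffOn ℝ ∞ f O) (w : E) :
    ContDiffOn ℝ ∞ (fun x => f (x + w)) {x | x + w ∈ O} :=
  hf.comp (contDiff_id.add contDiff_const).contDiffOn fun _ h => h

theorem contDiffOn_jet (hO : IsOpen O) (hf : ContDiffOn ℝ ∞ f O) (v : E) (M : ℕ) (a : ℝ) :
    ContDiffOn ℝ ∞ (jet v M a f) {x | x + a • v ∈ O} := by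
  unfold jet
  exact ContDiffOn.sum fun p _ =>
    (contDiffOn_shift (contDiffOn_iterate_dirDeriv hO hf v p) _).const_smul _

theorem fderiv_jet (hO : IsOpen O) (hf : ContDiffOn ℝ ∞ f O) (v : E) (M : ℕ) (a : ℝ) {x : E}
    (hx : x + a • v ∈ O) : fderiv ℝ (jet v M a f) x = jet v M a (fderiv ℝ f) x := by
  unfold jet
  have hd : ∀ p, HasFDerivAt (fun x => (dirDeriv v)^[p] f (x + a • v))
      ((dirDeriv v)^[p] (fderiv ℝ f) (x + a • v)) x := by
    intro p
    have h1 : DifferentiableAt ℝ ((dirDeriv v)^[p] f) (x + a • v) :=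
      ((contDiffOn_iterate_dirDeriv hO hf v p).contDiffAt (hO.mem_nhds hx)).differentiableAt
        (by simp)
    rw [← fderiv_iterate_dirDeriv hO hf v p hx]
    exact h1.hasFDerivAt.comp x ((hasFDerivAt_id x).add_const _)
  exact (HasFDerivAt.fun_sum fun p _ => (hd p).const_smul _).fderiv

/-- The derivative with respect to the base point telescopes to the term of order `M + 1`. -/
theorem hasDerivAt_jet (hO : IsOpen O) (hf : ContDiffOn ℝ ∞ f O) (v : E) (M : ℕ) {a : ℝ} {x : E}
    (hx : x + a • v ∈ O) :
    HasDerivAt (fun a => jet v M a f x)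
      (((-a) ^ M / (M.factorial : ℝ)) • (dirDeriv v)^[M + 1] f (x + a • v)) a := by
  have hd : ∀ p, HasDerivAt (fun a : ℝ => (dirDeriv v)^[p] f (x + a • v))
      ((dirDeriv v)^[p + 1] f (x + a • v)) a := by
    intro p
    have h1 : DifferentiableAt ℝ ((dirDeriv v)^[p] f) (x + a • v) :=
      ((contDiffOn_iterate_dirDeriv hO hf v p).contDiffAt (hO.mem_nhds hx)).differentiableAt
        (by simp)
    have h2 : HasDerivAt (fun a : ℝ => x + a • v) v a := by
      simpa using ((hasDerivAt_id a).smul_const v).const_add x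
    rw [Function.iterate_succ_apply']
    exact h1.hasFDerivAt.comp_hasDerivAt a h2
  induction M with
  | zero =>
    have := hd 0
    simpa [jet] using this
  | succ M ih =>
    have h3 : (fun a => jet v (M + 1) a f x) = fun a => jet v M a f x +
        ((-a) ^ (M + 1) / ((M + 1).factorial : ℝ)) • (dirDeriv v)^[M + 1] f (x + a • v) := by
      funext a; rw [jet, Finset.sum_range_succ]; rfl
    rw [h3]
    have h4 : HasDerivAt (fun a : ℝ => (-a) ^ (M + 1) / ((M + 1).factorial : ℝ))
        (-((-a) ^ M / (M.factorial : ℝ))) a := by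
      have h5 : HasDerivAt (fun a : ℝ => (-a) ^ (M + 1)) (((M + 1 : ℕ) : ℝ) * (-a) ^ M * (-1)) a := by
        simpa using (hasDerivAt_neg a).fun_pow (M + 1)
      refine (h5.div_const ((M + 1).factorial : ℝ)).congr_deriv ?_
      have : (M.factorial : ℝ) ≠ 0 := by positivity
      rw [Nat.factorial_succ]
      push_cast
      field_simp
    refine HasDerivAt.congr_deriv (ih.add (h4.smul (hd (M + 1)))) ?_
    rw [neg_smul]
    abel

/-- Moving the base point of the Taylor polynomial. -/
theorem norm_jet_sub_le (hO : IsOpen O) (hf : ContDiffOn ℝ ∞ f O) (v : E) (M : ℕ) {a b C : ℝ}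
    {x : E} (hb : 0 ≤ b) (hba : b ≤ a) (hx : ∀ s ∈ Set.Icc b a, x + s • v ∈ O)
    (hC : ∀ y ∈ O, ‖(dirDeriv v)^[M + 1] f y‖ ≤ C) :
    ‖jet v M a f x - jet v M b f x‖ ≤ C * a ^ (M + 1) := by
  have hC0 : 0 ≤ C := (norm_nonneg _).trans (hC _ (hx b ⟨le_rfl, hba⟩))
  have h1 := (convex_Icc b a).norm_image_sub_le_of_norm_hasDerivWithin_le
    (f := fun s => jet v M s f x) (C := C * a ^ M)
    (fun s hs => (hasDerivAt_jet hO hf v M (hx s hs)).hasDerivWithinAt) (fun s hs => by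
      rw [norm_smul, norm_div, norm_pow, norm_neg, Real.norm_of_nonneg (hb.trans hs.1),
        Real.norm_of_nonneg (by positivity), mul_comm]
      have h2 : s ^ M / (M.factorial : ℝ) ≤ a ^ M := by
        have : s ^ M ≤ a ^ M := pow_le_pow_left₀ (hb.trans hs.1) hs.2 M
        exact (div_le_self (pow_nonneg (hb.trans hs.1) _)
          (by exact_mod_cast M.factorial_pos)).trans this
      have h0 : 0 ≤ s ^ M / (M.factorial : ℝ) :=
        div_nonneg (pow_nonneg (hb.trans hs.1) _) (by positivity)
      exact mul_le_mul (hC _ (hx s hs)) h2 h0 hC0)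
    (Set.left_mem_Icc.2 hba) (Set.right_mem_Icc.2 hba)
  refine h1.trans ?_
  rw [Real.norm_of_nonneg (by linarith), pow_succ, ← mul_assoc]
  have : 0 ≤ a := hb.trans hba
  gcongr
  linarith

theorem norm_iteratedFDeriv_jet_sub_le (hO : IsOpen O) (hf : ContDiffOn ℝ ∞ f O) (v : E) (M m : ℕ)
    {a b C : ℝ} {V : Set E} (hV : IsOpen V) (hb : 0 ≤ b) (hba : b ≤ a)
    (hx : ∀ x ∈ V, ∀ s ∈ Set.Icc b a, x + s • v ∈ O)
    (hC : ∀ y ∈ O, ‖iteratedFDeriv ℝ (m + (M + 1)) f y‖ ≤ C) {x : E} (hxV : x ∈ V) :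
    ‖iteratedFDeriv ℝ m (fun x => jet v M a f x - jet v M b f x) x‖ ≤
      ‖v‖ ^ (M + 1) * C * a ^ (M + 1) := by
  induction m generalizing F f x with
  | zero =>
    rw [norm_iteratedFDeriv_zero]
    refine norm_jet_sub_le hO hf v M hb hba (hx x hxV) fun y hy => ?_
    have := norm_iteratedFDeriv_dirDeriv_le hO hf v 0 (M + 1) hy
    rw [norm_iteratedFDeriv_zero] at this
    exact this.trans (by gcongr; exact hC y hy)
  | succ m ih =>
    rw [← norm_iteratedFDeriv_fderiv]
    have h1 : fderiv ℝ (fun x => jet v M a f x - jet v M b f x) =ᶠ[nhds x]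
        fun x => jet v M a (fderiv ℝ f) x - jet v M b (fderiv ℝ f) x := by
      filter_upwards [hV.mem_nhds hxV] with y hy
      have hda : ∀ c ∈ Set.Icc b a, DifferentiableAt ℝ (jet v M c f) y := fun c hc =>
        ((contDiffOn_jet hO hf v M c).contDiffAt
          ((hO.preimage (by fun_prop)).mem_nhds (hx y hy c hc))).differentiableAt (by simp)
      have ha : a ∈ Set.Icc b a := ⟨hba, le_rfl⟩
      have hb' : b ∈ Set.Icc b a := ⟨le_rfl, hba⟩
      rw [fderiv_fun_sub (hda a ha) (hda b hb'), fderiv_jet hO hf v M a (hx y hy a ha),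
        fderiv_jet hO hf v M b (hx y hy b hb')]
    rw [(Filter.EventuallyEq.iteratedFDeriv ℝ h1 m).eq_of_nhds]
    refine ih (hf.fderiv_of_isOpen hO (by simp)) (fun y hy => ?_) hxV
    rw [norm_iteratedFDeriv_fderiv]
    rw [show m + 1 + (M + 1) = m + (M + 1) + 1 by ring] at hC
    exact hC y hy

theorem norm_iteratedFDeriv_jet_term_le (hO : IsOpen O) (hf : ContDiffOn ℝ ∞ f O) (v : E)
    (p m : ℕ) {a C : ℝ} (ha : 0 ≤ a) (hC : ∀ y ∈ O, ‖iteratedFDeriv ℝ (m + p) f y‖ ≤ C) {x : E}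
    (hx : x + a • v ∈ O) :
    ‖iteratedFDeriv ℝ m (fun x => ((-a) ^ p / (p.factorial : ℝ)) •
      (dirDeriv v)^[p] f (x + a • v)) x‖ ≤ ‖v‖ ^ p * C * a ^ p := by
  have hc := (contDiffOn_iterate_dirDeriv hO hf v p)
  have h1 : ContDiffAt ℝ m (fun x => (dirDeriv v)^[p] f (x + a • v)) x :=
    ((contDiffOn_shift hc (a • v)).contDiffAt
      ((hO.preimage (by fun_prop)).mem_nhds hx)).of_le (by norm_cast; exact le_top)
  rw [iteratedFDeriv_const_smul_apply' h1, norm_smul, iteratedFDeriv_comp_add_right]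
  have h2 : ‖(-a) ^ p / (p.factorial : ℝ)‖ ≤ a ^ p := by
    rw [norm_div, norm_pow, norm_neg, Real.norm_of_nonneg ha, Real.norm_of_nonneg (by positivity)]
    exact div_le_self (by positivity) (by exact_mod_cast p.factorial_pos)
  calc _ ≤ a ^ p * (‖v‖ ^ p * C) := by
        gcongr
        refine (norm_iteratedFDeriv_dirDeriv_le hO hf v m p hx).trans ?_
        gcongr
        exact hC _ hx
    _ = _ := by ring

/-- Comparison of Taylor polynomials of different orders `M ≤ M'` at different base points. -/
theorem norm_iteratedFDeriv_jet_sub_jet_le (hO : IsOpen O) (hf : ContDiffOn ℝ ∞ f O) (v : E)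
    {M M' m : ℕ} (hM : M ≤ M') {a b : ℝ} {C : ℕ → ℝ} {V : Set E} (hV : IsOpen V) (hb : 0 ≤ b)
    (hba : b ≤ a) (ha1 : a ≤ 1) (hx : ∀ x ∈ V, ∀ s ∈ Set.Icc b a, x + s • v ∈ O)
    (hC0 : ∀ k, 0 ≤ C k)
    (hC : ∀ k, ∀ y ∈ O, ‖iteratedFDeriv ℝ k f y‖ ≤ C k) {x : E} (hxV : x ∈ V) :
    ‖iteratedFDeriv ℝ m (fun x => jet v M' b f x - jet v M a f x) x‖ ≤
      a ^ (M + 1) * (2 * ∑ p ∈ Finset.range (M' + 2), ‖v‖ ^ p * C (m + p)) := by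
  have ha0 : 0 ≤ a := hb.trans hba
  set Q : ℝ := ∑ p ∈ Finset.range (M' + 2), ‖v‖ ^ p * C (m + p) with hQ
  have hterm : ∀ p, 0 ≤ ‖v‖ ^ p * C (m + p) := fun p => mul_nonneg (by positivity) (hC0 _)
  have hb' : b ∈ Set.Icc b a := ⟨le_rfl, hba⟩
  have ha' : a ∈ Set.Icc b a := ⟨hba, le_rfl⟩
  have hsum : (fun x => jet v M' b f x - jet v M a f x) = fun x =>
      (∑ p ∈ Finset.Ico (M + 1) (M' + 1), ((-b) ^ p / (p.factorial : ℝ)) •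
        (dirDeriv v)^[p] f (x + b • v)) + -(jet v M a f x - jet v M b f x) := by
    funext y
    have : jet v M' b f y = jet v M b f y + ∑ p ∈ Finset.Ico (M + 1) (M' + 1),
        ((-b) ^ p / (p.factorial : ℝ)) • (dirDeriv v)^[p] f (y + b • v) := by
      rw [jet, jet, Finset.range_eq_Ico, Finset.range_eq_Ico,
        Finset.sum_Ico_consecutive _ (by omega) (by omega)]
    rw [this]; abel
  have hnh : ∀ c ∈ Set.Icc b a, {y : E | y + c • v ∈ O} ∈ nhds x := fun c hc =>
    (hO.preimage (by fun_prop)).mem_nhds (hx x hxV c hc)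
  have hct : ∀ p, ContDiffAt ℝ m (fun x => ((-b) ^ p / (p.factorial : ℝ)) •
      (dirDeriv v)^[p] f (x + b • v)) x := fun p =>
    (((contDiffOn_shift (contDiffOn_iterate_dirDeriv hO hf v p) _).const_smul _).contDiffAt
      (hnh b hb')).of_le (by norm_cast; exact le_top)
  have hcj : ∀ c ∈ Set.Icc b a, ContDiffAt ℝ m (jet v M c f) x := fun c hc =>
    ((contDiffOn_jet hO hf v M c).contDiffAt (hnh c hc)).of_le (by norm_cast; exact le_top)
  rw [hsum]
  have hcd : ContDiffAt ℝ m (fun x => jet v M a f x - jet v M b f x) x :=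
    (hcj a ha').sub (hcj b hb')
  have e1 : iteratedFDeriv ℝ m (fun x => (∑ p ∈ Finset.Ico (M + 1) (M' + 1),
      ((-b) ^ p / (p.factorial : ℝ)) • (dirDeriv v)^[p] f (x + b • v)) +
        -(jet v M a f x - jet v M b f x)) x =
      (∑ p ∈ Finset.Ico (M + 1) (M' + 1), iteratedFDeriv ℝ m (fun x =>
        ((-b) ^ p / (p.factorial : ℝ)) • (dirDeriv v)^[p] f (x + b • v)) x) +
      -iteratedFDeriv ℝ m (fun x => jet v M a f x - jet v M b f x) x := by
    rw [fun_iteratedFDeriv_add_apply (ContDiffAt.sum fun p _ => hct p) hcd.neg,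
      iteratedFDeriv_fun_sum_apply fun p _ => hct p]
    congr 1
    exact iteratedFDeriv_neg_apply (f := fun x => jet v M a f x - jet v M b f x)
  rw [e1]
  have hle1 : ∑ p ∈ Finset.Ico (M + 1) (M' + 1), ‖v‖ ^ p * C (m + p) ≤ Q := by
    refine Finset.sum_le_sum_of_subset_of_nonneg (fun p hp => ?_) fun p _ _ => hterm p
    simp at hp ⊢; omega
  have hle2 : ‖v‖ ^ (M + 1) * C (m + (M + 1)) ≤ Q :=
    Finset.single_le_sum (f := fun p => ‖v‖ ^ p * C (m + p)) (fun p _ => hterm p)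
      (Finset.mem_range.2 (by omega))
  refine (norm_add_le _ _).trans ?_
  rw [norm_neg]
  have h1 : ‖∑ p ∈ Finset.Ico (M + 1) (M' + 1), iteratedFDeriv ℝ m (fun x =>
        ((-b) ^ p / (p.factorial : ℝ)) • (dirDeriv v)^[p] f (x + b • v)) x‖ ≤
      a ^ (M + 1) * Q := by
    refine (norm_sum_le _ _).trans ?_
    calc _ ≤ ∑ p ∈ Finset.Ico (M + 1) (M' + 1), a ^ (M + 1) * (‖v‖ ^ p * C (m + p)) := by
          refine Finset.sum_le_sum fun p hp => ?_
          refine (norm_iteratedFDeriv_jet_term_le hO hf v p m hb (hC _) (hx x hxV b hb')).trans ?_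
          rw [mul_comm]
          have : b ^ p ≤ a ^ (M + 1) := (pow_le_pow_left₀ hb hba p).trans
            (pow_le_pow_of_le_one ha0 ha1 (Finset.mem_Ico.1 hp).1)
          exact mul_le_mul_of_nonneg_right this (hterm p)
      _ ≤ _ := by rw [← Finset.mul_sum]; gcongr
  have h2 := norm_iteratedFDeriv_jet_sub_le hO hf v M m hV hb hba hx (hC _) hxV
  have h3 : ‖v‖ ^ (M + 1) * C (m + (M + 1)) * a ^ (M + 1) ≤ a ^ (M + 1) * Q := by
    rw [mul_comm]; gcongr
  linarith

end Jet

/-! ### Extension of smooth functions from sets that can be pushed inside an open set -/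

section Extension

open Filter

/-- A sequence of orders that tends to infinity so slowly that the growth of `P` along it is at
most `2 ^ k`. -/
theorem exists_slow_orders (P : ℕ → ℝ) :
    ∃ M : ℕ → ℕ, Monotone M ∧ Tendsto M atTop atTop ∧ ∀ᶠ k in atTop, P (M k) ≤ 2 ^ k := by
  classical
  have hev : ∀ m : ℕ, ∀ᶠ k : ℕ in atTop, m ≤ k ∧ ∀ i ≤ m, P i ≤ 2 ^ k := by
    intro m
    refine (eventually_ge_atTop m).and ?_
    have : ∀ i ∈ Finset.range (m + 1), ∀ᶠ k : ℕ in atTop, P i ≤ 2 ^ k := fun i _ =>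
      (tendsto_pow_atTop_atTop_of_one_lt (one_lt_two (α := ℝ))).eventually_ge_atTop (P i)
    filter_upwards [(Finset.eventually_all _).2 this] with k hk i hi
    exact hk i (Finset.mem_range.2 (by omega))
  refine ⟨fun k => Nat.findGreatest (fun m => ∀ i ≤ m, P i ≤ 2 ^ k) k, ?_, ?_, ?_⟩
  · intro k k' hk
    refine Nat.findGreatest_mono (fun m hm i hi => (hm i hi).trans ?_) hk
    exact pow_le_pow_right₀ one_le_two hk
  · refine tendsto_atTop.2 fun m => ?_
    filter_upwards [hev m] with k hk
    exact Nat.le_findGreatest hk.1 hk.2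
  · filter_upwards [hev 0] with k hk
    exact Nat.findGreatest_spec (P := fun m => ∀ i ≤ m, P i ≤ 2 ^ k) hk.1 hk.2 _ le_rfl

variable {E : Type} [NormedAddCommGroup E] [NormedSpace ℝ E]
  {F : Type} [NormedAddCommGroup F] [NormedSpace ℝ F]

/-- The product of a cutoff function and a function that is smooth near the support of the cutoff
function is smooth. -/
theorem contDiff_cutoff_smul {A : Set E} {r : ℝ} (hr : 0 < r) {χ : E → ℝ} {u : E → F}
    (hχ : ContDiff ℝ ∞ χ) (hsupp : ∀ x, χ x ≠ 0 → ∃ a ∈ A, dist x a < r)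
    (hu : ContDiffOn ℝ ∞ u {x | ∃ a ∈ A, dist x a < 2 * r}) :
    ContDiff ℝ ∞ fun x => χ x • u x := by
  have hV : IsOpen {x : E | ∃ a ∈ A, dist x a < 2 * r} := by
    have : {x : E | ∃ a ∈ A, dist x a < 2 * r} = ⋃ a ∈ A, Metric.ball a (2 * r) := by ext; simp
    rw [this]; exact isOpen_biUnion fun _ _ => Metric.isOpen_ball
  refine contDiff_iff_contDiffAt.2 fun x => ?_
  by_cases hx : ∃ a ∈ A, dist x a < 2 * r
  · exact hχ.contDiffAt.smul (hu.contDiffAt (hV.mem_nhds hx))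
  · have : (fun x => χ x • u x) =ᶠ[nhds x] fun _ => 0 := by
      filter_upwards [Metric.ball_mem_nhds x hr] with y hy
      have : χ y = 0 := by
        by_contra h0
        obtain ⟨a, ha, hya⟩ := hsupp y h0
        refine hx ⟨a, ha, ?_⟩
        have := dist_triangle x y a
        rw [Metric.mem_ball, dist_comm] at hy
        linarith
      simp [this]
    exact contDiffAt_const.congr_of_eventuallyEq this

/-- Leibniz' rule: the `m`-th derivative loses a factor `r ^ m`. -/
theorem norm_iteratedFDeriv_cutoff_smul_le {A : Set E} {r : ℝ} (hr : 0 < r) (hr1 : r ≤ 1)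
    {χ : E → ℝ} {u : E → F} {K B : ℕ → ℝ} {m : ℕ}
    (hχ : ContDiff ℝ ∞ χ) (hsupp : ∀ x, χ x ≠ 0 → ∃ a ∈ A, dist x a < r)
    (hu : ContDiffOn ℝ ∞ u {x | ∃ a ∈ A, dist x a < 2 * r}) (hK : ∀ m, 0 ≤ K m)
    (hχK : ∀ m x, ‖iteratedFDeriv ℝ m χ x‖ ≤ K m / r ^ m) (hB : ∀ m, 0 ≤ B m)
    (huB : ∀ m, ∀ x ∈ {x | ∃ a ∈ A, dist x a < 2 * r}, ‖iteratedFDeriv ℝ m u x‖ ≤ B m) (x : E) :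
    ‖iteratedFDeriv ℝ m (fun x => χ x • u x) x‖ ≤
      (∑ i ∈ Finset.range (m + 1), (m.choose i : ℝ) * K i * B (m - i)) / r ^ m := by
  have hV : IsOpen {x : E | ∃ a ∈ A, dist x a < 2 * r} := by
    have : {x : E | ∃ a ∈ A, dist x a < 2 * r} = ⋃ a ∈ A, Metric.ball a (2 * r) := by ext; simp
    rw [this]; exact isOpen_biUnion fun _ _ => Metric.isOpen_ball
  by_cases hx : ∃ a ∈ A, dist x a < 2 * r
  · have hm : ((m : ℕ∞) : WithTop ℕ∞) ≤ ∞ := by norm_cast; exact le_top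
    have h1 := norm_iteratedFDerivWithin_smul_le hχ.contDiffOn hu hV.uniqueDiffOn hx hm
    have hin : ∀ k, ∀ {F : Type} [NormedAddCommGroup F] [NormedSpace ℝ F] (g : E → F),
        iteratedFDerivWithin ℝ k g {x | ∃ a ∈ A, dist x a < 2 * r} x = iteratedFDeriv ℝ k g x :=
      fun k _ _ _ g => iteratedFDerivWithin_of_isOpen k hV hx
    simp only [hin] at h1
    refine h1.trans ?_
    rw [Finset.sum_div]
    refine Finset.sum_le_sum fun i hi => ?_
    have hi' : i ≤ m := by simpa [Nat.lt_succ_iff] using hi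
    calc _ ≤ (m.choose i : ℝ) * (K i / r ^ i) * B (m - i) := by
          have h2 : 0 ≤ (m.choose i : ℝ) * (K i / r ^ i) :=
            mul_nonneg (by positivity) (div_nonneg (hK i) (by positivity))
          exact mul_le_mul (mul_le_mul_of_nonneg_left (hχK i x) (by positivity)) (huB _ x hx)
            (norm_nonneg _) h2
      _ ≤ (m.choose i : ℝ) * (K i / r ^ m) * B (m - i) := by
          have : K i / r ^ i ≤ K i / r ^ m :=
            div_le_div_of_nonneg_left (hK i) (by positivity) (pow_le_pow_of_le_one hr.le hr1 hi')
          have := hB (m - i)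
          gcongr
      _ = _ := by ring
  · have : (fun x => χ x • u x) =ᶠ[nhds x] fun _ => 0 := by
      filter_upwards [Metric.ball_mem_nhds x hr] with y hy
      have : χ y = 0 := by
        by_contra h0
        obtain ⟨a, ha, hya⟩ := hsupp y h0
        refine hx ⟨a, ha, ?_⟩
        have := dist_triangle x y a
        rw [Metric.mem_ball, dist_comm] at hy
        linarith
      simp [this]
    rw [(Filter.EventuallyEq.iteratedFDeriv ℝ this m).eq_of_nhds]
    have h0 : iteratedFDeriv ℝ m (fun _ : E => (0 : F)) x = 0 := by
      have := congrFun (iteratedFDeriv_fun_zero (𝕜 := ℝ) (E := E) (F := F) (n := m)) x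
      exact this
    rw [h0, norm_zero]
    refine div_nonneg (Finset.sum_nonneg fun i _ => ?_) (by positivity)
    exact mul_nonneg (mul_nonneg (by positivity) (hK i)) (hB _)

/-- Let `f` be smooth with bounded derivatives on an open set `O`, and let `A` be a subset that is
pushed into the interior of `O` by translations along `v`: a point of `A` moved by `t v` has
distance at least `c t` to the complement of `O`. Then `f` extends from `A` to a smooth function on
the whole space. The extension is a telescoping series of Taylor polynomials of `f` based at the
points `x + t_k v`, `t_k → 0`, each term being cut off near `A` at the scale `t_k`; the orders of
the Taylor polynomials tend to infinity slowly. -/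
theorem exists_contDiff_extension [FiniteDimensional ℝ E] {A O : Set E} (hO : IsOpen O)
    (hAO : A ⊆ O) {v : E} {c t₀ : ℝ} (hc : 0 < c) (ht₀ : 0 < t₀)
    (hpush : ∀ x ∈ A, ∀ t, 0 < t → t ≤ t₀ → ∀ u : E, ‖u‖ ≤ c * t → x + t • v + u ∈ O)
    {f : E → F} [CompleteSpace F] (hf : ContDiffOn ℝ ∞ f O)
    (hb : ∀ m : ℕ, ∃ C, ∀ x ∈ O, ‖iteratedFDeriv ℝ m f x‖ ≤ C) :
    ∃ φ : E → F, ContDiff ℝ ∞ φ ∧ Set.EqOn φ f A := by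
  wlog h1 : c ≤ 1 ∧ t₀ ≤ 1 generalizing c t₀
  · refine this (c := min c 1) (t₀ := min t₀ 1) (lt_min hc one_pos) (lt_min ht₀ one_pos)
      (fun x hx t ht htt u hu => ?_) ⟨min_le_right _ _, min_le_right _ _⟩
    refine hpush x hx t ht (htt.trans (min_le_left _ _)) u (hu.trans ?_)
    gcongr
    exact min_le_left _ _
  obtain ⟨hc1, ht1⟩ := h1
  obtain ⟨C, hC0, hC⟩ : ∃ C : ℕ → ℝ, (∀ k, 0 ≤ C k) ∧
      ∀ k, ∀ y ∈ O, ‖iteratedFDeriv ℝ k f y‖ ≤ C k := by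
    choose C hC using hb
    exact ⟨fun k => max (C k) 0, fun k => le_max_right _ _,
      fun k y hy => (hC k y hy).trans (le_max_left _ _)⟩
  obtain ⟨K, hK, hcut⟩ := exists_cutoff E
  -- bounds for the derivatives of the differences of Taylor polynomials, and of the cut off ones
  set Q : ℕ → ℕ → ℝ := fun m M => 2 * ∑ p ∈ Finset.range (M + 2), ‖v‖ ^ p * C (m + p) with hQ
  have hQ0 : ∀ m M, 0 ≤ Q m M := fun m M =>
    mul_nonneg zero_le_two (Finset.sum_nonneg fun p _ => mul_nonneg (by positivity) (hC0 _))
  set P : ℕ → ℕ → ℝ := fun m M =>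
    ∑ i ∈ Finset.range (m + 1), (m.choose i : ℝ) * K i * Q (m - i) M with hP
  have hP0 : ∀ m M, 0 ≤ P m M := fun m M => Finset.sum_nonneg fun i _ =>
    mul_nonneg (mul_nonneg (by positivity) (hK i)) (hQ0 _ _)
  -- the constants that belong to Taylor polynomials of order `M k` do not exceed `2 ^ k`
  obtain ⟨M, hMm, hMt, hM⟩ := exists_slow_orders
    fun M => Q 0 M + ∑ m ∈ Finset.range (M + 1), P m M
  set t : ℕ → ℝ := fun k => t₀ * (1 / 4) ^ k with ht
  have htpos : ∀ k, 0 < t k := fun k => by positivity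
  have htle : ∀ k, t k ≤ t₀ := fun k =>
    mul_le_of_le_one_right ht₀.le (pow_le_one₀ (by norm_num) (by norm_num))
  have htsucc : ∀ k, t (k + 1) = t k / 4 := fun k => by simp only [ht, pow_succ]; ring
  have hV : ∀ k, IsOpen {x : E | ∃ a ∈ A, dist x a < c * t k} := fun k => by
    have : {x : E | ∃ a ∈ A, dist x a < c * t k} = ⋃ a ∈ A, Metric.ball a (c * t k) := by
      ext; simp
    rw [this]; exact isOpen_biUnion fun _ _ => Metric.isOpen_ball
  have hVO : ∀ k, ∀ x ∈ {x : E | ∃ a ∈ A, dist x a < c * t k}, ∀ s, t k ≤ s → s ≤ t₀ →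
      x + s • v ∈ O := by
    rintro k x ⟨a, ha, hxa⟩ s hs hs'
    have := hpush a ha s ((htpos k).trans_le hs) hs' (x - a) (by
      rw [← dist_eq_norm]; exact hxa.le.trans (by gcongr))
    convert this using 1
    abel
  have hr : ∀ k, 0 < c * t k / 2 := fun k => by have := htpos k; positivity
  have hr1 : ∀ k, c * t k / 2 ≤ 1 := fun k => by
    have : c * t k ≤ 1 * 1 := mul_le_mul hc1 ((htle k).trans ht1) (htpos k).le zero_le_one
    linarith
  choose χ hχs hχ1 hχsupp hχK using fun k => hcut A _ (hr k)
  have h2r : ∀ k, 2 * (c * t k / 2) = c * t k := fun k => by ring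
  set g : ℕ → E → F := fun k => jet v (M k) (t k) f with hg
  have hgs : ∀ k l, k ≤ l → ContDiffOn ℝ ∞ (g k) {x | ∃ a ∈ A, dist x a < c * t l} := by
    intro k l hkl
    refine (contDiffOn_jet hO hf v (M k) (t k)).mono fun x hx => hVO l x hx _ ?_ (htle k)
    simp only [ht]
    exact mul_le_mul_of_nonneg_left
      (pow_le_pow_of_le_one (by norm_num) (by norm_num) hkl) ht₀.le
  set w : ℕ → E → F := fun k x => χ (k + 1) x • (g (k + 1) x - g k x) with hw
  have hdiff : ∀ k, ContDiffOn ℝ ∞ (fun x => g (k + 1) x - g k x)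
      {x | ∃ a ∈ A, dist x a < 2 * (c * t (k + 1) / 2)} := fun k => by
    rw [h2r]; exact (hgs _ _ le_rfl).sub (hgs _ _ (Nat.le_succ k))
  have hws : ∀ k, ContDiff ℝ ∞ (w k) := fun k =>
    contDiff_cutoff_smul (hr (k + 1)) (hχs _) (hχsupp _) (hdiff k)
  have hgb : ∀ k m, ∀ x ∈ {x : E | ∃ a ∈ A, dist x a < c * t (k + 1)},
      ‖iteratedFDeriv ℝ m (fun x => g (k + 1) x - g k x) x‖ ≤
        t k ^ (M k + 1) * Q m (M (k + 1)) := by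
    intro k m x hx
    refine norm_iteratedFDeriv_jet_sub_jet_le hO hf v (hMm (Nat.le_succ k)) (hV (k + 1))
      (htpos _).le ?_ ((htle k).trans ht1) (fun y hy s hs => hVO (k + 1) y hy s hs.1
        (hs.2.trans (htle k))) hC0 hC hx
    rw [htsucc]; linarith [htpos k]
  have hwb : ∀ k m x, ‖iteratedFDeriv ℝ m (w k) x‖ ≤
      t k ^ (M k + 1) * P m (M (k + 1)) / (c * t (k + 1) / 2) ^ m := by
    intro k m x
    have := norm_iteratedFDeriv_cutoff_smul_le (m := m)
      (B := fun m => t k ^ (M k + 1) * Q m (M (k + 1)))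
      (hr (k + 1)) (hr1 (k + 1)) (hχs _) (hχsupp _) (hdiff k) hK (hχK (k + 1))
      (fun m => mul_nonneg (pow_nonneg (htpos k).le _) (hQ0 _ _))
      (fun m x hx => hgb k m x (by rw [h2r] at hx; exact hx)) x
    refine this.trans (le_of_eq ?_)
    congr 1
    rw [hP, Finset.mul_sum]
    exact Finset.sum_congr rfl fun i _ => by ring
  have hPle : ∀ m, ∀ᶠ k in atTop, m ≤ M k ∧ P m (M (k + 1)) ≤ 2 ^ (k + 1) := by
    intro m
    filter_upwards [hMt.eventually_ge_atTop m, (tendsto_add_atTop_nat 1).eventually hM,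
      (tendsto_add_atTop_nat 1).eventually (hMt.eventually_ge_atTop m)] with k h1 h2 h3
    refine ⟨h1, le_trans ?_ h2⟩
    have h4 : P m (M (k + 1)) ≤ ∑ i ∈ Finset.range (M (k + 1) + 1), P i (M (k + 1)) :=
      Finset.single_le_sum (f := fun i => P i (M (k + 1))) (fun i _ => hP0 i _)
        (Finset.mem_range.2 (by omega))
    linarith [hQ0 0 (M (k + 1))]
  -- once `M k ≥ m`, the factor `t_k ^ (M k + 1)` from Taylor's formula makes up for the `t_k ^ (-m)` due
  -- to the cutoff, and a factor `t_k` is left for summation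
  have hcof : ∀ m : ℕ, ∀ᶠ k in cofinite, ∀ x,
      ‖iteratedFDeriv ℝ m (w k) x‖ ≤ (8 / c) ^ m * 2 * (1 / 2) ^ k := by
    intro m
    rw [Nat.cofinite_eq_atTop]
    filter_upwards [hPle m] with k hk x
    refine (hwb k m x).trans ?_
    have htk := htpos k
    have e1 : (c * t (k + 1) / 2) ^ m = t k ^ m / (8 / c) ^ m := by
      rw [htsucc, ← div_pow]; congr 1; field_simp; norm_num
    rw [e1, div_div_eq_mul_div, div_le_iff₀ (by positivity)]
    have e2 : t k ^ (M k + 1) ≤ t k ^ m * (1 / 4) ^ k := by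
      calc t k ^ (M k + 1) ≤ t k ^ (m + 1) :=
            pow_le_pow_of_le_one htk.le ((htle k).trans ht1) (by omega)
        _ = t k ^ m * t k := pow_succ _ _
        _ ≤ t k ^ m * (1 / 4) ^ k := by
            gcongr
            exact mul_le_of_le_one_left (by positivity) ht1
    calc t k ^ (M k + 1) * P m (M (k + 1)) * (8 / c) ^ m
        ≤ (t k ^ m * (1 / 4) ^ k) * 2 ^ (k + 1) * (8 / c) ^ m := by
          gcongr
          · exact hP0 _ _
          · exact hk.2
      _ = (8 / c) ^ m * 2 * (((1 / 4) ^ k) * 2 ^ k) * t k ^ m := by ring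
      _ = _ := by rw [← mul_pow]; norm_num
  have hsum : ∀ m : ℕ, Summable fun k : ℕ => (8 / c) ^ m * 2 * (1 / 2 : ℝ) ^ k := fun m =>
    (summable_geometric_of_lt_one (by norm_num) (by norm_num)).mul_left _
  refine ⟨fun x => χ 0 x • g 0 x + ∑' k, w k x, ContDiff.add ?_ ?_, fun x hx => ?_⟩
  · refine contDiff_cutoff_smul (hr 0) (hχs _) (hχsupp _) ?_
    rw [h2r]; exact hgs _ _ le_rfl
  · exact contDiff_tsum_of_eventually (N := ⊤) hws (fun k _ => hsum k) fun m _ => hcof m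
  · have hs : Summable fun k => w k x := by
      refine Summable.of_norm_bounded_eventually (hsum 0) ?_
      filter_upwards [hcof 0] with k hk
      simpa using hk x
    have hpart : ∀ n, ∑ k ∈ Finset.range n, w k x = g n x - g 0 x := by
      intro n
      rw [← Finset.sum_range_sub (fun k => g k x)]
      refine Finset.sum_congr rfl fun k _ => ?_
      simp only [hw]
      rw [hχ1 (k + 1) x hx, one_smul]
    have hlim : Tendsto (fun n => g n x) atTop (nhds (f x)) := by
      rw [tendsto_iff_norm_sub_tendsto_zero]
      refine squeeze_zero' (g := fun k => (1 / 2 : ℝ) ^ k)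
        (Eventually.of_forall fun _ => norm_nonneg _) ?_
        (tendsto_pow_atTop_nhds_zero_of_lt_one (by norm_num) (by norm_num))
      filter_upwards [hM] with k hk
      have h5 := norm_jet_sub_le (b := 0) hO hf v (M k) (x := x)
        (C := ‖v‖ ^ (M k + 1) * C (M k + 1)) le_rfl (htpos k).le (fun s hs => by
          rcases hs.1.eq_or_lt with rfl | hs0
          · simpa using hAO hx
          · simpa using hpush x hx s hs0 (hs.2.trans (htle k)) 0 (by simpa using by positivity))
        (fun y hy => by
          have := norm_iteratedFDeriv_dirDeriv_le hO hf v 0 (M k + 1) hy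
          rw [norm_iteratedFDeriv_zero, zero_add] at this
          exact this.trans (by gcongr; exact hC _ y hy))
      rw [jet_zero] at h5
      have h6 : ‖v‖ ^ (M k + 1) * C (M k + 1) ≤ 2 ^ k := by
        have h7 : ‖v‖ ^ (M k + 1) * C (M k + 1) ≤ Q 0 (M k) := by
          have := Finset.single_le_sum (f := fun p => ‖v‖ ^ p * C (0 + p))
            (fun p _ => mul_nonneg (by positivity) (hC0 _))
            (Finset.mem_range.2 (show M k + 1 < M k + 2 by omega))
          have h8 := hQ0 0 (M k)
          simp only [hQ, zero_add] at this h8 ⊢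
          linarith
        have h9 : 0 ≤ ∑ m ∈ Finset.range (M k + 1), P m (M k) :=
          Finset.sum_nonneg fun m _ => hP0 m _
        linarith
      calc ‖g k x - f x‖ ≤ ‖v‖ ^ (M k + 1) * C (M k + 1) * t k ^ (M k + 1) := h5
        _ ≤ 2 ^ k * (1 / 4) ^ k := by
          gcongr
          calc t k ^ (M k + 1) ≤ t k ^ 1 :=
                pow_le_pow_of_le_one (htpos k).le ((htle k).trans ht1) (by omega)
            _ = t₀ * (1 / 4) ^ k := pow_one _
            _ ≤ (1 / 4) ^ k := mul_le_of_le_one_left (by positivity) ht1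
        _ = (1 / 2) ^ k := by rw [← mul_pow]; norm_num
    have hts : ∑' k, w k x = f x - g 0 x := by
      refine tendsto_nhds_unique hs.hasSum.tendsto_sum_nat ?_
      simp only [hpart]
      exact hlim.sub_const _
    simp only [hts, hχ1 0 x hx, one_smul]
    abel

end Extension

/-! ### Combinatorics of the index sets -/

section Combinatorics

variable {n ℓ : ℕ} {I : Fin ℓ → Finset (Fin n)}

theorem hat_subset (j : Fin ℓ) : hat I j ⊆ I j := Finset.sdiff_subset

theorem mem_hat {i : Fin n} {j : Fin ℓ} : i ∈ hat I j ↔ i ∈ I j ∧ ∀ k, I k ⊂ I j → i ∉ I k := by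
  simp [hat]

theorem mem_rest {i : Fin n} : i ∈ rest I ↔ ∀ j, i ∉ I j := by simp [rest]

theorem mem_union {i : Fin n} {J : Finset (Fin ℓ)} : i ∈ union I J ↔ ∃ j ∈ J, i ∈ I j := by
  simp [union]

namespace Admissible

variable (hI : Admissible I)
include hI

theorem hat_nonempty (j : Fin ℓ) : (hat I j).Nonempty := by
  obtain ⟨i, hi, hi'⟩ := Finset.exists_of_ssubset (hI.strict j)
  exact ⟨i, Finset.mem_sdiff.2 ⟨hi, hi'⟩⟩

theorem injective : Function.Injective I := by
  intro j k h
  by_contra hjk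
  obtain ⟨i, hi⟩ := hI.hat_nonempty j
  have hij := hat_subset j hi
  rcases hI.nested j k hjk with h' | h' | h'
  · exact h'.ne h
  · exact h'.ne h.symm
  · exact Finset.disjoint_left.1 h' hij (h ▸ hij)

theorem mem_iff_subset {i : Fin n} {b : Fin ℓ} (hi : i ∈ hat I b) (k : Fin ℓ) :
    i ∈ I k ↔ I b ⊆ I k := by
  refine ⟨fun hk => ?_, fun h => h (hat_subset b hi)⟩
  by_cases hbk : b = k
  · rw [hbk]
  rcases hI.nested b k hbk with h | h | h
  · exact h.subset
  · exact absurd hk ((mem_hat.1 hi).2 k h)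
  · exact absurd hk (Finset.disjoint_left.1 h (hat_subset b hi))

omit hI in
theorem exists_mem_hat {i : Fin n} {j : Fin ℓ} (hi : i ∈ I j) : ∃ b, i ∈ hat I b ∧ I b ⊆ I j := by
  classical
  obtain ⟨b, hb, hmin⟩ := Finset.exists_min_image (Finset.univ.filter fun k => i ∈ I k ∧ I k ⊆ I j)
    (fun k => (I k).card) ⟨j, by simp [hi]⟩
  simp only [Finset.mem_filter, Finset.mem_univ, true_and] at hb hmin
  refine ⟨b, mem_hat.2 ⟨hb.1, fun k hk hik => ?_⟩, hb.2⟩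
  exact absurd (hmin k ⟨hik, hk.subset.trans hb.2⟩) (by simpa using Finset.card_lt_card hk)

theorem eq_of_mem_hat {i : Fin n} {j k : Fin ℓ} (hj : i ∈ hat I j) (hk : i ∈ hat I k) : j = k := by
  apply hI.injective
  exact ((hI.mem_iff_subset hj k).1 (hat_subset k hk)).antisymm
    ((hI.mem_iff_subset hk j).1 (hat_subset j hj))

end Admissible

theorem rest_or_hat (i : Fin n) : i ∈ rest I ∨ ∃ b, i ∈ hat I b := by
  by_cases h : i ∈ rest I
  · exact Or.inl h
  · rw [mem_rest] at h
    push Not at h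
    obtain ⟨j, hj⟩ := h
    obtain ⟨b, hb, -⟩ := Admissible.exists_mem_hat hj
    exact Or.inr ⟨b, hb⟩

end Combinatorics

/-! ### Coordinate projections -/

section Projections

variable {n : ℕ} (s : Finset (Fin n))

@[simp] theorem proj_apply (z : EuclideanSpace ℂ (Fin n)) (i : s) : proj s z i = z i := rfl

theorem proj_add (z w : EuclideanSpace ℂ (Fin n)) : proj s (z + w) = proj s z + proj s w := rfl

theorem proj_smul {R : Type*} [SMul R ℂ] (c : R) (z : EuclideanSpace ℂ (Fin n)) :
    proj s (c • z) = c • proj s z := rfl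

theorem incl_apply (w : EuclideanSpace ℂ s) (i : Fin n) :
    incl s w i = if h : i ∈ s then w ⟨i, h⟩ else 0 := rfl

theorem incl_apply_mem (w : EuclideanSpace ℂ s) {i : Fin n} (h : i ∈ s) :
    incl s w i = w ⟨i, h⟩ := by simp [incl_apply, h]

theorem incl_apply_not_mem (w : EuclideanSpace ℂ s) {i : Fin n} (h : i ∉ s) :
    incl s w i = 0 := by simp [incl_apply, h]

@[simp] theorem proj_incl (w : EuclideanSpace ℂ s) : proj s (incl s w) = w := by
  ext i
  simp [incl_apply]

/-- The projection to the coordinates in `s` as a continuous linear map. -/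
noncomputable def projL : EuclideanSpace ℂ (Fin n) →L[ℂ] EuclideanSpace ℂ s :=
  LinearMap.toContinuousLinearMap
    { toFun := proj s, map_add' := proj_add s, map_smul' := fun c z => proj_smul s c z }

/-- The inclusion of the coordinate subspace with coordinates in `s` as a continuous linear map. -/
noncomputable def inclL : EuclideanSpace ℂ s →L[ℂ] EuclideanSpace ℂ (Fin n) :=
  LinearMap.toContinuousLinearMap
    { toFun := incl s
      map_add' := fun v w => by
        ext i
        by_cases h : i ∈ s <;> simp [incl_apply, h]
      map_smul' := fun c w => by
        ext i
        by_cases h : i ∈ s <;> simp [incl_apply, h] }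

theorem continuous_proj : Continuous (proj s) := (projL s).continuous

theorem isOpenMap_proj : IsOpenMap (proj s) :=
  (projL s).isOpenMap fun w => ⟨incl s w, proj_incl s w⟩

variable {s}

theorem norm_proj_sq (z : EuclideanSpace ℂ (Fin n)) : ‖proj s z‖ ^ 2 = ∑ i ∈ s, ‖z i‖ ^ 2 := by
  rw [EuclideanSpace.norm_sq_eq, ← Finset.sum_coe_sort s fun i => ‖z i‖ ^ 2]
  rfl

theorem norm_apply_le_norm_proj {i : Fin n} (hi : i ∈ s) (z : EuclideanSpace ℂ (Fin n)) :
    ‖z i‖ ≤ ‖proj s z‖ := PiLp.norm_apply_le (proj s z) ⟨i, hi⟩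

theorem norm_proj_le (z : EuclideanSpace ℂ (Fin n)) : ‖proj s z‖ ≤ ‖z‖ := by
  refine le_of_sq_le_sq ?_ (norm_nonneg _)
  rw [norm_proj_sq, EuclideanSpace.norm_sq_eq]
  exact Finset.sum_le_sum_of_subset_of_nonneg (Finset.subset_univ _) fun _ _ _ => by positivity

theorem proj_congr {z w : EuclideanSpace ℂ (Fin n)} (h : ∀ i ∈ s, z i = w i) :
    proj s z = proj s w := by
  ext i
  exact h i i.2

theorem norm_le_sum_apply (z : EuclideanSpace ℂ (Fin n)) : ‖z‖ ≤ ∑ i, ‖z i‖ := by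
  refine le_of_sq_le_sq ?_ (Finset.sum_nonneg fun _ _ => norm_nonneg _)
  rw [EuclideanSpace.norm_sq_eq]
  exact Finset.sum_sq_le_sq_sum_of_nonneg fun i _ => norm_nonneg (z i)

end Projections

/-! ### Shrinking convex sets and cones -/

section Shrinking

open Metric

variable {E : Type*} [NormedAddCommGroup E] [NormedSpace ℝ E]

/-- The points of `W` of norm less than `κ⁻¹` whose distance to the complement of `W` exceeds `κ`. -/
def shrinkConvex (W : Set E) (κ : ℝ) : Set E := {w | closedBall w κ ⊆ W} ∩ ball 0 κ⁻¹

/-- The cone of the points `x` of the cone `G` with `dist x Gᶜ > κ ‖x‖`. It is convex because the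
distance to the complement of a convex set is a concave function. -/
def shrinkCone (G : ConvexCone ℝ E) (κ : ℝ) (hκ : 0 ≤ κ) : ConvexCone ℝ E where
  carrier := {x | closedBall x (κ * ‖x‖) ⊆ G}
  smul_mem' := by
    intro c hc x hx y hy
    have h1 : c⁻¹ • y ∈ closedBall x (κ * ‖x‖) := by
      rw [mem_closedBall, dist_eq_norm] at hy ⊢
      have : c⁻¹ • y - x = c⁻¹ • (y - c • x) := by
        rw [smul_sub, smul_smul, inv_mul_cancel₀ hc.ne', one_smul]
      rw [this, norm_smul, norm_inv, Real.norm_of_nonneg hc.le, inv_mul_le_iff₀ hc]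
      refine hy.trans (le_of_eq ?_)
      rw [norm_smul, Real.norm_of_nonneg hc.le]; ring
    have h2 := G.smul_mem hc (hx h1)
    rwa [smul_smul, mul_inv_cancel₀ hc.ne', one_smul] at h2
  add_mem' := by
    intro x hx y hy w hw
    -- distribute the displacement over the two summands in proportion to their norms
    rcases eq_or_ne (‖x‖ + ‖y‖) 0 with h0 | h0
    · have hx0 : x = 0 := norm_eq_zero.1 (by linarith [norm_nonneg x, norm_nonneg y])
      subst hx0
      rw [zero_add] at hw
      exact hy hw
    have hpos : 0 < ‖x‖ + ‖y‖ := lt_of_le_of_ne (by positivity) h0.symm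
    set u := w - (x + y) with hu
    have hun : ‖u‖ ≤ κ * (‖x‖ + ‖y‖) := by
      rw [mem_closedBall, dist_eq_norm] at hw
      exact hw.trans (mul_le_mul_of_nonneg_left (norm_add_le _ _) hκ)
    have key : ∀ a : E, ‖(‖a‖ / (‖x‖ + ‖y‖)) • u‖ ≤ κ * ‖a‖ := by
      intro a
      rw [norm_smul, Real.norm_of_nonneg (by positivity)]
      calc ‖a‖ / (‖x‖ + ‖y‖) * ‖u‖ ≤ ‖a‖ / (‖x‖ + ‖y‖) * (κ * (‖x‖ + ‖y‖)) := by gcongr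
        _ = κ * ‖a‖ := by field_simp
    have h1 := hx (show x + (‖x‖ / (‖x‖ + ‖y‖)) • u ∈ closedBall x (κ * ‖x‖) by
      rw [mem_closedBall, dist_eq_norm, add_sub_cancel_left]; exact key x)
    have h2 := hy (show y + (‖y‖ / (‖x‖ + ‖y‖)) • u ∈ closedBall y (κ * ‖y‖) by
      rw [mem_closedBall, dist_eq_norm, add_sub_cancel_left]; exact key y)
    have h3 := G.add_mem h1 h2
    have h4 : x + (‖x‖ / (‖x‖ + ‖y‖)) • u + (y + (‖y‖ / (‖x‖ + ‖y‖)) • u) = w := by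
      rw [add_add_add_comm, ← add_smul, ← add_div, div_self h0, one_smul, hu]
      abel
    rwa [h4] at h3

theorem shrinkCone_le (G : ConvexCone ℝ E) (κ : ℝ) (hκ : 0 ≤ κ) :
    (shrinkCone G κ hκ : Set E) ⊆ G :=
  fun _ hx => hx (mem_closedBall_self (by positivity))

theorem shrinkCone_anti (G : ConvexCone ℝ E) {κ κ' : ℝ} (hκ : 0 ≤ κ) (h : κ ≤ κ') :
    (shrinkCone G κ' (hκ.trans h) : Set E) ⊆ shrinkCone G κ hκ :=
  fun _ hx => (closedBall_subset_closedBall (by gcongr)).trans hx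

omit [NormedSpace ℝ E] in
theorem shrinkConvex_subset (W : Set E) {κ : ℝ} (hκ : 0 ≤ κ) : shrinkConvex W κ ⊆ W :=
  fun _ hx => hx.1 (mem_closedBall_self hκ)

omit [NormedSpace ℝ E] in
theorem shrinkConvex_anti (W : Set E) {κ κ' : ℝ} (hκ : 0 < κ) (h : κ ≤ κ') :
    shrinkConvex W κ' ⊆ shrinkConvex W κ := fun _ hx =>
  ⟨(closedBall_subset_closedBall h).trans hx.1, ball_subset_ball (inv_anti₀ hκ h) hx.2⟩

theorem convex_shrinkConvex {W : Set E} (hW : Convex ℝ W) (κ : ℝ) :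
    Convex ℝ (shrinkConvex W κ) := by
  refine Convex.inter ?_ (convex_ball 0 _)
  intro x hx y hy a b ha hb hab w hw
  set u := w - (a • x + b • y) with hu
  have hun : ‖u‖ ≤ κ := by rwa [mem_closedBall, dist_eq_norm] at hw
  have h1 := hx (show x + u ∈ closedBall x κ by simpa [dist_eq_norm] using hun)
  have h2 := hy (show y + u ∈ closedBall y κ by simpa [dist_eq_norm] using hun)
  have h3 := hW h1 h2 ha hb hab
  have h4 : a • (x + u) + b • (y + u) = w := by
    rw [smul_add, smul_add, add_add_add_comm, ← add_smul, hab, one_smul, hu]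
    abel
  rwa [h4] at h3

variable [FiniteDimensional ℝ E]

omit [NormedSpace ℝ E] [FiniteDimensional ℝ E] in
theorem exists_closedBall_subset {K W : Set E} (hK : IsCompact K) (hW : IsOpen W) (h : K ⊆ W) :
    ∃ δ > 0, ∀ x ∈ K, closedBall x δ ⊆ W := by
  obtain ⟨δ, hδ, hsub⟩ := hK.exists_cthickening_subset_open hW h
  exact ⟨δ, hδ, fun x hx => (closedBall_subset_cthickening hx δ).trans hsub⟩

theorem isOpen_shrinkConvex {W : Set E} (hW : IsOpen W) (κ : ℝ) : IsOpen (shrinkConvex W κ) := by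
  have : ProperSpace E := FiniteDimensional.proper ℝ E
  refine IsOpen.inter (isOpen_iff.2 fun w hw => ?_) isOpen_ball
  obtain ⟨δ, hδ, hsub⟩ := exists_closedBall_subset (isCompact_closedBall w κ) hW hw
  refine ⟨δ, hδ, fun y hy u hu => ?_⟩
  have h1 : u + (w - y) ∈ closedBall w κ := by
    rw [mem_closedBall, dist_eq_norm] at hu ⊢
    rwa [show u + (w - y) - w = u - y by abel]
  refine hsub _ h1 ?_
  rw [mem_closedBall, dist_eq_norm]
  rw [mem_ball, dist_eq_norm] at hy
  rw [show u - (u + (w - y)) = y - w by abel]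
  exact hy.le

theorem isOpen_shrinkCone {G : ConvexCone ℝ E} (hG : IsOpen (G : Set E)) (κ : ℝ) (hκ : 0 ≤ κ) :
    IsOpen (shrinkCone G κ hκ : Set E) := by
  have : ProperSpace E := FiniteDimensional.proper ℝ E
  refine isOpen_iff.2 fun x hx => ?_
  obtain ⟨δ, hδ, hsub⟩ := exists_closedBall_subset (isCompact_closedBall x (κ * ‖x‖)) hG hx
  refine ⟨δ / (κ + 1), by positivity, fun y hy w hw => ?_⟩
  rw [mem_ball, dist_eq_norm] at hy
  rw [mem_closedBall, dist_eq_norm] at hw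
  -- contract the displacement `w - y` to length at most `κ ‖x‖`
  have hxy : ‖y‖ ≤ ‖x‖ + ‖y - x‖ := by
    have := norm_add_le x (y - x); rwa [add_sub_cancel] at this
  have hle : ‖w - y‖ ≤ κ * ‖x‖ + κ * ‖y - x‖ := hw.trans (by rw [← mul_add]; gcongr)
  obtain ⟨u, hu, hwu⟩ : ∃ u : E, ‖u‖ ≤ κ * ‖x‖ ∧ ‖(w - y) - u‖ ≤ κ * ‖y - x‖ := by
    rcases le_or_gt ‖w - y‖ (κ * ‖x‖) with h | h
    · exact ⟨w - y, h, by simpa using by positivity⟩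
    · have h0 : 0 < ‖w - y‖ := lt_of_le_of_lt (by positivity) h
      refine ⟨(κ * ‖x‖ / ‖w - y‖) • (w - y), ?_, ?_⟩
      · rw [norm_smul, Real.norm_of_nonneg (by positivity), div_mul_cancel₀ _ h0.ne']
      · have : (w - y) - (κ * ‖x‖ / ‖w - y‖) • (w - y) =
            (1 - κ * ‖x‖ / ‖w - y‖) • (w - y) := by rw [sub_smul, one_smul]
        rw [this, norm_smul, Real.norm_of_nonneg (by
          rw [sub_nonneg, div_le_one h0]; exact h.le), sub_mul, one_mul,
          div_mul_cancel₀ _ h0.ne']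
        linarith
  refine hsub (x + u) (by rw [mem_closedBall, dist_eq_norm, add_sub_cancel_left]; exact hu) ?_
  rw [mem_closedBall, dist_eq_norm]
  have e : w - (x + u) = (y - x) + ((w - y) - u) := by abel
  rw [e]
  refine (norm_add_le _ _).trans ?_
  calc ‖y - x‖ + ‖w - y - u‖ ≤ ‖y - x‖ + κ * ‖y - x‖ := by gcongr
    _ = ‖y - x‖ * (κ + 1) := by ring
    _ ≤ δ := by rw [← le_div_iff₀ (by positivity)]; exact hy.le

omit [NormedSpace ℝ E] [FiniteDimensional ℝ E] in
theorem closure_shrinkConvex_subset {W : Set E} {κ κ' : ℝ} (hκ' : 0 < κ') (h : κ' < κ) :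
    closure (shrinkConvex W κ) ⊆ shrinkConvex W κ' := by
  intro x hx
  constructor
  · intro y hy
    obtain ⟨x', hx', hd⟩ := Metric.mem_closure_iff.1 hx (κ - κ') (by linarith)
    refine hx'.1 ?_
    rw [mem_closedBall] at hy ⊢
    linarith [dist_triangle y x x']
  · have h1 : x ∈ closedBall (0 : E) κ⁻¹ := closure_ball_subset_closedBall
      (closure_mono Set.inter_subset_right hx)
    rw [mem_closedBall] at h1
    rw [mem_ball]
    exact h1.trans_lt (inv_strictAnti₀ hκ' h)

omit [FiniteDimensional ℝ E] in
theorem closure_shrinkCone_diff_subset (G : ConvexCone ℝ E) {κ κ' : ℝ} (hκ' : 0 ≤ κ')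
    (h : κ' < κ) :
    closure (shrinkCone G κ (hκ'.trans h.le) : Set E) \ {0} ⊆ shrinkCone G κ' hκ' := by
  rintro x ⟨hx, hx0⟩ y hy
  have hxpos : 0 < ‖x‖ := norm_pos_iff.2 hx0
  have hη : 0 < (κ - κ') * ‖x‖ / (1 + κ) := by
    have : 0 < κ - κ' := by linarith
    have : 0 < 1 + κ := by linarith
    positivity
  obtain ⟨x', hx', hd⟩ := Metric.mem_closure_iff.1 hx _ hη
  refine hx' ?_
  rw [mem_closedBall] at hy ⊢
  rw [lt_div_iff₀ (by linarith)] at hd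
  have h1 := dist_triangle y x x'
  have h2 : ‖x‖ ≤ ‖x'‖ + dist x x' := by
    rw [dist_eq_norm]
    have := norm_add_le x' (x - x'); rwa [add_sub_cancel] at this
  have h3 : κ * ‖x‖ ≤ κ * (‖x'‖ + dist x x') := mul_le_mul_of_nonneg_left h2 (by linarith)
  nlinarith

/-- A cone that is properly contained in an open cone keeps a distance from its complement that is
comparable with the norm. -/
theorem exists_closedBall_subset_cone {G' G : ConvexCone ℝ E} (hG : IsOpen (G : Set E))
    (h : closure (G' : Set E) \ {0} ⊆ G) :
    ∃ δ > 0, ∀ x ∈ closure (G' : Set E), x ≠ 0 → closedBall x (δ * ‖x‖) ⊆ G := by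
  have : ProperSpace E := FiniteDimensional.proper ℝ E
  obtain ⟨δ, hδ, hsub⟩ := exists_closedBall_subset (K := closure (G' : Set E) ∩ sphere 0 1)
    ((isCompact_sphere 0 1).inter_left isClosed_closure) hG fun x hx => h ⟨hx.1, by
      rintro rfl; simpa using hx.2⟩
  refine ⟨δ, hδ, fun x hx hx0 => ?_⟩
  have hpos : 0 < ‖x‖ := norm_pos_iff.2 hx0
  have hcl : ‖x‖⁻¹ • x ∈ closure (G' : Set E) := by
    have hmap : Set.MapsTo (fun y : E => ‖x‖⁻¹ • y) G' G' := fun y hy =>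
      G'.smul_mem (inv_pos.2 hpos) hy
    exact hmap.closure (continuous_const_smul _) hx
  have h1 := hsub (‖x‖⁻¹ • x) ⟨hcl, by
    rw [mem_sphere_zero_iff_norm, norm_smul, norm_inv, norm_norm, inv_mul_cancel₀ hpos.ne']⟩
  intro y hy
  have h2 : ‖x‖⁻¹ • y ∈ closedBall (‖x‖⁻¹ • x) δ := by
    rw [mem_closedBall, dist_eq_norm] at hy ⊢
    rw [← smul_sub, norm_smul, norm_inv, norm_norm, inv_mul_le_iff₀ hpos]
    linarith
  have h3 := G.smul_mem hpos (h1 h2)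
  rwa [smul_smul, mul_inv_cancel₀ hpos.ne', one_smul] at h3

omit [FiniteDimensional ℝ E] in
theorem zero_not_mem_of_salient [Nontrivial E] {G : ConvexCone ℝ E} (hG : IsOpen (G : Set E))
    (hs : G.Salient) : (0 : E) ∉ G := by
  intro h0
  obtain ⟨δ, hδ, hsub⟩ := isOpen_iff.1 hG 0 h0
  obtain ⟨x, hx, hx0⟩ : ∃ x : E, ‖x‖ < δ ∧ x ≠ 0 := by
    obtain ⟨y, hy⟩ := exists_ne (0 : E)
    have hy' : 0 < ‖y‖ := norm_pos_iff.2 hy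
    refine ⟨(δ / 2 / ‖y‖) • y, ?_, smul_ne_zero (by positivity) hy⟩
    rw [norm_smul, Real.norm_of_nonneg (by positivity), div_mul_cancel₀ _ hy'.ne']
    linarith
  exact hs x (hsub (by simpa using hx)) hx0 (hsub (by simpa using hx))

end Shrinking

/-! ### Proper inclusions and exhaustions of multi-cones -/

section Exhaustion

open Metric Filter

variable {n ℓ : ℕ} {I : Fin ℓ → Finset (Fin n)}

namespace MultiCone

theorem mem_U {S : MultiCone I} {z : EuclideanSpace ℂ (Fin n)} :
    z ∈ S.U ↔ (∀ j, ‖proj (hat I j) z‖ < S.radius j) ∧ proj (rest I) z ∈ S.W := by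
  simp [U]

theorem mem_carrier {S : MultiCone I} {z : EuclideanSpace ℂ (Fin n)} :
    z ∈ S.carrier ↔ z ∈ S.U ∧ ∀ j, proj (hat I j) z ∈ S.G j ∧
      ∀ b, I b ⊂ I j → ‖proj (hat I b) z‖ < S.ε * ‖proj (hat I j) z‖ := by
  simp only [carrier, Set.mem_inter_iff, Set.mem_iInter, V, Set.mem_ofPred_eq]
  exact ⟨fun h => ⟨h.1, fun j => (h.2 j).2⟩, fun h => ⟨h.1, fun j => ⟨h.1, h.2 j⟩⟩⟩

theorem isOpen_U (S : MultiCone I) : IsOpen S.U := by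
  have : S.U = (⋂ j, proj (hat I j) ⁻¹' ball 0 (S.radius j)) ∩ proj (rest I) ⁻¹' S.W := by
    ext z; simp [U]
  rw [this]
  exact (isOpen_iInter_of_finite fun j => isOpen_ball.preimage (continuous_proj _)).inter
    (S.isOpen_W.preimage (continuous_proj _))

theorem isOpen_carrier (S : MultiCone I) : IsOpen S.carrier := by
  have : S.carrier = S.U ∩ ⋂ j, (proj (hat I j) ⁻¹' (S.G j) ∩
      ⋂ b : {b // I b ⊂ I j},
        {z | ‖proj (hat I b) z‖ < S.ε * ‖proj (hat I j) z‖}) := by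
    ext z; simp [mem_carrier]
  rw [this]
  refine S.isOpen_U.inter (isOpen_iInter_of_finite fun j =>
    ((S.isOpen_G j).preimage (continuous_proj _)).inter (isOpen_iInter_of_finite fun b => ?_))
  exact isOpen_lt (continuous_proj _).norm (continuous_const.mul (continuous_proj _).norm)

theorem zero_not_mem_G (hI : Admissible I) (S : MultiCone I) (j : Fin ℓ) : 0 ∉ S.G j := by
  have : Nonempty (hat I j) := (hI.hat_nonempty j).to_subtype
  exact zero_not_mem_of_salient (S.isOpen_G j) (S.proper_G j)

theorem norm_proj_pos (hI : Admissible I) {S : MultiCone I} {z : EuclideanSpace ℂ (Fin n)}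
    (hz : z ∈ S.carrier) (j : Fin ℓ) : 0 < ‖proj (hat I j) z‖ := by
  rw [norm_pos_iff]
  intro h
  exact S.zero_not_mem_G hI j (h ▸ ((mem_carrier.1 hz).2 j).1)

/-- Proper inclusion in terms of the data of the multi-cones. -/
theorem properlyContained_iff (hI : Admissible I) {S' S : MultiCone I} :
    S'.ProperlyContained S ↔ S'.ε < S.ε ∧ (∀ j, S'.radius j < S.radius j) ∧
      IsCompact (closure S'.W) ∧ closure S'.W ⊆ S.W ∧
      ∀ j, closure (S'.G j : Set (EuclideanSpace ℂ (hat I j))) \ {0} ⊆ (S.G j : Set _) := by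
  have hdisj : ∀ j i, i ∈ hat I j → i ∉ rest I := fun j i hi hr => mem_rest.1 hr j (hat_subset j hi)
  constructor
  · intro h
    obtain ⟨w₀, hw₀⟩ := S'.nonempty_W
    -- test the inclusion of `U'` on points `(0, w)` and `(x, w₀)`
    have hWmem : ∀ w ∈ S'.W, incl (rest I) w ∈ S'.U := by
      intro w hw
      refine mem_U.2 ⟨fun j => ?_, by rwa [proj_incl]⟩
      have : proj (hat I j) (incl (rest I) w) = 0 := by
        ext i
        rw [proj_apply, incl_apply_not_mem _ _ (hdisj j i i.2)]; rfl
      rw [this, norm_zero]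
      exact S'.radius_pos j
    have hcW : closure S'.W ⊆ proj (rest I) '' closure S'.U := by
      refine closure_minimal (fun w hw => ⟨_, subset_closure (hWmem w hw), proj_incl _ _⟩) ?_
      exact (h.isCompact_closure_U.image (continuous_proj _)).isClosed
    refine ⟨h.ε_lt, fun j => ?_, ?_, ?_, h.closure_G_subset⟩
    · have : Nonempty (hat I j) := (hI.hat_nonempty j).to_subtype
      obtain ⟨x, hx⟩ : ∃ x : EuclideanSpace ℂ (hat I j), ‖x‖ = S'.radius j :=
        exists_norm_eq _ (S'.radius_pos j).le
      have hU : ∀ t : ℝ, t ∈ Set.Ico (0 : ℝ) 1 →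
          incl (rest I) w₀ + t • incl (hat I j) x ∈ S'.U := by
        intro t ht
        refine mem_U.2 ⟨fun k => ?_, ?_⟩
        · by_cases hkj : k = j
          · subst hkj
            have : proj (hat I k) (incl (rest I) w₀ + t • incl (hat I k) x) = t • x := by
              rw [proj_add, proj_smul, proj_incl]
              ext i
              simp [incl_apply_not_mem _ _ (hdisj k i i.2)]
            rw [this, norm_smul, Real.norm_of_nonneg ht.1, hx]
            exact mul_lt_of_lt_one_left (S'.radius_pos k) ht.2
          · have : proj (hat I k) (incl (rest I) w₀ + t • incl (hat I j) x) = 0 := by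
              ext i
              have : (i : Fin n) ∉ hat I j := fun hi => hkj (hI.eq_of_mem_hat i.2 hi)
              simp [incl_apply_not_mem _ _ (hdisj k i i.2), incl_apply_not_mem _ _ this]
            rw [this, norm_zero]
            exact S'.radius_pos k
        · have : proj (rest I) (incl (rest I) w₀ + t • incl (hat I j) x) = w₀ := by
            ext i
            have : (i : Fin n) ∉ hat I j := fun hi => hdisj j i hi i.2
            simp [incl_apply_mem _ _ i.2, incl_apply_not_mem _ _ this]
          rwa [this]
      have hcl : incl (rest I) w₀ + (1 : ℝ) • incl (hat I j) x ∈ closure S'.U := by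
        have h1 : (1 : ℝ) ∈ closure (Set.Ico (0 : ℝ) 1) := by
          rw [closure_Ico zero_ne_one]; simp
        have hmap : Set.MapsTo (fun t : ℝ => incl (rest I) w₀ + t • incl (hat I j) x)
            (Set.Ico 0 1) S'.U := fun t ht => hU t ht
        exact hmap.closure (by fun_prop) h1
      have h2 := (mem_U.1 (h.closure_U_subset hcl)).1 j
      have h3 : proj (hat I j) (incl (rest I) w₀ + (1 : ℝ) • incl (hat I j) x) = x := by
        rw [proj_add, proj_smul, proj_incl]
        ext i
        simp [incl_apply_not_mem _ _ (hdisj j i i.2)]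
      rwa [h3, hx] at h2
    · exact (h.isCompact_closure_U.image (continuous_proj _)).of_isClosed_subset isClosed_closure hcW
    · intro w hw
      obtain ⟨z, hz, rfl⟩ := hcW hw
      exact (mem_U.1 (h.closure_U_subset hz)).2
  · rintro ⟨hε, hr, hWc, hW, hG⟩
    have hclosed : IsClosed {z : EuclideanSpace ℂ (Fin n) |
        (∀ j, ‖proj (hat I j) z‖ ≤ S'.radius j) ∧ proj (rest I) z ∈ closure S'.W} := by
      have : {z : EuclideanSpace ℂ (Fin n) |
          (∀ j, ‖proj (hat I j) z‖ ≤ S'.radius j) ∧ proj (rest I) z ∈ closure S'.W} =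
          (⋂ j, {z | ‖proj (hat I j) z‖ ≤ S'.radius j}) ∩ proj (rest I) ⁻¹' closure S'.W := by
        ext z; simp
      rw [this]
      exact (isClosed_iInter fun j => isClosed_le (continuous_proj _).norm continuous_const).inter
        (isClosed_closure.preimage (continuous_proj _))
    have hsub : closure S'.U ⊆ {z : EuclideanSpace ℂ (Fin n) |
        (∀ j, ‖proj (hat I j) z‖ ≤ S'.radius j) ∧ proj (rest I) z ∈ closure S'.W} :=
      closure_minimal (fun z hz => ⟨fun j => ((mem_U.1 hz).1 j).le,
        subset_closure (mem_U.1 hz).2⟩) hclosed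
    refine ⟨hε, ?_, fun z hz => ?_, hG⟩
    · obtain ⟨R, hR⟩ := hWc.isBounded.exists_norm_le
      refine isCompact_of_isClosed_isBounded isClosed_closure ?_
      refine isBounded_iff_forall_norm_le.2 ⟨∑ i : Fin n, (|R| + ∑ j, S'.radius j), fun z hz => ?_⟩
      refine (norm_le_sum_apply z).trans (Finset.sum_le_sum fun i _ => ?_)
      have hpos : ∀ k, 0 ≤ S'.radius k := fun k => (S'.radius_pos k).le
      rcases rest_or_hat (I := I) i with hi | ⟨j, hj⟩
      · have h1 := (norm_apply_le_norm_proj hi z).trans (hR _ (hsub hz).2)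
        have h2 : 0 ≤ ∑ j, S'.radius j := Finset.sum_nonneg fun k _ => hpos k
        linarith [le_abs_self R]
      · have h1 := (norm_apply_le_norm_proj hj z).trans ((hsub hz).1 j)
        have h2 : S'.radius j ≤ ∑ j, S'.radius j :=
          Finset.single_le_sum (fun k _ => hpos k) (Finset.mem_univ j)
        linarith [abs_nonneg R]
    · exact mem_U.2 ⟨fun j => ((hsub hz).1 j).trans_lt (hr j), hW (hsub hz).2⟩

namespace ProperlyContained

theorem G_le (hI : Admissible I) {S' S : MultiCone I} (h : S'.ProperlyContained S) (j : Fin ℓ) :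
    (S'.G j : Set (EuclideanSpace ℂ (hat I j))) ⊆ S.G j := fun x hx =>
  h.closure_G_subset j ⟨subset_closure hx, by
    rintro rfl; exact S'.zero_not_mem_G hI j hx⟩

theorem carrier_subset (hI : Admissible I) {S' S : MultiCone I} (h : S'.ProperlyContained S) :
    S'.carrier ⊆ S.carrier := by
  intro z hz
  rw [mem_carrier] at hz ⊢
  refine ⟨h.closure_U_subset (subset_closure hz.1), fun j => ⟨h.G_le hI j (hz.2 j).1,
    fun b hb => ((hz.2 j).2 b hb).trans_le ?_⟩⟩
  gcongr
  exact h.ε_lt.le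

end ProperlyContained

/-- The condition on the parameter `κ` under which shrinking a multi-cone yields a multi-cone. -/
structure Shrinkable (S : MultiCone I) (κ : ℝ) : Prop where
  pos : 0 < κ
  nonempty_W : (shrinkConvex S.W κ).Nonempty
  nonempty_G : ∀ j, (shrinkCone (S.G j) κ pos.le : Set (EuclideanSpace ℂ (hat I j))).Nonempty

theorem Shrinkable.mono {S : MultiCone I} {κ κ' : ℝ} (h : S.Shrinkable κ') (hκ : 0 < κ)
    (hle : κ ≤ κ') : S.Shrinkable κ :=
  ⟨hκ, h.nonempty_W.mono (shrinkConvex_anti _ hκ hle),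
    fun j => (h.nonempty_G j).mono (shrinkCone_anti _ hκ.le hle)⟩

/-- The multi-cone obtained by shrinking all the data of `S`. As `κ` tends to `0`, these exhaust
`S`. -/
noncomputable def shrink (S : MultiCone I) (κ : ℝ) (h : S.Shrinkable κ) : MultiCone I where
  radius j := S.radius j / (1 + κ)
  radius_pos j := div_pos (S.radius_pos j) (by linarith [h.pos])
  W := shrinkConvex S.W κ
  isOpen_W := isOpen_shrinkConvex S.isOpen_W κ
  convex_W := convex_shrinkConvex S.convex_W κ
  nonempty_W := h.nonempty_W
  G j := shrinkCone (S.G j) κ h.pos.le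
  isOpen_G j := isOpen_shrinkCone (S.isOpen_G j) κ h.pos.le
  nonempty_G := h.nonempty_G
  proper_G j x hx hx0 hnx :=
    S.proper_G j x (shrinkCone_le _ _ h.pos.le hx) hx0 (shrinkCone_le _ _ h.pos.le hnx)
  ε := S.ε / (1 + κ)
  ε_pos := div_pos S.ε_pos (by linarith [h.pos])

theorem isCompact_closure_shrinkConvex {s : Finset (Fin n)} (W : Set (EuclideanSpace ℂ s)) (κ : ℝ) :
    IsCompact (closure (shrinkConvex W κ)) :=
  (isBounded_ball.subset Set.inter_subset_right).isCompact_closure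

theorem shrink_properlyContained (hI : Admissible I) (S : MultiCone I) {κ : ℝ}
    (h : S.Shrinkable κ) : (S.shrink κ h).ProperlyContained S := by
  have h1 : 1 < 1 + κ := by linarith [h.pos]
  refine (properlyContained_iff hI).2 ⟨div_lt_self S.ε_pos h1,
    fun j => div_lt_self (S.radius_pos j) h1, isCompact_closure_shrinkConvex _ _, ?_, fun j => ?_⟩
  · exact (closure_shrinkConvex_subset (half_pos h.pos) (half_lt_self h.pos)).trans
      (shrinkConvex_subset _ (half_pos h.pos).le)
  · exact (closure_shrinkCone_diff_subset _ (half_pos h.pos).le (half_lt_self h.pos)).trans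
      (shrinkCone_le _ _ _)

theorem shrink_properlyContained_shrink (hI : Admissible I) (S : MultiCone I) {κ κ' : ℝ}
    (h : S.Shrinkable κ) (h' : S.Shrinkable κ') (hκ : κ' < κ) :
    (S.shrink κ h).ProperlyContained (S.shrink κ' h') := by
  have h1 : 0 < 1 + κ' := by linarith [h'.pos]
  exact (properlyContained_iff hI).2 ⟨div_lt_div_of_pos_left S.ε_pos h1 (by linarith),
    fun j => div_lt_div_of_pos_left (S.radius_pos j) h1 (by linarith),
    isCompact_closure_shrinkConvex _ _, closure_shrinkConvex_subset h'.pos hκ,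
    fun j => closure_shrinkCone_diff_subset _ h'.pos.le hκ⟩

theorem eventually_lt_div {a b : ℝ} (hab : a < b) :
    ∀ᶠ κ in nhdsWithin (0 : ℝ) (Set.Ioi 0), a < b / (1 + κ) := by
  have : Tendsto (fun κ : ℝ => b / (1 + κ)) (nhds 0) (nhds (b / (1 + 0))) :=
    tendsto_const_nhds.div (tendsto_const_nhds.add tendsto_id) (by norm_num)
  rw [add_zero, div_one] at this
  exact nhdsWithin_le_nhds (this.eventually_const_lt hab)

theorem eventually_subset_shrinkConvex {E : Type*} [NormedAddCommGroup E] {K W : Set E}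
    (hK : IsCompact K) (hW : IsOpen W) (h : K ⊆ W) :
    ∀ᶠ κ in nhdsWithin (0 : ℝ) (Set.Ioi 0), K ⊆ shrinkConvex W κ := by
  obtain ⟨δ, hδ, hsub⟩ := exists_closedBall_subset hK hW h
  obtain ⟨R, hR⟩ := hK.isBounded.exists_norm_le
  have h1 : ∀ᶠ κ in nhdsWithin (0 : ℝ) (Set.Ioi 0), R < κ⁻¹ :=
    tendsto_inv_nhdsGT_zero.eventually_gt_atTop R
  filter_upwards [nhdsWithin_le_nhds (eventually_le_nhds hδ), h1] with κ hκ hκR x hx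
  exact ⟨(closedBall_subset_closedBall hκ).trans (hsub x hx),
    mem_ball_zero_iff.2 ((hR x hx).trans_lt hκR)⟩

/-- Every multi-cone that is properly contained in `S` is properly contained in the shrunk
multi-cones for small parameters. -/
theorem ProperlyContained.eventually_shrink (hI : Admissible I) {S' S : MultiCone I}
    (h : S'.ProperlyContained S) : ∀ᶠ κ in nhdsWithin (0 : ℝ) (Set.Ioi 0),
      ∃ hκ : S.Shrinkable κ, S'.ProperlyContained (S.shrink κ hκ) := by
  obtain ⟨hε, hr, hWc, hW, hG⟩ := (properlyContained_iff hI).1 h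
  have h1 : ∀ j, ∀ᶠ κ in nhdsWithin (0 : ℝ) (Set.Ioi 0), ∀ hκ : 0 ≤ κ,
      closure (S'.G j : Set (EuclideanSpace ℂ (hat I j))) \ {0} ⊆ shrinkCone (S.G j) κ hκ := by
    intro j
    obtain ⟨δ, hδ, hsub⟩ := exists_closedBall_subset_cone (S.isOpen_G j) (hG j)
    filter_upwards [nhdsWithin_le_nhds (eventually_le_nhds hδ)] with κ hκ hκ0 x hx
    exact (closedBall_subset_closedBall (by gcongr)).trans (hsub x hx.1 hx.2)
  filter_upwards [self_mem_nhdsWithin, eventually_lt_div hε,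
    (eventually_all).2 fun j => eventually_lt_div (hr j),
    eventually_subset_shrinkConvex hWc S.isOpen_W hW, eventually_all.2 h1] with κ h0 h2 h3 h4 h5
  have h0' : 0 < κ := h0
  have hκ : S.Shrinkable κ := ⟨h0', S'.nonempty_W.mono (subset_closure.trans h4), fun j =>
    (S'.nonempty_G j).mono fun x hx => h5 j h0'.le ⟨subset_closure hx, by
      rintro rfl; exact S'.zero_not_mem_G hI j hx⟩⟩
  exact ⟨hκ, (properlyContained_iff hI).2 ⟨h2, h3, hWc, h4, fun j => h5 j h0'.le⟩⟩

theorem eventually_mem_shrinkCone {E : Type*} [NormedAddCommGroup E] [NormedSpace ℝ E]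
    {G : ConvexCone ℝ E} (hG : IsOpen (G : Set E)) {x : E} (hx : x ∈ G) :
    ∀ᶠ κ in nhdsWithin (0 : ℝ) (Set.Ioi 0), ∀ hκ : 0 ≤ κ, x ∈ shrinkCone G κ hκ := by
  obtain ⟨δ, hδ, hsub⟩ := isOpen_iff.1 hG x hx
  have h1 : Tendsto (fun κ : ℝ => κ * ‖x‖) (nhds 0) (nhds (0 * ‖x‖)) :=
    tendsto_id.mul_const _
  rw [zero_mul] at h1
  filter_upwards [nhdsWithin_le_nhds (h1.eventually_lt_const hδ)] with κ hκ hκ0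
  exact (closedBall_subset_ball hκ).trans hsub

theorem eventually_shrinkable (S : MultiCone I) :
    ∀ᶠ κ in nhdsWithin (0 : ℝ) (Set.Ioi 0), S.Shrinkable κ := by
  obtain ⟨w, hw⟩ := S.nonempty_W
  choose x hx using S.nonempty_G
  filter_upwards [self_mem_nhdsWithin, eventually_subset_shrinkConvex (isCompact_singleton (x := w))
    S.isOpen_W (by simpa using hw),
    eventually_all.2 fun j => eventually_mem_shrinkCone (S.isOpen_G j) (hx j)] with κ h0 h1 h2
  have h0' : 0 < κ := h0
  exact ⟨h0', ⟨w, h1 rfl⟩, fun j => ⟨x j, h2 j h0'.le⟩⟩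

theorem eventually_mem_shrink {S : MultiCone I} {z : EuclideanSpace ℂ (Fin n)}
    (hz : z ∈ S.carrier) : ∀ᶠ κ in nhdsWithin (0 : ℝ) (Set.Ioi 0),
      ∀ hκ : S.Shrinkable κ, z ∈ (S.shrink κ hκ).carrier := by
  rw [mem_carrier, mem_U] at hz
  obtain ⟨⟨hr, hW⟩, hG⟩ := hz
  have h1 : ∀ j b, ∀ᶠ κ in nhdsWithin (0 : ℝ) (Set.Ioi 0), I b ⊂ I j →
      ‖proj (hat I b) z‖ < S.ε * ‖proj (hat I j) z‖ / (1 + κ) := by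
    intro j b
    by_cases h : I b ⊂ I j
    · filter_upwards [eventually_lt_div ((hG j).2 b h)] with κ hκ _ using hκ
    · exact Eventually.of_forall fun _ h' => absurd h' h
  filter_upwards [eventually_all.2 fun j => eventually_lt_div (hr j),
    eventually_subset_shrinkConvex (isCompact_singleton (x := proj (rest I) z))
      S.isOpen_W (by simpa using hW),
    eventually_all.2 fun j => eventually_mem_shrinkCone (S.isOpen_G j) (hG j).1,
    eventually_all.2 fun j => eventually_all.2 (h1 j)] with κ h2 h3 h4 h5 hκ
  refine mem_carrier.2 ⟨mem_U.2 ⟨h2, h3 rfl⟩, fun j => ⟨h4 j hκ.pos.le, fun b hb => ?_⟩⟩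
  refine (h5 j b hb).trans_le (le_of_eq ?_)
  change _ = S.ε / (1 + κ) * _
  ring

/-- A multi-cone is exhausted by a sequence of multi-cones, each of them properly contained in the
next one. -/
theorem exists_exhaustion (hI : Admissible I) (S : MultiCone I) :
    ∃ s : ℕ → MultiCone I, (∀ k l, k < l → (s k).ProperlyContained (s l)) ∧
      (∀ k, (s k).ProperlyContained S) ∧
      (∀ S' : MultiCone I, S'.ProperlyContained S → ∃ k, S'.ProperlyContained (s k)) ∧
      ∀ z ∈ S.carrier, ∃ k, z ∈ (s k).carrier := by
  obtain ⟨κ₀, h₀⟩ := S.eventually_shrinkable.exists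
  have hpos : ∀ k : ℕ, 0 < κ₀ / ((k : ℝ) + 1) := fun k => div_pos h₀.pos (by positivity)
  have hle : ∀ k : ℕ, κ₀ / ((k : ℝ) + 1) ≤ κ₀ := fun k =>
    div_le_self h₀.pos.le (by linarith [(k.cast_nonneg : (0 : ℝ) ≤ k)])
  have hs : ∀ k : ℕ, S.Shrinkable (κ₀ / ((k : ℝ) + 1)) := fun k => h₀.mono (hpos k) (hle k)
  have hlim : Tendsto (fun k : ℕ => κ₀ / ((k : ℝ) + 1)) atTop (nhdsWithin 0 (Set.Ioi 0)) := by
    refine tendsto_nhdsWithin_iff.2 ⟨?_, Eventually.of_forall hpos⟩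
    exact tendsto_const_nhds.div_atTop
      (tendsto_atTop_add_const_right _ _ tendsto_natCast_atTop_atTop)
  refine ⟨fun k => S.shrink _ (hs k), fun k l hkl => ?_, fun k => S.shrink_properlyContained hI _,
    fun S' h => ?_, fun z hz => ?_⟩
  · refine S.shrink_properlyContained_shrink hI _ _ ?_
    refine div_lt_div_of_pos_left h₀.pos (by positivity) ?_
    have : (k : ℝ) < l := by exact_mod_cast hkl
    linarith
  · obtain ⟨k, hk, h'⟩ := (hlim.eventually (h.eventually_shrink hI)).exists
    exact ⟨k, h'⟩
  · obtain ⟨k, hk⟩ := (hlim.eventually (eventually_mem_shrink hz)).exists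
    exact ⟨k, hk _⟩

theorem ProperlyContained.exists_between (hI : Admissible I) {S' S : MultiCone I}
    (h : S'.ProperlyContained S) :
    ∃ S'' : MultiCone I, S'.ProperlyContained S'' ∧ S''.ProperlyContained S := by
  obtain ⟨κ, hκ, h'⟩ := (h.eventually_shrink hI).exists
  exact ⟨_, h', S.shrink_properlyContained hI hκ⟩

end MultiCone

end Exhaustion

/-! ### Room inside a multi-cone -/

section Room

open Metric Filter

variable {n ℓ : ℕ} {I : Fin ℓ → Finset (Fin n)}

theorem norm_le_of_norm_proj_le {u : EuclideanSpace ℂ (Fin n)} {A : ℝ}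
    (hh : ∀ j, ‖proj (hat I j) u‖ ≤ A) (hr : ‖proj (rest I) u‖ ≤ A) : ‖u‖ ≤ n * A := by
  refine (norm_le_sum_apply u).trans ?_
  have : ∀ i ∈ Finset.univ, ‖u i‖ ≤ A := fun i _ => by
    rcases rest_or_hat (I := I) i with hi | ⟨j, hj⟩
    · exact (norm_apply_le_norm_proj hi u).trans hr
    · exact (norm_apply_le_norm_proj hj u).trans (hh j)
  refine (Finset.sum_le_sum this).trans (le_of_eq ?_)
  simp

namespace MultiCone

/-- A properly contained multi-cone has room around each of its points, at the scale of the
distances of the point to the submanifolds. -/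
theorem ProperlyContained.exists_room (hI : Admissible I) {S' S : MultiCone I}
    (h : S'.ProperlyContained S) : ∃ δ > 0, δ < 1 ∧ ∀ z ∈ S'.carrier,
      ∀ u : EuclideanSpace ℂ (Fin n), (∀ j, ‖proj (hat I j) u‖ ≤ δ * ‖proj (hat I j) z‖) →
        ‖proj (rest I) u‖ ≤ δ → z + u ∈ S.carrier := by
  obtain ⟨η, hη, hU⟩ := exists_closedBall_subset h.isCompact_closure_U S.isOpen_U
    h.closure_U_subset
  choose d hd hG using fun j => exists_closedBall_subset_cone (S.isOpen_G j) (h.closure_G_subset j)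
  set A : ℝ := 1 + ∑ j, S'.radius j with hA
  have hrA : ∀ j, S'.radius j ≤ A := fun j => by
    have := Finset.single_le_sum (f := S'.radius) (fun k _ => (S'.radius_pos k).le)
      (Finset.mem_univ j)
    linarith
  have hA1 : 1 ≤ A := by
    have := Finset.sum_nonneg fun k (_ : k ∈ Finset.univ) => (S'.radius_pos k).le
    linarith
  have hlim1 : Tendsto (fun δ : ℝ => n * (δ * A)) (nhds 0) (nhds (n * (0 * A))) :=
    (tendsto_id.mul_const _).const_mul _
  have hlim2 : Tendsto (fun δ : ℝ => S.ε * (1 - δ) - (1 + δ) * S'.ε) (nhds 0)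
      (nhds (S.ε * (1 - 0) - (1 + 0) * S'.ε)) :=
    ((tendsto_const_nhds.sub tendsto_id).const_mul _).sub
      ((tendsto_const_nhds.add tendsto_id).mul_const _)
  rw [zero_mul, mul_zero] at hlim1
  have hev : ∀ᶠ δ in nhdsWithin (0 : ℝ) (Set.Ioi 0), 0 < δ ∧ δ < 1 ∧ (∀ j, δ ≤ d j) ∧
      n * (δ * A) ≤ η ∧ 0 < S.ε * (1 - δ) - (1 + δ) * S'.ε := by
    filter_upwards [self_mem_nhdsWithin, nhdsWithin_le_nhds (eventually_lt_nhds one_pos),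
      nhdsWithin_le_nhds (eventually_all.2 fun j => eventually_le_nhds (hd j)),
      nhdsWithin_le_nhds (hlim1.eventually_le_const hη),
      nhdsWithin_le_nhds (hlim2.eventually_const_lt (u := 0) (by linarith [h.ε_lt]))]
      with δ h1 h2 h3 h4 h5
    exact ⟨h1, h2, h3, h4, h5⟩
  obtain ⟨δ, hδ, hδ1, hδd, hδη, hδε⟩ := hev.exists
  refine ⟨δ, hδ, hδ1, fun z hz u hu hur => ?_⟩
  rw [mem_carrier] at hz ⊢
  have hnorm : ‖u‖ ≤ n * (δ * A) := norm_le_of_norm_proj_le (I := I) (fun j =>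
    (hu j).trans (by gcongr; exact ((mem_U.1 hz.1).1 j).le.trans (hrA j)))
    (hur.trans (by nlinarith))
  refine ⟨hU z (subset_closure hz.1) (by
    rw [mem_closedBall, dist_eq_norm, add_sub_cancel_left]; linarith), fun j => ⟨?_, fun b hb => ?_⟩⟩
  · have hzG := (hz.2 j).1
    refine hG j (proj (hat I j) z) (subset_closure hzG)
      (fun h0 => S'.zero_not_mem_G hI j (h0 ▸ hzG)) ?_
    rw [proj_add, mem_closedBall, dist_eq_norm, add_sub_cancel_left]
    exact (hu j).trans (by gcongr; exact hδd j)
  · have h1 : ‖proj (hat I b) (z + u)‖ ≤ (1 + δ) * ‖proj (hat I b) z‖ := by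
      rw [proj_add]
      exact (norm_add_le _ _).trans (by linarith [hu b])
    have h2 : (1 - δ) * ‖proj (hat I j) z‖ ≤ ‖proj (hat I j) (z + u)‖ := by
      rw [proj_add]
      have := norm_sub_norm_le (proj (hat I j) z) (-proj (hat I j) u)
      rw [norm_neg, sub_neg_eq_add] at this
      linarith [hu j]
    have h3 := (hz.2 j).2 b hb
    have h4 := norm_nonneg (proj (hat I b) z)
    have h5 := S'.ε_pos
    have h6 := S.ε_pos
    have h7 : 0 < ‖proj (hat I j) z‖ := pos_of_mul_pos_right (h4.trans_lt h3) h5.le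
    calc ‖proj (hat I b) (z + u)‖ ≤ (1 + δ) * ‖proj (hat I b) z‖ := h1
      _ < (1 + δ) * (S'.ε * ‖proj (hat I j) z‖) := by gcongr
      _ < S.ε * ((1 - δ) * ‖proj (hat I j) z‖) := by nlinarith
      _ ≤ _ := by gcongr

end MultiCone

/-- For a cone properly contained in a proper open convex cone there is a direction of the larger
cone that makes acute angles with the smaller cone: the point nearest to `0` of the closed convex
set of points at distance `≥ κ` from the complement of the larger cone. -/
theorem exists_axis {s : Finset (Fin n)} {G' G : ConvexCone ℝ (EuclideanSpace ℂ s)}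
    (hG : IsOpen (G : Set (EuclideanSpace ℂ s))) (h0 : (0 : EuclideanSpace ℂ s) ∉ G)
    (hne : (G' : Set (EuclideanSpace ℂ s)).Nonempty)
    (h : closure (G' : Set (EuclideanSpace ℂ s)) \ {0} ⊆ G) (h0' : (0 : EuclideanSpace ℂ s) ∉ G') :
    ∃ p : EuclideanSpace ℂ s, ∃ κ > 0, closedBall p κ ⊆ (G : Set (EuclideanSpace ℂ s)) ∧
      ∀ x ∈ G', ∀ t : ℝ, 0 ≤ t → ‖x‖ + t * κ ≤ ‖x + t • p‖ := by
  obtain ⟨κ, hκ, hsub⟩ := exists_closedBall_subset_cone hG h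
  set C : Set (EuclideanSpace ℂ s) := {x | ball x κ ⊆ G} with hC
  have hCc : IsClosed C := by
    refine isClosed_of_closure_subset fun x hx y hy => ?_
    rw [mem_ball] at hy
    obtain ⟨x', hx', hd⟩ := Metric.mem_closure_iff.1 hx (κ - dist y x) (by linarith)
    refine hx' ?_
    rw [mem_ball]
    linarith [dist_triangle y x x']
  have hCconv : Convex ℝ C := by
    intro x hx y hy a b ha hb hab w hw
    set u := w - (a • x + b • y) with hu
    have hun : ‖u‖ < κ := by rwa [mem_ball, dist_eq_norm] at hw
    have h1 := hx (show x + u ∈ ball x κ by simpa [dist_eq_norm] using hun)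
    have h2 := hy (show y + u ∈ ball y κ by simpa [dist_eq_norm] using hun)
    have h3 := G.convex h1 h2 ha hb hab
    have h4 : a • (x + u) + b • (y + u) = w := by
      rw [smul_add, smul_add, add_add_add_comm, ← add_smul, hab, one_smul, hu]
      abel
    rwa [h4] at h3
  have hunit : ∀ x ∈ G', ‖x‖⁻¹ • x ∈ C := by
    intro x hx
    have hx0 : x ≠ 0 := fun e => h0' (e ▸ hx)
    have hpos : 0 < ‖x‖ := norm_pos_iff.2 hx0
    have h1 := hsub (‖x‖⁻¹ • x) (subset_closure (G'.smul_mem (inv_pos.2 hpos) hx))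
      (smul_ne_zero (inv_ne_zero hpos.ne') hx0)
    rw [norm_smul, norm_inv, norm_norm, inv_mul_cancel₀ hpos.ne', mul_one] at h1
    exact ball_subset_closedBall.trans h1
  obtain ⟨x₀, hx₀⟩ := hne
  obtain ⟨p, hp, hpd⟩ := hCc.exists_infDist_eq_dist ⟨_, hunit x₀ hx₀⟩ 0
  have hmin : ∀ x ∈ C, ‖p‖ ≤ ‖x‖ := fun x hx => by
    have := infDist_le_dist_of_mem (x := (0 : EuclideanSpace ℂ s)) hx
    rwa [hpd, dist_zero_left, dist_zero_left] at this
  have hpG : p ∈ G := hp (mem_ball_self hκ)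
  have hp0 : 0 < ‖p‖ := norm_pos_iff.2 fun e => h0 (e ▸ hpG)
  have hinner : ∀ x ∈ C, ‖p‖ ^ 2 ≤ (inner ℂ p x).re := by
    intro x hx
    by_contra! hlt
    -- moving from `p` towards `x` would decrease the norm
    set a : ℝ := ‖p‖ ^ 2 - (inner ℂ p x).re with ha
    have hapos : 0 < a := by linarith
    obtain ⟨t, ht0, ht1, hta⟩ : ∃ t : ℝ, 0 < t ∧ t ≤ 1 ∧ t * (‖x - p‖ ^ 2 + 1) ≤ a :=
      ⟨min 1 (a / (‖x - p‖ ^ 2 + 1)), lt_min one_pos (by positivity), min_le_left _ _, by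
        rw [← le_div_iff₀ (by positivity)]; exact min_le_right _ _⟩
    have hmem : p + (t : ℂ) • (x - p) ∈ C := by
      have := hCconv hp hx (a := 1 - t) (b := t) (by linarith) ht0.le (by ring)
      convert this using 1
      rw [Complex.coe_smul, smul_sub, sub_smul, one_smul]
      abel
    have h1 := pow_le_pow_left₀ (norm_nonneg _) (hmin _ hmem) 2
    rw [norm_add_sq (𝕜 := ℂ), inner_smul_right, inner_sub_right, norm_smul,
      inner_self_eq_norm_sq_to_K] at h1
    have h2 : RCLike.re ((t : ℂ) * (inner ℂ p x - ((‖p‖ : ℝ) : ℂ) ^ 2)) = -(t * a) := by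
      rw [← Complex.ofReal_pow, RCLike.re_eq_complex_re, Complex.re_ofReal_mul, Complex.sub_re,
        Complex.ofReal_re, ha]
      ring
    have h2' : RCLike.re ((t : ℂ) * (inner ℂ p x - ((‖p‖ : ℂ)) ^ 2)) = -(t * a) := h2
    erw [h2'] at h1
    rw [Complex.norm_real, Real.norm_of_nonneg ht0.le, mul_pow] at h1
    nlinarith [sq_nonneg ‖x - p‖]
  -- the minimum is at most `κ / 2` for the ball, at most `‖p‖` and `‖p‖ ^ 2` for the terms `t² ‖p‖²` and
  -- `2 t re ⟪x, p⟫` of `‖x + t p‖²`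
  refine ⟨p, min (κ / 2) ‖p‖ ⊓ ‖p‖ ^ 2, by positivity, ?_, fun x hx t ht => ?_⟩
  · refine (closedBall_subset_ball ?_).trans hp
    exact ((min_le_left _ _).trans (min_le_left _ _)).trans_lt (half_lt_self hκ)
  · set κ' := min (κ / 2) ‖p‖ ⊓ ‖p‖ ^ 2 with hκ'
    have hκp : κ' ≤ ‖p‖ := (min_le_left _ _).trans (min_le_right _ _)
    have hκ0 : 0 < κ' := by positivity
    have hxpos : 0 < ‖x‖ := norm_pos_iff.2 fun e => h0' (e ▸ hx)
    have h1 := hinner _ (hunit x hx)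
    have h2 : ‖p‖ ^ 2 * ‖x‖ ≤ (inner ℂ p x).re := by
      have e : (‖x‖⁻¹ • x : EuclideanSpace ℂ s) = ((‖x‖⁻¹ : ℝ) : ℂ) • x :=
        (Complex.coe_smul _ _).symm
      rw [e, inner_smul_right, Complex.re_ofReal_mul, ← div_eq_inv_mul, le_div_iff₀ hxpos] at h1
      exact h1
    have h3 : κ' * ‖x‖ ≤ (inner ℂ x p).re := by
      have : (inner ℂ x p).re = (inner ℂ p x).re := by
        rw [← inner_conj_symm, Complex.conj_re]
      rw [this]
      refine le_trans ?_ h2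
      gcongr
      exact min_le_right _ _
    refine le_of_sq_le_sq ?_ (norm_nonneg _)
    have e : (t • p : EuclideanSpace ℂ s) = (t : ℂ) • p := (Complex.coe_smul _ _).symm
    rw [e, norm_add_sq (𝕜 := ℂ), inner_smul_right, norm_smul, Complex.norm_real,
      Real.norm_of_nonneg ht, RCLike.re_eq_complex_re, Complex.re_ofReal_mul]
    have h4 : κ' ^ 2 ≤ ‖p‖ ^ 2 := pow_le_pow_left₀ hκ0.le hκp 2
    have h5 : t * (κ' * ‖x‖) ≤ t * (inner ℂ x p).re := mul_le_mul_of_nonneg_left h3 ht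
    have h6 : t ^ 2 * κ' ^ 2 ≤ t ^ 2 * ‖p‖ ^ 2 := mul_le_mul_of_nonneg_left h4 (sq_nonneg t)
    nlinarith

theorem le_norm_add_smul_add {E : Type*} [NormedAddCommGroup E] [NormedSpace ℝ E] {x p u : E}
    {a e κ κ₀ : ℝ} (ha : 0 ≤ a) (h : ‖x‖ + a * κ ≤ ‖x + a • p‖) (hκ : κ₀ ≤ κ) (hu : ‖u‖ ≤ e) :
    ‖x‖ + a * κ₀ - e ≤ ‖x + a • p + u‖ := by
  have h5 := norm_sub_norm_le (x + a • p) (-u)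
  rw [norm_neg, sub_neg_eq_add] at h5
  have h6 : a * κ₀ ≤ a * κ := mul_le_mul_of_nonneg_left hκ ha
  linarith

/-- The numerical inequality behind `MultiCone.ProperlyContained.exists_push`. -/
theorem lt_mul_of_push_bounds {ε κ δ P η Db Dj t Xb Xj Yb Yj : ℝ} (hε : 0 < ε) (hκ : 0 < κ)
    (ht : 0 < t) (hDj : 0 < Dj) (hP : 0 < P) (hη0 : 0 < η) (hDbj : Db ≤ δ * Dj) (hDb : Db ≤ Dj)
    (hδP : δ * P ≤ ε * κ / 4) (hη1 : η ≤ κ / 2) (hη2 : η ≤ ε * κ / 8) (hX : Xb < ε * Xj)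
    (hYb : Yb ≤ Xb + t * Db * P + t * (Db * η)) (hYj : Xj + t * Dj * κ - t * (Dj * η) ≤ Yj) :
    Yb < ε * Yj := by
  have e1 : Db * P ≤ Dj * (ε * κ / 4) := by
    calc Db * P ≤ δ * Dj * P := by gcongr
      _ = Dj * (δ * P) := by ring
      _ ≤ _ := by gcongr
  have e2 : Db * η ≤ Dj * (ε * κ / 8) := by gcongr
  have e3 : Db * P + Db * η ≤ Dj * (ε * κ / 2) := by
    have : 0 < Dj * (ε * κ) := by positivity
    linarith
  have e4 : t * (Db * P + Db * η) ≤ t * (Dj * (ε * κ / 2)) := by gcongr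
  have e5 : t * (Dj * η) ≤ t * (Dj * (κ / 2)) := by gcongr
  calc Yb ≤ Xb + t * (Db * P + Db * η) := by linarith
    _ < ε * Xj + t * (Dj * (ε * κ / 2)) := by linarith
    _ = ε * (Xj + t * (Dj * (κ / 2))) := by ring
    _ ≤ ε * Yj := by gcongr; linarith

namespace MultiCone

/-- Translations along a suitable vector push a multi-cone into the interior of any multi-cone in
which it is properly contained. The components of the vector with respect to smaller `I_j` are
chosen to be much smaller. -/
theorem ProperlyContained.exists_push (hI : Admissible I) {S' S : MultiCone I}
    (h : S'.ProperlyContained S) : ∃ v : EuclideanSpace ℂ (Fin n), ∃ c > 0, ∃ t₀ > 0,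
      ∀ x ∈ S'.carrier, ∀ t : ℝ, 0 < t → t ≤ t₀ → ∀ u : EuclideanSpace ℂ (Fin n), ‖u‖ ≤ c * t →
        x + t • v + u ∈ S.carrier := by
  obtain ⟨ηU, hηU, hU⟩ := exists_closedBall_subset h.isCompact_closure_U S.isOpen_U
    h.closure_U_subset
  choose p κ hκ hpG hp using fun j => exists_axis (S.isOpen_G j) (S.zero_not_mem_G hI j)
    (S'.nonempty_G j) (h.closure_G_subset j) (S'.zero_not_mem_G hI j)
  obtain ⟨κ₀, hκ₀, hκle⟩ : ∃ κ₀ > 0, ∀ j, κ₀ ≤ κ j := by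
    have : ∀ᶠ x in nhdsWithin (0 : ℝ) (Set.Ioi 0), 0 < x ∧ ∀ j, x ≤ κ j := by
      filter_upwards [self_mem_nhdsWithin,
        nhdsWithin_le_nhds (eventually_all.2 fun j => eventually_le_nhds (hκ j))] with x h1 h2
      exact ⟨h1, h2⟩
    obtain ⟨x, h1, h2⟩ := this.exists
    exact ⟨x, h1, h2⟩
  set P : ℝ := 1 + ∑ j, ‖p j‖ with hP
  have hpP : ∀ j, ‖p j‖ ≤ P := fun j => by
    have := Finset.single_le_sum (f := fun j => ‖p j‖) (fun k _ => norm_nonneg _)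
      (Finset.mem_univ j)
    linarith
  have hPpos : 0 < P := by
    have : 0 ≤ ∑ j, ‖p j‖ := Finset.sum_nonneg fun k _ => norm_nonneg _
    linarith
  have hε := S.ε_pos
  set δ : ℝ := min 1 (S.ε * κ₀ / (4 * P)) with hδ
  have hδ0 : 0 < δ := lt_min one_pos (by positivity)
  have hδ1 : δ ≤ 1 := min_le_left _ _
  have hδP : δ * P ≤ S.ε * κ₀ / 4 := by
    have : δ ≤ S.ε * κ₀ / (4 * P) := min_le_right _ _
    calc δ * P ≤ S.ε * κ₀ / (4 * P) * P := by gcongr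
      _ = _ := by field_simp
  set η : ℝ := min (κ₀ / 2) (S.ε * κ₀ / 8) with hη
  have hη0 : 0 < η := lt_min (by positivity) (by positivity)
  have hη1 : η ≤ κ₀ / 2 := min_le_left _ _
  have hη2 : η ≤ S.ε * κ₀ / 8 := min_le_right _ _
  -- the component of `v` in `Î_j` gets the factor `δ ^ d j`, so that it is smaller by a factor `δ` at
  -- least than that of any larger index set
  set d : Fin ℓ → ℕ := fun j => n - (I j).card with hd
  have hdlt : ∀ b j, I b ⊂ I j → d j + 1 ≤ d b := fun b j hbj => by
    have h1 := Finset.card_lt_card hbj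
    have h2 : (I j).card ≤ n := by simpa using Finset.card_le_univ (I j)
    simp only [hd]; omega
  have hdn : ∀ j, d j ≤ n := fun j => Nat.sub_le _ _
  set v : EuclideanSpace ℂ (Fin n) := ∑ j, (δ ^ d j) • incl (hat I j) (p j) with hv
  have hvapp : ∀ i, v i = ∑ j, (δ ^ d j) • incl (hat I j) (p j) i := fun i => by
    rw [hv]; simp
  have hvj : ∀ j, proj (hat I j) v = (δ ^ d j) • p j := by
    intro j
    ext i
    rw [proj_apply, hvapp, Finset.sum_eq_single j]
    · rw [incl_apply_mem _ _ i.2]; rfl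
    · intro k _ hkj
      have : (i : Fin n) ∉ hat I k := fun hi => hkj (hI.eq_of_mem_hat hi i.2)
      rw [incl_apply_not_mem _ _ this, smul_zero]
    · simp
  have hvr : proj (rest I) v = 0 := by
    ext i
    rw [proj_apply, hvapp, Finset.sum_eq_zero]; rfl
    intro k _
    have : (i : Fin n) ∉ hat I k := fun hi => mem_rest.1 i.2 k (hat_subset k hi)
    rw [incl_apply_not_mem _ _ this, smul_zero]
  set c : ℝ := δ ^ n * η with hc
  have hc0 : 0 < c := by positivity
  have hcd : ∀ j, c ≤ δ ^ d j * η := fun j => by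
    exact mul_le_mul_of_nonneg_right (pow_le_pow_of_le_one hδ0.le hδ1 (hdn j)) hη0.le
  clear_value v c d η δ P
  refine ⟨v, c, hc0, ηU / (‖v‖ + c), by positivity, fun x hx t ht htt u hu => ?_⟩
  rw [mem_carrier] at hx ⊢
  have huj : ∀ j, ‖proj (hat I j) u‖ ≤ t * (δ ^ d j * η) := fun j => by
    refine (norm_proj_le u).trans (hu.trans ?_)
    rw [mul_comm]
    gcongr
    exact hcd j
  have hxj : ∀ j, proj (hat I j) (x + t • v + u) =
      proj (hat I j) x + (t * δ ^ d j) • p j + proj (hat I j) u := fun j => by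
    rw [proj_add, proj_add, proj_smul, hvj, smul_smul]
  refine ⟨hU x (subset_closure hx.1) ?_, fun j => ⟨?_, fun b hb => ?_⟩⟩
  · rw [mem_closedBall, dist_eq_norm, add_assoc, add_sub_cancel_left]
    rw [le_div_iff₀ (by positivity)] at htt
    calc ‖t • v + u‖ ≤ t * ‖v‖ + c * t := by
          refine (norm_add_le _ _).trans ?_
          rw [norm_smul, Real.norm_of_nonneg ht.le]
          gcongr
      _ ≤ ηU := by linarith
  · rw [hxj, add_assoc]
    refine (S.G j).add_mem (h.G_le hI j (hx.2 j).1) ?_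
    have htd : 0 < t * δ ^ d j := by positivity
    have h1 : p j + (t * δ ^ d j)⁻¹ • proj (hat I j) u ∈ closedBall (p j) (κ j) := by
      rw [mem_closedBall, dist_eq_norm, add_sub_cancel_left, norm_smul, norm_inv,
        Real.norm_of_nonneg htd.le, inv_mul_le_iff₀ htd]
      refine (huj j).trans ?_
      rw [← mul_assoc]
      gcongr
      linarith [hκle j]
    have h2 := (S.G j).smul_mem htd (hpG j h1)
    rwa [smul_add, smul_smul, mul_inv_cancel₀ htd.ne', one_smul] at h2
  · rw [hxj, hxj]
    have h1 := (hx.2 j).2 b hb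
    have h2 : ‖proj (hat I b) x + (t * δ ^ d b) • p b + proj (hat I b) u‖ ≤
        ‖proj (hat I b) x‖ + t * δ ^ d b * P + t * (δ ^ d b * η) := by
      refine (norm_add_le _ _).trans (add_le_add ((norm_add_le _ _).trans ?_) (huj b))
      rw [norm_smul, Real.norm_of_nonneg (by positivity)]
      gcongr
      exact hpP b
    have h3 : ‖proj (hat I j) x‖ + t * δ ^ d j * κ₀ - t * (δ ^ d j * η) ≤
        ‖proj (hat I j) x + (t * δ ^ d j) • p j + proj (hat I j) u‖ := by
      exact le_norm_add_smul_add (by positivity) (hp j _ (hx.2 j).1 _ (by positivity)) (hκle j)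
        (huj j)
    have h7 : δ ^ d b ≤ δ * δ ^ d j := by
      rw [← pow_succ']
      exact pow_le_pow_of_le_one hδ0.le hδ1 (hdlt b j hb)
    have h8 : δ ^ d b ≤ δ ^ d j := h7.trans (mul_le_of_le_one_left (by positivity) hδ1)
    exact lt_mul_of_push_bounds hε hκ₀ ht (by positivity) hPpos hη0 h7 h8 hδP hη1 hη2
      (h1.trans_le (mul_le_mul_of_nonneg_right h.ε_lt.le (norm_nonneg _))) h2 h3

end MultiCone

end Room

/-! ### Multi-scalings and faces -/

section Faces

open Metric Filter

variable {n ℓ : ℕ} {I : Fin ℓ → Finset (Fin n)}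

variable (I) in
/-- The multi-action `μ(z, σ)` for real `σ`: the coordinate `z_i` is multiplied by the `σ_j` with
`i ∈ I_j`. -/
noncomputable def scale (σ : Fin ℓ → ℝ) (z : EuclideanSpace ℂ (Fin n)) :
    EuclideanSpace ℂ (Fin n) :=
  WithLp.toLp 2 fun i => ((∏ j ∈ Finset.univ.filter (fun j => i ∈ I j), σ j : ℝ) : ℂ) * z i

@[simp] theorem scale_apply (σ : Fin ℓ → ℝ) (z : EuclideanSpace ℂ (Fin n)) (i : Fin n) :
    scale I σ z i = ((∏ j ∈ Finset.univ.filter (fun j => i ∈ I j), σ j : ℝ) : ℂ) * z i := rfl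

theorem proj_rest_scale (σ : Fin ℓ → ℝ) (z : EuclideanSpace ℂ (Fin n)) :
    proj (rest I) (scale I σ z) = proj (rest I) z := by
  refine proj_congr fun i hi => ?_
  rw [scale_apply, Finset.prod_eq_one, Complex.ofReal_one, one_mul]
  intro j hj
  exact absurd (Finset.mem_filter.1 hj).2 (mem_rest.1 hi j)

theorem proj_hat_scale (hI : Admissible I) (σ : Fin ℓ → ℝ) (z : EuclideanSpace ℂ (Fin n))
    (b : Fin ℓ) : proj (hat I b) (scale I σ z) =
      (∏ j ∈ Finset.univ.filter (fun j => I b ⊆ I j), σ j) • proj (hat I b) z := by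
  ext i
  rw [proj_apply, scale_apply]
  have : (Finset.univ.filter fun j => (i : Fin n) ∈ I j) =
      Finset.univ.filter fun j => I b ⊆ I j := by
    ext j; simp [hI.mem_iff_subset i.2 j]
  rw [this]
  simp

theorem norm_proj_hat_scale (hI : Admissible I) {σ : Fin ℓ → ℝ} (hσ : ∀ j, 0 ≤ σ j)
    (z : EuclideanSpace ℂ (Fin n)) (b : Fin ℓ) : ‖proj (hat I b) (scale I σ z)‖ =
      (∏ j ∈ Finset.univ.filter (fun j => I b ⊆ I j), σ j) * ‖proj (hat I b) z‖ := by
  rw [proj_hat_scale hI, norm_smul, Real.norm_of_nonneg (Finset.prod_nonneg fun j _ => hσ j)]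

@[fun_prop]
theorem continuous_scale (z : EuclideanSpace ℂ (Fin n)) :
    Continuous fun σ : Fin ℓ → ℝ => scale I σ z := by
  unfold scale
  refine (PiLp.continuous_toLp 2 _).comp (continuous_pi fun i => ?_)
  exact (Complex.continuous_ofReal.comp
    (continuous_finsetProd _ fun j _ => continuous_apply j)).mul continuous_const

namespace MultiCone

/-- Multi-cones are stable under the multi-action of `(0, 1]^ℓ`. -/
theorem scale_mem_carrier (hI : Admissible I) {S : MultiCone I} {z : EuclideanSpace ℂ (Fin n)}
    (hz : z ∈ S.carrier) {σ : Fin ℓ → ℝ} (h0 : ∀ j, 0 < σ j) (h1 : ∀ j, σ j ≤ 1) :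
    scale I σ z ∈ S.carrier := by
  rw [mem_carrier, mem_U] at hz ⊢
  have hpos : ∀ s : Finset (Fin ℓ), 0 < ∏ j ∈ s, σ j := fun s => Finset.prod_pos fun j _ => h0 j
  have hle : ∀ s : Finset (Fin ℓ), ∏ j ∈ s, σ j ≤ 1 := fun s =>
    Finset.prod_le_one (fun j _ => (h0 j).le) fun j _ => h1 j
  have hn := norm_proj_hat_scale hI (fun j => (h0 j).le) z
  refine ⟨⟨fun j => ?_, ?_⟩, fun j => ⟨?_, fun b hb => ?_⟩⟩
  · rw [hn]
    exact (mul_le_of_le_one_left (norm_nonneg _) (hle _)).trans_lt (hz.1.1 j)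
  · rw [proj_rest_scale]; exact hz.1.2
  · rw [proj_hat_scale hI]
    exact (S.G j).smul_mem (hpos _) (hz.2 j).1
  · rw [hn, hn]
    have hsub : (Finset.univ.filter fun k => I j ⊆ I k) ⊆
        Finset.univ.filter fun k => I b ⊆ I k := fun k hk => by
      simp only [Finset.mem_filter, Finset.mem_univ, true_and] at hk ⊢
      exact hb.subset.trans hk
    have hprod : (∏ k ∈ Finset.univ.filter (fun k => I b ⊆ I k), σ k) ≤
        ∏ k ∈ Finset.univ.filter (fun k => I j ⊆ I k), σ k := by
      rw [← Finset.prod_sdiff hsub]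
      exact mul_le_of_le_one_left (hpos _).le (hle _)
    calc _ < (∏ k ∈ Finset.univ.filter (fun k => I b ⊆ I k), σ k) *
          (S.ε * ‖proj (hat I j) z‖) := mul_lt_mul_of_pos_left ((hz.2 j).2 b hb) (hpos _)
      _ ≤ (∏ k ∈ Finset.univ.filter (fun k => I j ⊆ I k), σ k) *
          (S.ε * ‖proj (hat I j) z‖) := by
          have := S.ε_pos
          gcongr
      _ = _ := by ring

/-- The closure of a multi-cone also contains the images under scalings that vanish in some
variables. -/
theorem scale_mem_closure (hI : Admissible I) {S : MultiCone I} {z : EuclideanSpace ℂ (Fin n)}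
    (hz : z ∈ S.carrier) {σ : Fin ℓ → ℝ} (h0 : ∀ j, 0 ≤ σ j) (h1 : ∀ j, σ j ≤ 1) :
    scale I σ z ∈ closure S.carrier := by
  have hmap : Set.MapsTo (fun t : ℝ => scale I (fun j => (1 - t) * σ j + t) z) (Set.Ioc 0 1)
      S.carrier := fun t ht => by
    refine scale_mem_carrier hI hz (fun j => ?_) fun j => ?_
    · have := mul_nonneg (sub_nonneg.2 ht.2) (h0 j); linarith [ht.1]
    · have := mul_le_mul_of_nonneg_left (h1 j) (sub_nonneg.2 ht.2); linarith
  have hcont : Continuous fun t : ℝ => scale I (fun j => (1 - t) * σ j + t) z :=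
    (continuous_scale z).comp (by fun_prop)
  have := hmap.closure hcont (show (0 : ℝ) ∈ closure (Set.Ioc 0 1) by
    rw [closure_Ioc zero_ne_one]; simp)
  simpa using this

end MultiCone

/-- The projection to `Z_J` is the scaling by `σ_j = 0` for `j ∈ J` and `σ_j = 1` otherwise. -/
theorem incl_proj_eq_scale (J : Finset (Fin ℓ)) (z : EuclideanSpace ℂ (Fin n)) :
    incl (union I J)ᶜ (proj (union I J)ᶜ z) = scale I (fun j => if j ∈ J then 0 else 1) z := by
  ext i
  rw [scale_apply]
  by_cases hi : i ∈ union I J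
  · rw [incl_apply_not_mem _ _ (by simpa using hi)]
    obtain ⟨j, hj, hij⟩ := mem_union.1 hi
    rw [Finset.prod_eq_zero (i := j) (by simpa using hij) (by simp [hj])]
    simp
  · rw [incl_apply_mem _ _ (by simpa using hi), Finset.prod_eq_one]
    · simp
    · intro j hj
      rw [if_neg fun hjJ => hi (mem_union.2 ⟨j, hjJ, (Finset.mem_filter.1 hj).2⟩)]

/-- For each `j`, either `I_j` is contained in one of the `I_k`, `k ∈ J`, or `Î_j` is disjoint
from `I_J`. -/
theorem Admissible.subset_or_hat_subset_compl (hI : Admissible I) (J : Finset (Fin ℓ))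
    (j : Fin ℓ) : (∃ k ∈ J, I j ⊆ I k) ∨ hat I j ⊆ (union I J)ᶜ := by
  by_cases h : ∃ k ∈ J, I j ⊆ I k
  · exact Or.inl h
  · refine Or.inr fun i hi => ?_
    rw [Finset.mem_compl, mem_union]
    rintro ⟨k, hk, hik⟩
    exact h ⟨k, hk, (hI.mem_iff_subset hi k).1 hik⟩

theorem rest_subset_compl (J : Finset (Fin ℓ)) : rest I ⊆ (union I J)ᶜ := fun i hi => by
  rw [Finset.mem_compl, mem_union]
  rintro ⟨k, -, hik⟩
  exact mem_rest.1 hi k hik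

/-- Points in the interior of the preimage of a set under a projection are mapped to its
interior. -/
theorem proj_incl_mem_interior {s t : Finset (Fin n)} (h : t ⊆ s)
    {A : Set (EuclideanSpace ℂ s)} {B : Set (EuclideanSpace ℂ t)}
    (hAB : ∀ w ∈ A, proj t (incl s w) ∈ B) {w : EuclideanSpace ℂ s} (hw : w ∈ interior A) :
    proj t (incl s w) ∈ interior B := by
  have hopen : IsOpenMap fun w : EuclideanSpace ℂ s => proj t (incl s w) := by
    refine ((projL t).comp (inclL s)).isOpenMap fun x => ⟨proj s (incl t x), ?_⟩
    ext i
    change incl s (proj s (incl t x)) i = x i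
    rw [incl_apply_mem _ _ (h i.2), proj_apply, incl_apply_mem _ _ i.2]
  refine interior_maximal ?_ (hopen _ isOpen_interior) ⟨w, hw, rfl⟩
  rintro _ ⟨y, hy, rfl⟩
  exact hAB y (interior_subset hy)

namespace MultiCone

theorem closure_carrier_subset (S : MultiCone I) : closure S.carrier ⊆
    {z | (∀ j, ‖proj (hat I j) z‖ ≤ S.radius j ∧ proj (hat I j) z ∈ closure (S.G j : Set _) ∧
      ∀ b, I b ⊂ I j → ‖proj (hat I b) z‖ ≤ S.ε * ‖proj (hat I j) z‖) ∧
      proj (rest I) z ∈ closure S.W} := by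
  refine closure_minimal (fun z hz => ?_) ?_
  · rw [mem_carrier, mem_U] at hz
    exact ⟨fun j => ⟨(hz.1.1 j).le, subset_closure (hz.2 j).1, fun b hb => ((hz.2 j).2 b hb).le⟩,
      subset_closure hz.1.2⟩
  · have : {z : EuclideanSpace ℂ (Fin n) | (∀ j, ‖proj (hat I j) z‖ ≤ S.radius j ∧
        proj (hat I j) z ∈ closure (S.G j : Set (EuclideanSpace ℂ (hat I j))) ∧
        ∀ b, I b ⊂ I j → ‖proj (hat I b) z‖ ≤ S.ε * ‖proj (hat I j) z‖) ∧
        proj (rest I) z ∈ closure S.W} =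
        (⋂ j, ({z | ‖proj (hat I j) z‖ ≤ S.radius j} ∩
          (proj (hat I j) ⁻¹' closure (S.G j : Set (EuclideanSpace ℂ (hat I j))) ∩
          ⋂ b : {b // I b ⊂ I j},
            {z | ‖proj (hat I b) z‖ ≤ S.ε * ‖proj (hat I j) z‖}))) ∩
        proj (rest I) ⁻¹' closure S.W := by
      ext z; simp
    rw [this]
    refine (isClosed_iInter fun j => ?_).inter (isClosed_closure.preimage (continuous_proj _))
    refine (isClosed_le (continuous_proj _).norm continuous_const).inter
      ((isClosed_closure.preimage (continuous_proj _)).inter (isClosed_iInter fun b => ?_))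
    exact isClosed_le (continuous_proj _).norm (continuous_const.mul (continuous_proj _).norm)

/-- The face `S_J` is the projection of the multi-cone to the coordinates outside `I_J`. -/
theorem face_eq_image (hI : Admissible I) (S : MultiCone I) (J : Finset (Fin ℓ)) :
    S.face J = proj (union I J)ᶜ '' S.carrier := by
  apply Set.Subset.antisymm
  swap
  · refine interior_maximal ?_ (isOpenMap_proj _ _ S.isOpen_carrier)
    rintro _ ⟨z, hz, rfl⟩
    change incl _ _ ∈ closure S.carrier
    rw [incl_proj_eq_scale]
    exact scale_mem_closure hI hz (fun j => by split_ifs <;> norm_num)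
      fun j => by split_ifs <;> norm_num
  intro w hw
  -- generalize the index set `I_Jᶜ` to a variable, for ease of rewriting
  suffices H : ∀ s, s = (union I J)ᶜ → ∀ w : EuclideanSpace ℂ s,
      w ∈ interior {w : EuclideanSpace ℂ s | incl s w ∈ closure S.carrier} →
      w ∈ proj s '' S.carrier from H _ rfl w hw
  clear hw w
  intro s hs w hw
  set A : Set (EuclideanSpace ℂ s) := {w | incl s w ∈ closure S.carrier} with hA
  have hw' : w ∈ interior A := hw
  have hdich : ∀ j, (∃ k ∈ J, I j ⊆ I k) ∨ hat I j ⊆ s := fun j =>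
    hs ▸ hI.subset_or_hat_subset_compl J j
  have hcl := fun (y : EuclideanSpace ℂ s) (hy : y ∈ A) =>
    S.closure_carrier_subset (show incl s y ∈ closure S.carrier from hy)
  have hconv : ∀ {E : Type} [NormedAddCommGroup E] [NormedSpace ℝ E] {C : Set E}, Convex ℝ C →
      IsOpen C → C.Nonempty → interior (closure C) = C := by
    intro E _ _ C hc ho hne
    rw [hc.interior_closure_eq_interior_of_nonempty_interior (by rwa [ho.interior_eq]),
      ho.interior_eq]
  have hG : ∀ j, hat I j ⊆ s → proj (hat I j) (incl s w) ∈ S.G j := fun j hj => by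
    have := proj_incl_mem_interior hj (B := closure (S.G j : Set (EuclideanSpace ℂ (hat I j))))
      (fun y hy => ((hcl y hy).1 j).2.1) hw'
    rwa [hconv (S.G j).convex (S.isOpen_G j) (S.nonempty_G j)] at this
  have hW : proj (rest I) (incl s w) ∈ S.W := by
    have := proj_incl_mem_interior (hs ▸ rest_subset_compl J) (B := closure S.W)
      (fun y hy => (hcl y hy).2) hw'
    rwa [hconv S.convex_W S.isOpen_W S.nonempty_W] at this
  have hr : ∀ j, hat I j ⊆ s → ‖proj (hat I j) (incl s w)‖ < S.radius j := fun j hj => by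
    have := proj_incl_mem_interior hj (B := closedBall 0 (S.radius j))
      (fun y hy => mem_closedBall_zero_iff.2 ((hcl y hy).1 j).1) hw'
    rwa [interior_closedBall _ (S.radius_pos j).ne', mem_ball_zero_iff] at this
  have hpos : ∀ j, hat I j ⊆ s → 0 < ‖proj (hat I j) (incl s w)‖ := fun j hj =>
    norm_pos_iff.2 fun h => S.zero_not_mem_G hI j (h ▸ hG j hj)
  have hε : ∀ j b, hat I j ⊆ s → hat I b ⊆ s → I b ⊂ I j →
      ‖proj (hat I b) (incl s w)‖ < S.ε * ‖proj (hat I j) (incl s w)‖ := by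
    intro j b hj hb hbj
    -- enlarge the coordinates in `Î_b` slightly and use the non-strict inequality there
    have hne : j ≠ b := fun h => hbj.ne (h ▸ rfl)
    let y : ℝ → EuclideanSpace ℂ s := fun t =>
      w + t • proj s (incl (hat I b) (proj (hat I b) (incl s w)))
    have hy : Continuous y := by fun_prop
    have hy0 : y 0 = w := by simp [y]
    have hev : ∀ᶠ t in nhdsWithin (0 : ℝ) (Set.Ioi 0), y t ∈ interior A := by
      refine nhdsWithin_le_nhds (hy.continuousAt.eventually_mem ?_)
      rw [hy0]; exact isOpen_interior.mem_nhds hw'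
    obtain ⟨t, ht, ht0⟩ := (hev.and self_mem_nhdsWithin).exists
    have ht0' : 0 < t := ht0
    have h1 := ((hcl _ (interior_subset ht)).1 j).2.2 b hbj
    have h2 : proj (hat I b) (incl s (y t)) = (1 + t) • proj (hat I b) (incl s w) := by
      ext i
      change incl s (y t) i = (1 + t) • incl s w i
      rw [incl_apply_mem _ _ (hb i.2), incl_apply_mem _ _ (hb i.2)]
      change w _ + t • incl (hat I b) _ (i : Fin n) = _
      rw [incl_apply_mem _ _ i.2, proj_apply, incl_apply_mem _ _ (hb i.2), add_smul, one_smul]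
    have h3 : proj (hat I j) (incl s (y t)) = proj (hat I j) (incl s w) := by
      ext i
      change incl s (y t) i = incl s w i
      rw [incl_apply_mem _ _ (hj i.2), incl_apply_mem _ _ (hj i.2)]
      change w _ + t • incl (hat I b) _ (i : Fin n) = _
      rw [incl_apply_not_mem _ _ fun h => hne (hI.eq_of_mem_hat i.2 h), smul_zero, add_zero]
    rw [h2, h3, norm_smul, Real.norm_of_nonneg (by linarith)] at h1
    have := hpos b hb
    nlinarith
  -- a point of the multi-cone close to `w`, with the coordinates outside `I_J` replaced by `w`
  obtain ⟨η, hη, hηle⟩ : ∃ η > 0, ∀ j, hat I j ⊆ s →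
      η ≤ S.ε * ‖proj (hat I j) (incl s w)‖ := by
    have : ∀ j, ∀ᶠ η in nhdsWithin (0 : ℝ) (Set.Ioi 0), hat I j ⊆ s →
        η ≤ S.ε * ‖proj (hat I j) (incl s w)‖ := fun j => by
      by_cases hj : hat I j ⊆ s
      · filter_upwards [nhdsWithin_le_nhds
          (eventually_le_nhds (mul_pos S.ε_pos (hpos j hj)))] with η h _ using h
      · exact Eventually.of_forall fun _ h => absurd h hj
    obtain ⟨η, h1, h2⟩ := ((eventually_all.2 this).and self_mem_nhdsWithin).exists
    exact ⟨η, h2, h1⟩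
  obtain ⟨z, hz, hzd⟩ := Metric.mem_closure_iff.1 (show w ∈ A from interior_subset hw') η hη
  let z' : EuclideanSpace ℂ (Fin n) := WithLp.toLp 2 fun i => if i ∈ s then incl s w i else z i
  have hz's : ∀ t ⊆ s, proj t z' = proj t (incl s w) := fun t ht =>
    proj_congr fun i hi => if_pos (ht hi)
  have hz'n : ∀ j k, k ∈ J → I j ⊆ I k → proj (hat I j) z' = proj (hat I j) z := fun j k hk hjk =>
    proj_congr fun i hi => if_neg (by
      rw [hs, Finset.mem_compl, not_not, mem_union]
      exact ⟨k, hk, hjk (hat_subset j hi)⟩)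
  rw [mem_carrier, mem_U] at hz
  refine ⟨z', mem_carrier.2 ⟨mem_U.2 ⟨fun j => ?_, ?_⟩, fun j => ⟨?_, fun b hb => ?_⟩⟩, ?_⟩
  · rcases hdich j with ⟨k, hk, hjk⟩ | hj
    · rw [hz'n j k hk hjk]; exact hz.1.1 j
    · rw [hz's _ hj]; exact hr j hj
  · rw [hz's _ (hs ▸ rest_subset_compl J)]; exact hW
  · rcases hdich j with ⟨k, hk, hjk⟩ | hj
    · rw [hz'n j k hk hjk]; exact (hz.2 j).1
    · rw [hz's _ hj]; exact hG j hj
  · rcases hdich j with ⟨k, hk, hjk⟩ | hj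
    · rw [hz'n j k hk hjk, hz'n b k hk (hb.subset.trans hjk)]
      exact (hz.2 j).2 b hb
    · rcases hdich b with ⟨k, hk, hbk⟩ | hb'
      · rw [hz'n b k hk hbk, hz's _ hj]
        refine lt_of_lt_of_le ?_ (hηle j hj)
        have h1 : proj (hat I b) z = proj (hat I b) (z - incl s w) := by
          refine proj_congr fun i hi => ?_
          have : i ∉ s := by
            rw [hs, Finset.mem_compl, not_not, mem_union]
            exact ⟨k, hk, hbk (hat_subset b hi)⟩
          simp [incl_apply_not_mem _ _ this]
        rw [h1]
        refine (norm_proj_le _).trans_lt ?_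
        rwa [← dist_eq_norm, dist_comm]
      · rw [hz's _ hj, hz's _ hb']
        exact hε j b hj hb' hb
  · rw [hz's s subset_rfl, proj_incl]

end MultiCone

end Faces

/-! ### Distances and weights -/

section Weights

open Metric

variable {n ℓ : ℕ} {I : Fin ℓ → Finset (Fin n)}

theorem norm_proj_hat_le_infDist (j : Fin ℓ) (z : EuclideanSpace ℂ (Fin n)) :
    ‖proj (hat I j) z‖ ≤ infDist z (Z I j) := by
  refine (le_infDist ⟨0, show (0 : EuclideanSpace ℂ (Fin n)) ∈ Z I j from fun i _ => rfl⟩).2 fun y hy => ?_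
  have : proj (hat I j) z = proj (hat I j) (z - y) := proj_congr fun i hi => by
    simp [show y i = 0 from hy i (hat_subset j hi)]
  rw [this, dist_eq_norm]
  exact norm_proj_le _

/-- The coordinates of `I_j` outside `Î_j` are dominated by those of `Î_j`. -/
theorem MultiCone.infDist_le {S : MultiCone I} {z : EuclideanSpace ℂ (Fin n)}
    (hz : z ∈ S.carrier) (j : Fin ℓ) :
    infDist z (Z I j) ≤ n * (1 + S.ε) * ‖proj (hat I j) z‖ := by
  let y : EuclideanSpace ℂ (Fin n) := WithLp.toLp 2 fun i => if i ∈ I j then 0 else z i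
  have hy : y ∈ Z I j := fun i hi => if_pos hi
  refine (infDist_le_dist_of_mem hy).trans ?_
  rw [dist_eq_norm]
  refine (norm_le_sum_apply _).trans ?_
  have : ∀ i ∈ Finset.univ, ‖(z - y) i‖ ≤ (1 + S.ε) * ‖proj (hat I j) z‖ := fun i _ => by
    have hε := S.ε_pos
    by_cases hi : i ∈ I j
    · have h1 : (z - y) i = z i := by
        change z i - (if i ∈ I j then 0 else z i) = _
        rw [if_pos hi, sub_zero]
      rw [h1]
      obtain ⟨b, hb, hbj⟩ := Admissible.exists_mem_hat hi
      refine (norm_apply_le_norm_proj hb z).trans ?_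
      have h0 := norm_nonneg (proj (hat I j) z)
      rcases hbj.eq_or_ssubset with h | h
      · have : hat I b = hat I j := by simp only [hat, h]
        rw [this]
        nlinarith
      · have := ((MultiCone.mem_carrier.1 hz).2 j).2 b h
        nlinarith
    · have h1 : (z - y) i = 0 := by
        change z i - (if i ∈ I j then 0 else z i) = _
        rw [if_neg hi, sub_self]
      rw [h1, norm_zero]
      positivity
  refine (Finset.sum_le_sum this).trans (le_of_eq ?_)
  simp [mul_assoc]

theorem Z_subset_iff {j k : Fin ℓ} : Z I j ⊆ Z I k ↔ I k ⊆ I j := by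
  refine ⟨fun h i hi => ?_, fun h z hz i hi => hz i (h hi)⟩
  by_contra hij
  have : EuclideanSpace.single i (1 : ℂ) ∈ Z I j := fun i' hi' => by
    have : i' ≠ i := fun e => hij (e ▸ hi')
    simp [this]
  have := h this i hi
  simp at this

theorem Z_ssubset_iff {j k : Fin ℓ} : Z I j ⊂ Z I k ↔ I k ⊂ I j := by
  rw [ssubset_iff_subset_not_subset, ssubset_iff_subset_not_subset, Z_subset_iff, Z_subset_iff]

variable (I) in
open Classical in
/-- The `k` such that `I_k` is maximal among the index sets strictly contained in `I_j`. -/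
noncomputable def children (j : Fin ℓ) : Finset (Fin ℓ) :=
  Finset.univ.filter fun k => I k ⊂ I j ∧ ¬ ∃ m, I m ⊂ I j ∧ I k ⊂ I m

theorem mem_children {j k : Fin ℓ} :
    k ∈ children I j ↔ I k ⊂ I j ∧ ¬ ∃ m, I m ⊂ I j ∧ I k ⊂ I m := by
  simp [children]

theorem weight_eq (j : Fin ℓ) (N : Fin ℓ → ℕ) :
    weight I j N = (N j : ℤ) - ∑ k ∈ children I j, (N k : ℤ) := by
  rw [weight, children]
  simp only [Z_ssubset_iff]

/-- `I_j` is the disjoint union of `Î_j` and of the `I_k` for the children `k` of `j`. -/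
theorem Admissible.sum_eq (hI : Admissible I) (a : Fin n → ℕ) (j : Fin ℓ) :
    ∑ i ∈ I j, a i = ∑ i ∈ hat I j, a i + ∑ k ∈ children I j, ∑ i ∈ I k, a i := by
  classical
  have hdisj : Set.PairwiseDisjoint (children I j : Set (Fin ℓ)) I := by
    intro k hk k' hk' hne
    rw [Finset.mem_coe, mem_children] at hk hk'
    rcases hI.nested k k' hne with h | h | h
    · exact absurd ⟨k', hk'.1, h⟩ hk.2
    · exact absurd ⟨k, hk.1, h⟩ hk'.2
    · exact h
  rw [← Finset.sum_biUnion hdisj, ← Finset.sum_union]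
  · refine Finset.sum_congr ?_ fun _ _ => rfl
    ext i
    rw [Finset.mem_union, Finset.mem_biUnion]
    constructor
    · intro hi
      by_cases h : i ∈ hat I j
      · exact Or.inl h
      right
      have : ∃ k, I k ⊂ I j ∧ i ∈ I k := by
        by_contra! hk
        exact h (mem_hat.2 ⟨hi, hk⟩)
      obtain ⟨k₀, hk₀⟩ := this
      obtain ⟨k, hk, hmax⟩ := Finset.exists_max_image
        (Finset.univ.filter fun k => I k ⊂ I j ∧ i ∈ I k) (fun k => (I k).card) ⟨k₀, by simpa⟩
      simp only [Finset.mem_filter, Finset.mem_univ, true_and] at hk hmax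
      refine ⟨k, mem_children.2 ⟨hk.1, ?_⟩, hk.2⟩
      rintro ⟨m, hm, hkm⟩
      exact absurd (hmax m ⟨hm, hkm.subset hk.2⟩) (by simpa using Finset.card_lt_card hkm)
    · rintro (hi | ⟨k, hk, hik⟩)
      · exact hat_subset j hi
      · exact (mem_children.1 hk).1.subset hik
  · rw [Finset.disjoint_left]
    intro i hi hi'
    obtain ⟨k, hk, hik⟩ := Finset.mem_biUnion.1 hi'
    exact (mem_hat.1 hi).2 k (mem_children.1 hk).1 hik

/-- If `n_j` is the total degree of a monomial in the variables of `I_j`, then `w_j(N)` is its total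
degree in the variables of `Î_j`. -/
theorem Admissible.weight_sum (hI : Admissible I) (a : Fin n → ℕ) (j : Fin ℓ) :
    weight I j (fun k => ∑ i ∈ I k, a i) = ∑ i ∈ hat I j, (a i : ℤ) := by
  rw [weight_eq, hI.sum_eq a j]
  push_cast
  ring

end Weights

/-! ### Bounded derivatives and smooth extensions -/

section SmoothExtension

variable {m : ℕ} {U : Set (EuclideanSpace ℂ (Fin m))} {f φ : EuclideanSpace ℂ (Fin m) → ℂ}

/-- The iterated real partial derivative along the word `[i, k, …]`, in the directions of the real
parts of the coordinates. -/
noncomputable def realWordDeriv (L : List (Fin m)) (φ : EuclideanSpace ℂ (Fin m) → ℂ) :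
    EuclideanSpace ℂ (Fin m) → ℂ :=
  L.foldr (fun i => dirDeriv (EuclideanSpace.single i (1 : ℂ))) φ

theorem contDiff_dirDeriv {E F : Type} [NormedAddCommGroup E] [NormedSpace ℝ E]
    [NormedAddCommGroup F] [NormedSpace ℝ F] {φ : E → F} (hφ : ContDiff ℝ ∞ φ) (v : E) :
    ContDiff ℝ ∞ (dirDeriv v φ) := by
  rw [← contDiffOn_univ] at hφ ⊢
  exact contDiffOn_dirDeriv isOpen_univ hφ v

theorem contDiff_realWordDeriv (hφ : ContDiff ℝ ∞ φ) (L : List (Fin m)) :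
    ContDiff ℝ ∞ (realWordDeriv L φ) := by
  induction L with
  | nil => exact hφ
  | cons i L ih => exact contDiff_dirDeriv ih _

theorem dirDeriv_eq_fderiv (hU : IsOpen U) (hf : DifferentiableOn ℂ f U)
    (v : EuclideanSpace ℂ (Fin m)) :
    Set.EqOn (dirDeriv v f) (fun x => fderiv ℂ f x v) U := fun x hx => by
  change fderiv ℝ f x v = _
  rw [(hf.differentiableAt (hU.mem_nhds hx)).fderiv_restrictScalars ℝ]
  rfl

theorem realWordDeriv_eqOn (hU : IsOpen U) (hf : DifferentiableOn ℂ f U) (h : Set.EqOn φ f U)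
    (L : List (Fin m)) : Set.EqOn (realWordDeriv L φ) (wordDeriv L f) U := by
  induction L with
  | nil => exact h
  | cons i L ih =>
    have hL := differentiableOn_wordDeriv hU hf L
    intro x hx
    rw [wordDeriv_cons, pderiv_eq hU hL i hx]
    exact (dirDeriv_congr hU ih _ hx).trans (dirDeriv_eq_fderiv hU hL _ hx)

theorem fderiv_real_eq_sum (hU : IsOpen U) (hf : DifferentiableOn ℂ f U)
    {x : EuclideanSpace ℂ (Fin m)} (hx : x ∈ U) :
    fderiv ℝ f x = ∑ i, pderiv i f x •
      ((EuclideanSpace.proj i : EuclideanSpace ℂ (Fin m) →L[ℂ] ℂ).restrictScalars ℝ) := by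
  ext v
  have h1 : fderiv ℝ f x v = fderiv ℂ f x v := dirDeriv_eq_fderiv hU hf v hx
  rw [h1]
  conv_lhs => rw [← (EuclideanSpace.basisFun (Fin m) ℂ).sum_repr v]
  rw [map_sum, sum_apply]
  refine Finset.sum_congr rfl fun i _ => ?_
  rw [map_smul, pderiv_eq hU hf i hx]
  simp [mul_comm]

/-- If all complex partial derivatives of a holomorphic function are bounded, then so are its real
higher derivatives. -/
theorem exists_norm_iteratedFDeriv_le (hU : IsOpen U) (hf : DifferentiableOn ℂ f U)
    (hb : ∀ L, ∃ C, ∀ x ∈ U, ‖wordDeriv L f x‖ ≤ C) (k : ℕ) :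
    ∃ C, ∀ x ∈ U, ‖iteratedFDeriv ℝ k f x‖ ≤ C := by
  induction k generalizing f with
  | zero => simpa using hb []
  | succ k ih =>
    have hp : ∀ i, ∃ C, ∀ x ∈ U, ‖iteratedFDeriv ℝ k (pderiv i f) x‖ ≤ C := fun i => by
      refine ih (differentiableOn_pderiv hU hf i) fun L => ?_
      obtain ⟨C, hC⟩ := hb (L ++ [i])
      refine ⟨C, fun x hx => ?_⟩
      have := hC x hx
      rwa [wordDeriv_append] at this
    choose C hC using hp
    let P : Fin m → EuclideanSpace ℂ (Fin m) →L[ℝ] ℂ := fun i =>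
      (EuclideanSpace.proj i : EuclideanSpace ℂ (Fin m) →L[ℂ] ℂ).restrictScalars ℝ
    let B : Fin m → ℂ →L[ℝ] (EuclideanSpace ℂ (Fin m) →L[ℝ] ℂ) := fun i =>
      (ContinuousLinearMap.lsmul ℝ ℂ).flip (P i)
    refine ⟨∑ i, ‖B i‖ * C i, fun x hx => ?_⟩
    have hcd : ∀ i, ContDiffAt ℝ ∞ (pderiv i f) x := fun i =>
      (((contDiffOn_of_differentiableOn hU (differentiableOn_pderiv hU hf i)).restrict_scalars
        ℝ).contDiffAt (hU.mem_nhds hx))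
    have heq : fderiv ℝ f =ᶠ[nhds x] fun y => ∑ i, (B i ∘ pderiv i f) y := by
      filter_upwards [hU.mem_nhds hx] with y hy
      rw [fderiv_real_eq_sum hU hf hy]
      rfl
    rw [← norm_iteratedFDeriv_fderiv, (Filter.EventuallyEq.iteratedFDeriv ℝ heq k).eq_of_nhds,
      iteratedFDeriv_fun_sum_apply fun i _ =>
        ((B i).contDiff.contDiffAt.comp x (hcd i)).of_le (by exact_mod_cast le_top)]
    refine (norm_sum_le _ _).trans (Finset.sum_le_sum fun i _ => ?_)
    refine ((B i).norm_iteratedFDeriv_comp_left (hcd i) (by exact_mod_cast le_top)).trans ?_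
    gcongr
    exact hC i x hx

end SmoothExtension

section Equivalence

variable {n ℓ : ℕ} {I : Fin ℓ → Finset (Fin n)} {S : MultiCone I}
  {f : EuclideanSpace ℂ (Fin n) → ℂ}

theorem DerivativesBounded.wordDeriv (hI : Admissible I) (hf : DifferentiableOn ℂ f S.carrier)
    (h : DerivativesBounded S f) {S' : MultiCone I} (hS' : S'.ProperlyContained S)
    (L : List (Fin n)) : ∃ C, ∀ z ∈ S'.carrier, ‖wordDeriv L f z‖ ≤ C := by
  obtain ⟨C, hC⟩ := h S' hS' fun i => L.count i
  refine ⟨C, fun z hz => ?_⟩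
  rw [wordDeriv_eq_mixedPartial S.isOpen_carrier hf L (hS'.carrier_subset hI hz)]
  exact hC z hz

/-- Functions with bounded derivatives are extendable: `S'` is pushed inside a multi-cone between `S'`
and `S`, on which all the real derivatives are bounded. -/
theorem DerivativesBounded.smoothlyExtendable (hI : Admissible I)
    (hf : DifferentiableOn ℂ f S.carrier) (h : DerivativesBounded S f) :
    SmoothlyExtendable S f := by
  intro S' hS'
  obtain ⟨S'', h1, h2⟩ := hS'.exists_between hI
  obtain ⟨v, c, hc, t₀, ht₀, hpush⟩ := h1.exists_push hI
  have hf'' := hf.mono (h2.carrier_subset hI)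
  exact exists_contDiff_extension S''.isOpen_carrier (h1.carrier_subset hI) hc ht₀ hpush
    ((contDiffOn_of_differentiableOn S''.isOpen_carrier hf'').restrict_scalars ℝ)
    (exists_norm_iteratedFDeriv_le S''.isOpen_carrier hf'' fun L => h.wordDeriv hI hf h2 L)

end Equivalence

/-! ### Comparison of the weights -/

section Ratios

variable {n ℓ : ℕ} {I : Fin ℓ → Finset (Fin n)}

theorem zpow_le_of_comparable {x a K : ℝ} (ha : 0 < a) (hx : 0 < x) (h1 : x ≤ K * a)
    (h2 : a ≤ K * x) (m : ℤ) : x ^ m ≤ K ^ m.natAbs * a ^ m := by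
  have hK : 0 < K := pos_of_mul_pos_left (hx.trans_le h1) ha.le
  rcases m.eq_nat_or_neg with ⟨k, rfl | rfl⟩
  · rw [Int.natAbs_natCast, zpow_natCast, zpow_natCast, ← mul_pow]
    gcongr
  · rw [Int.natAbs_neg, Int.natAbs_natCast, zpow_neg, zpow_neg, zpow_natCast, zpow_natCast,
      ← inv_pow, ← inv_pow, ← mul_pow]
    gcongr
    rw [inv_eq_one_div, div_le_iff₀ hx]
    calc 1 = a⁻¹ * a := (inv_mul_cancel₀ ha.ne').symm
      _ ≤ a⁻¹ * (K * x) := by gcongr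
      _ = K * a⁻¹ * x := by ring

theorem MultiCone.infDist_pos (hI : Admissible I) {S : MultiCone I}
    {z : EuclideanSpace ℂ (Fin n)} (hz : z ∈ S.carrier) (j : Fin ℓ) :
    0 < Metric.infDist z (Z I j) :=
  (norm_proj_pos hI hz j).trans_le (norm_proj_hat_le_infDist j z)

/-- On a multi-cone, the distance to `Z_j` may be replaced by `|z_{Î_j}|`. -/
theorem MultiCone.prod_infDist_comparable (hI : Admissible I) (S : MultiCone I) (m : Fin ℓ → ℤ) :
    ∃ C > 0, ∀ z ∈ S.carrier,
      ∏ j, Metric.infDist z (Z I j) ^ m j ≤ C * ∏ j, ‖proj (hat I j) z‖ ^ m j ∧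
      ∏ j, ‖proj (hat I j) z‖ ^ m j ≤ C * ∏ j, Metric.infDist z (Z I j) ^ m j := by
  have hε := S.ε_pos
  set K : ℝ := n * (1 + S.ε) + 1 with hK
  have hK0 : 1 ≤ K := by rw [hK]; have : 0 ≤ n * (1 + S.ε) := by positivity
                         linarith
  refine ⟨∏ j, K ^ (m j).natAbs, Finset.prod_pos fun j _ => by positivity, fun z hz => ?_⟩
  have h1 : ∀ j, Metric.infDist z (Z I j) ≤ K * ‖proj (hat I j) z‖ := fun j =>
    (infDist_le hz j).trans (by gcongr; linarith)
  have h2 : ∀ j, ‖proj (hat I j) z‖ ≤ K * Metric.infDist z (Z I j) := fun j =>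
    (norm_proj_hat_le_infDist j z).trans
      (le_mul_of_one_le_left (infDist_pos hI hz j).le hK0)
  rw [← Finset.prod_mul_distrib, ← Finset.prod_mul_distrib]
  constructor
  · exact Finset.prod_le_prod (fun j _ => zpow_nonneg Metric.infDist_nonneg _) fun j _ =>
      zpow_le_of_comparable (norm_proj_pos hI hz j) (infDist_pos hI hz j) (h1 j) (h2 j) _
  · exact Finset.prod_le_prod (fun j _ => zpow_nonneg (norm_nonneg _) _) fun j _ =>
      zpow_le_of_comparable (infDist_pos hI hz j) (norm_proj_pos hI hz j) (h2 j) (h1 j) _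

variable (I) in
open Classical in
/-- The `k` such that `I_k` is minimal among the index sets strictly containing `I_j`; there is at
most one such index. -/
noncomputable def parents (j : Fin ℓ) : Finset (Fin ℓ) :=
  Finset.univ.filter fun k => j ∈ children I k

theorem mem_parents {j k : Fin ℓ} : k ∈ parents I j ↔ j ∈ children I k := by
  simp [parents]

theorem Admissible.parents_eq (hI : Admissible I) {j k k' : Fin ℓ} (hk : k ∈ parents I j)
    (hk' : k' ∈ parents I j) : k = k' := by
  rw [mem_parents, mem_children] at hk hk'
  by_contra hne
  rcases hI.nested k k' hne with h | h | h
  · exact hk'.2 ⟨k, h, hk.1⟩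
  · exact hk.2 ⟨k', h, hk'.1⟩
  · obtain ⟨i, hi⟩ := hI.hat_nonempty j
    exact Finset.disjoint_left.1 h (hk.1.subset (hat_subset j hi))
      (hk'.1.subset (hat_subset j hi))

theorem Admissible.parents_eq_empty_or_singleton (hI : Admissible I) (j : Fin ℓ) :
    parents I j = ∅ ∨ ∃ k, parents I j = {k} ∧ I j ⊂ I k := by
  rcases (parents I j).eq_empty_or_nonempty with h | ⟨k, hk⟩
  · exact Or.inl h
  · refine Or.inr ⟨k, ?_, (mem_children.1 (mem_parents.1 hk)).1⟩
    ext k'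
    rw [Finset.mem_singleton]
    exact ⟨fun h => hI.parents_eq h hk, fun h => h ▸ hk⟩

variable (I) in
/-- The quotient `|z_{Î_j}| / |z_{Î_k}|` for the parent `k` of `j`, or `|z_{Î_j}|` if `j` has no
parent. -/
noncomputable def ratio (j : Fin ℓ) (z : EuclideanSpace ℂ (Fin n)) : ℝ :=
  ‖proj (hat I j) z‖ / ∏ k ∈ parents I j, ‖proj (hat I k) z‖

theorem MultiCone.ratio_pos (hI : Admissible I) {S : MultiCone I}
    {z : EuclideanSpace ℂ (Fin n)} (hz : z ∈ S.carrier) (j : Fin ℓ) : 0 < ratio I j z :=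
  div_pos (norm_proj_pos hI hz j) (Finset.prod_pos fun k _ => norm_proj_pos hI hz k)

/-- The ratios are bounded, by the inequalities `|z_{Î_k}| < ε |z_{Î_j}|` and `|z_{Î_j}| < r_j`. -/
theorem MultiCone.ratio_le (hI : Admissible I) {S : MultiCone I}
    {z : EuclideanSpace ℂ (Fin n)} (hz : z ∈ S.carrier) (j : Fin ℓ) :
    ratio I j z ≤ max S.ε (S.radius j) := by
  rw [ratio]
  rcases hI.parents_eq_empty_or_singleton j with h | ⟨k, h, hjk⟩
  · rw [h, Finset.prod_empty, div_one]
    exact ((mem_U.1 (mem_carrier.1 hz).1).1 j).le.trans (le_max_right _ _)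
  · rw [h, Finset.prod_singleton, div_le_iff₀ (norm_proj_pos hI hz k)]
    refine (((mem_carrier.1 hz).2 k).2 j hjk).le.trans ?_
    gcongr
    exact le_max_left _ _

/-- The weights `w_j(N)` are such that `∏_j |z_{Î_j}|^{w_j(N)}` is the monomial with exponents `n_j`
in the ratios. -/
theorem MultiCone.prod_norm_zpow_weight (hI : Admissible I) {S : MultiCone I}
    {z : EuclideanSpace ℂ (Fin n)} (hz : z ∈ S.carrier) (N : Fin ℓ → ℕ) :
    ∏ j, ‖proj (hat I j) z‖ ^ weight I j N = ∏ j, ratio I j z ^ N j := by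
  classical
  have hne : ∀ j, ‖proj (hat I j) z‖ ≠ 0 := fun j => (norm_proj_pos hI hz j).ne'
  simp only [ratio, div_pow, Finset.prod_div_distrib, weight_eq]
  have h1 : ∀ j, ‖proj (hat I j) z‖ ^ ((N j : ℤ) - ∑ k ∈ children I j, (N k : ℤ)) =
      ‖proj (hat I j) z‖ ^ N j / ∏ k ∈ children I j, ‖proj (hat I j) z‖ ^ N k := fun j => by
    rw [zpow_sub₀ (hne j), zpow_natCast, ← Nat.cast_sum, zpow_natCast, Finset.prod_pow_eq_pow_sum]
  simp only [h1, Finset.prod_div_distrib, ← Finset.prod_pow]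
  congr 1
  exact Finset.prod_comm' fun j k => by simp [mem_parents]

/-- Increasing `n_j` makes the weight smaller, up to a constant. -/
theorem MultiCone.prod_weight_update_le (hI : Admissible I) {S : MultiCone I}
    {z : EuclideanSpace ℂ (Fin n)} (hz : z ∈ S.carrier) (N : Fin ℓ → ℕ) (j : Fin ℓ) :
    ∏ k, ‖proj (hat I k) z‖ ^ weight I k (Function.update N j (N j + 1)) ≤
      max S.ε (S.radius j) * ∏ k, ‖proj (hat I k) z‖ ^ weight I k N := by
  rw [prod_norm_zpow_weight hI hz, prod_norm_zpow_weight hI hz]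
  have h : ∏ k, ratio I k z ^ (Function.update N j (N j + 1)) k =
      ratio I j z * ∏ k, ratio I k z ^ N k := by
    rw [← Finset.mul_prod_erase _ _ (Finset.mem_univ j),
      ← Finset.mul_prod_erase _ (fun k => ratio I k z ^ N k) (Finset.mem_univ j),
      Function.update_self, pow_succ]
    rw [Finset.prod_congr rfl fun k hk => by
      rw [Function.update_of_ne (Finset.ne_of_mem_erase hk)]]
    ring
  rw [h]
  exact mul_le_mul_of_nonneg_right (ratio_le hI hz j)
    (Finset.prod_nonneg fun k _ => pow_nonneg (ratio_pos hI hz k).le _)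

end Ratios

/-! ### Rules for iterated partial derivatives -/

section Calculus

variable {m : ℕ} {U : Set (EuclideanSpace ℂ (Fin m))} {f g : EuclideanSpace ℂ (Fin m) → ℂ}

theorem pderiv_add (hU : IsOpen U) (hf : DifferentiableOn ℂ f U) (hg : DifferentiableOn ℂ g U)
    (i : Fin m) : Set.EqOn (pderiv i fun z => f z + g z) (fun z => pderiv i f z + pderiv i g z) U := by
  intro z hz
  have h := pderiv_eq hU (hf.fun_add hg) i hz
  simp only [pderiv_eq hU hf i hz, pderiv_eq hU hg i hz]
  rw [h, fderiv_fun_add (hf.differentiableAt (hU.mem_nhds hz)) (hg.differentiableAt (hU.mem_nhds hz))]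
  rfl

theorem pderiv_mul (hU : IsOpen U) (hf : DifferentiableOn ℂ f U) (hg : DifferentiableOn ℂ g U)
    (i : Fin m) : Set.EqOn (pderiv i fun z => f z * g z)
      (fun z => f z * pderiv i g z + pderiv i f z * g z) U := by
  intro z hz
  have h := pderiv_eq hU (hf.fun_mul hg) i hz
  simp only [pderiv_eq hU hf i hz, pderiv_eq hU hg i hz]
  rw [h, fderiv_fun_mul (hf.differentiableAt (hU.mem_nhds hz)) (hg.differentiableAt (hU.mem_nhds hz))]
  simp [mul_comm]

theorem wordDeriv_add (hU : IsOpen U) (hf : DifferentiableOn ℂ f U) (hg : DifferentiableOn ℂ g U)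
    (L : List (Fin m)) : Set.EqOn (wordDeriv L fun z => f z + g z)
      (fun z => wordDeriv L f z + wordDeriv L g z) U := by
  induction L with
  | nil => exact fun _ _ => rfl
  | cons i L ih =>
    exact (pderiv_congr hU ih i).trans
      (pderiv_add hU (differentiableOn_wordDeriv hU hf L) (differentiableOn_wordDeriv hU hg L) i)

theorem wordDeriv_const_mul (c : ℂ) (L : List (Fin m)) :
    wordDeriv L (fun z => c * f z) = fun z => c * wordDeriv L f z := by
  induction L with
  | nil => rfl
  | cons i L ih =>
    funext z
    rw [wordDeriv_cons, ih, wordDeriv_cons, pderiv, pderiv, lineDeriv, lineDeriv,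
      deriv_const_mul_field]

theorem wordDeriv_zero (L : List (Fin m)) :
    wordDeriv L (fun _ => (0 : ℂ)) = fun _ => 0 := by
  simpa using wordDeriv_const_mul (f := fun _ => 0) 0 L

theorem wordDeriv_sum {ι : Type*} {s : Finset ι} {f : ι → EuclideanSpace ℂ (Fin m) → ℂ}
    (hU : IsOpen U) (hf : ∀ a ∈ s, DifferentiableOn ℂ (f a) U) (L : List (Fin m)) :
    Set.EqOn (wordDeriv L fun z => ∑ a ∈ s, f a z) (fun z => ∑ a ∈ s, wordDeriv L (f a) z) U := by
  classical
  induction s using Finset.induction_on with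
  | empty => simp [wordDeriv_zero, Set.EqOn]
  | insert a s ha ih =>
    have h1 : DifferentiableOn ℂ (fun z => ∑ a ∈ s, f a z) U :=
      DifferentiableOn.fun_sum fun b hb => hf b (Finset.mem_insert_of_mem hb)
    intro z hz
    simp only [Finset.sum_insert ha]
    have h2 := ih (fun b hb => hf b (Finset.mem_insert_of_mem hb)) hz
    simp only at h2
    rw [← h2]
    exact wordDeriv_add hU (hf a (Finset.mem_insert_self a s)) h1 L hz

theorem differentiable_eval (p : MvPolynomial (Fin m) ℂ) :
    Differentiable ℂ fun z : EuclideanSpace ℂ (Fin m) => MvPolynomial.eval (fun i => z i) p := by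
  induction p using MvPolynomial.induction_on with
  | C a => simp
  | add p q hp hq => simpa using hp.fun_add hq
  | mul_X p i hp =>
    simp only [map_mul, MvPolynomial.eval_X]
    exact hp.fun_mul (EuclideanSpace.proj i : EuclideanSpace ℂ (Fin m) →L[ℂ] ℂ).differentiable

theorem pderiv_coord (i k : Fin m) : pderiv i (fun z : EuclideanSpace ℂ (Fin m) => z k) =
    fun _ => if k = i then 1 else 0 := by
  funext z
  have : DifferentiableOn ℂ (fun z : EuclideanSpace ℂ (Fin m) => z k) Set.univ :=
    (EuclideanSpace.proj k : EuclideanSpace ℂ (Fin m) →L[ℂ] ℂ).differentiable.differentiableOn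
  rw [pderiv_eq isOpen_univ this i (Set.mem_univ z)]
  have h := (EuclideanSpace.proj k : EuclideanSpace ℂ (Fin m) →L[ℂ] ℂ).hasFDerivAt (x := z)
  have h' : fderiv ℂ (fun z : EuclideanSpace ℂ (Fin m) => z k) z = EuclideanSpace.proj k :=
    h.fderiv
  rw [h']
  simp

theorem pderiv_eval (i : Fin m) (p : MvPolynomial (Fin m) ℂ) :
    pderiv i (fun z : EuclideanSpace ℂ (Fin m) => MvPolynomial.eval (fun i => z i) p) =
      fun z => MvPolynomial.eval (fun i => z i) (MvPolynomial.pderiv i p) := by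
  induction p using MvPolynomial.induction_on with
  | C a => funext z; simp [pderiv, lineDeriv]
  | add p q hp hq =>
    funext z
    simp only [map_add]
    rw [pderiv_add isOpen_univ (differentiable_eval p).differentiableOn
      (differentiable_eval q).differentiableOn i (Set.mem_univ z), hp, hq]
  | mul_X p k hp =>
    funext z
    have hk : DifferentiableOn ℂ (fun z : EuclideanSpace ℂ (Fin m) => z k) Set.univ :=
      (EuclideanSpace.proj k : EuclideanSpace ℂ (Fin m) →L[ℂ] ℂ).differentiable.differentiableOn
    simp only [map_mul, MvPolynomial.eval_X]
    rw [pderiv_mul isOpen_univ (differentiable_eval p).differentiableOn hk i (Set.mem_univ z), hp,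
      pderiv_coord, Derivation.leibniz, MvPolynomial.pderiv_X]
    by_cases h : k = i
    · subst h; simp [mul_comm]
    · simp [h, mul_comm]

theorem wordDeriv_eval (L : List (Fin m)) (p : MvPolynomial (Fin m) ℂ) :
    wordDeriv L (fun z : EuclideanSpace ℂ (Fin m) => MvPolynomial.eval (fun i => z i) p) =
      fun z => MvPolynomial.eval (fun i => z i) (L.foldr (fun i => MvPolynomial.pderiv i) p) := by
  induction L with
  | nil => rfl
  | cons i L ih => rw [wordDeriv_cons, ih, pderiv_eval]; rfl

/-- Derivatives of monomials. The subtraction of exponents is truncated; the falling factorials vanish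
where this matters. -/
theorem foldr_pderiv_monomial (L : List (Fin m)) (α : Fin m →₀ ℕ) (c : ℂ) :
    L.foldr (fun i => MvPolynomial.pderiv i) (MvPolynomial.monomial α c) =
      MvPolynomial.monomial (α - Finsupp.equivFunOnFinite.symm fun i => L.count i)
        (c * ∏ i, ((α i).descFactorial (L.count i) : ℂ)) := by
  induction L with
  | nil =>
    have : (Finsupp.equivFunOnFinite.symm fun i : Fin m => List.count i []) = 0 := by ext; simp
    rw [this]
    simp
  | cons k L ih =>
    rw [List.foldr_cons, ih, MvPolynomial.pderiv_monomial]
    refine congrArg₂ (fun s a => MvPolynomial.monomial s a) ?_ ?_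
    · ext i
      by_cases h : k = i
      · subst h; simp [Nat.sub_sub]
      · simp [h, List.count_cons]
    · rw [mul_assoc]
      congr 1
      rw [← Finset.mul_prod_erase _ _ (Finset.mem_univ k),
        ← Finset.mul_prod_erase _ (fun i => ((α i).descFactorial (List.count i (k :: L)) : ℂ))
          (Finset.mem_univ k)]
      rw [Finset.prod_congr rfl fun i hi => by
        rw [show List.count i L = List.count i (k :: L) by
          simp [(Finset.ne_of_mem_erase hi).symm]]]
      rw [List.count_cons_self, Nat.descFactorial_succ]
      simp
      ring

/-- Functions of the coordinates in `s` are constants for derivatives in the other directions. -/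
theorem wordDeriv_mul_of_not_mem {s : Finset (Fin m)} (h : EuclideanSpace ℂ s → ℂ)
    {L : List (Fin m)} (hL : ∀ i ∈ L, i ∉ s) :
    wordDeriv L (fun z => h (proj s z) * f z) = fun z => h (proj s z) * wordDeriv L f z := by
  induction L with
  | nil => rfl
  | cons i L ih =>
    funext z
    rw [wordDeriv_cons, ih fun k hk => hL k (List.mem_cons_of_mem i hk), wordDeriv_cons, pderiv,
      pderiv, lineDeriv, lineDeriv, ← deriv_const_mul_field]
    congr 1
    funext t
    congr 2
    refine proj_congr fun k hk => ?_
    have : k ≠ i := fun e => hL i (List.mem_cons_self) (e ▸ hk)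
    simp [this]

theorem wordDeriv_comp_proj {s : Finset (Fin m)} (h : EuclideanSpace ℂ s → ℂ)
    (L : List (Fin m)) : ∃ h' : EuclideanSpace ℂ s → ℂ,
      wordDeriv L (fun z => h (proj s z)) = fun z => h' (proj s z) := by
  induction L with
  | nil => exact ⟨h, rfl⟩
  | cons i L ih =>
    obtain ⟨h', e⟩ := ih
    refine ⟨fun w => lineDeriv ℂ h' w (proj s (EuclideanSpace.single i 1)), ?_⟩
    rw [wordDeriv_cons, e]
    rfl

theorem wordDeriv_comp_proj_eq_zero {s : Finset (Fin m)} (h : EuclideanSpace ℂ s → ℂ)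
    {L : List (Fin m)} (hL : ∃ i ∈ L, i ∉ s) :
    wordDeriv L (fun z => h (proj s z)) = fun _ => 0 := by
  obtain ⟨i, hi, his⟩ := hL
  obtain ⟨L₁, L₂, rfl⟩ := List.append_of_mem hi
  obtain ⟨h', e⟩ := wordDeriv_comp_proj h L₂
  have : pderiv i (fun z => h' (proj s z)) = fun _ => 0 := by
    have h1 := wordDeriv_mul_of_not_mem (f := fun _ => 1) h' (L := [i]) (by simpa using his)
    simp only [mul_one, wordDeriv_cons, wordDeriv_nil] at h1
    rw [h1]
    funext z
    simp [pderiv, lineDeriv]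
  rw [wordDeriv_append, wordDeriv_cons, e, this, wordDeriv_zero]

end Calculus

/-! ### Weighted bounds and Cauchy estimates on multi-cones -/

section Bounds

variable {n ℓ : ℕ} {I : Fin ℓ → Finset (Fin n)} {S : MultiCone I}
  {f g : EuclideanSpace ℂ (Fin n) → ℂ}

/-- `g` is bounded by a multiple of `∏_j |z_{Î_j}|^{m_j}` on each multi-cone properly contained
in `S`. -/
def WeightedBound (S : MultiCone I) (m : Fin ℓ → ℤ) (g : EuclideanSpace ℂ (Fin n) → ℂ) : Prop :=
  ∀ S' : MultiCone I, S'.ProperlyContained S →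
    ∃ C, ∀ z ∈ S'.carrier, ‖g z‖ ≤ C * ∏ j, ‖proj (hat I j) z‖ ^ m j

/-- A derivative with respect to `z_i`, `i ∈ Î_b`, costs a factor `|z_{Î_b}|`: the multi-cones
contain polydiscs of a radius comparable to it in that direction. -/
theorem WeightedBound.pderiv (hI : Admissible I) (hg : DifferentiableOn ℂ g S.carrier)
    {m : Fin ℓ → ℤ} (h : WeightedBound S m g) (i : Fin n) :
    WeightedBound S (fun j => m j - if i ∈ hat I j then 1 else 0) (pderiv i g) := by
  intro S' hS'
  obtain ⟨S'', h1, h2⟩ := hS'.exists_between hI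
  obtain ⟨δ, hδ, hδ1, hroom⟩ := h1.exists_room hI
  obtain ⟨C, hC⟩ := h S'' h2
  have hC0 : ∀ z ∈ S''.carrier, 0 ≤ C * ∏ j, ‖proj (hat I j) z‖ ^ m j := fun z hz =>
    (norm_nonneg _).trans (hC z hz)
  have hg'' := hg.mono (h2.carrier_subset hI)
  have hpd : ∀ z ∈ S'.carrier, MultiAsymptotic.pderiv i g z = fderiv ℂ g z (EuclideanSpace.single i 1) :=
    fun z hz => pderiv_eq S.isOpen_carrier hg i (hS'.carrier_subset hI hz)
  have hproj0 : ∀ (s : Finset (Fin n)) (ζ : ℂ), i ∉ s →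
      proj s (ζ • EuclideanSpace.single i (1 : ℂ)) = 0 := fun s ζ hi => by
    ext k
    have : (k : Fin n) ≠ i := fun e => hi (e ▸ k.2)
    simp [proj_apply, this]
  have hnorm : ∀ ζ : ℂ, ‖ζ • EuclideanSpace.single i (1 : ℂ)‖ = ‖ζ‖ := fun ζ => by
    rw [norm_smul]; simp
  rcases rest_or_hat (I := I) i with hi | ⟨b, hb⟩
  · -- all the `z_{Î_j}` stay the same
    have hij : ∀ j, i ∉ hat I j := fun j hj => mem_rest.1 hi j (hat_subset j hj)
    simp only [hij, if_false, sub_zero]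
    refine ⟨C / δ, fun z hz => ?_⟩
    rw [hpd z hz, div_mul_eq_mul_div]
    refine norm_fderiv_apply_le S''.isOpen_carrier hg'' hδ (fun ζ hζ => ?_) fun ζ hζ => ?_
    · refine hroom z hz _ (fun j => ?_) ((norm_proj_le _).trans ?_)
      · rw [hproj0 _ ζ (hij j), norm_zero]; positivity
      · rwa [hnorm]
    · have hmem : z + ζ • EuclideanSpace.single i (1 : ℂ) ∈ S''.carrier := by
        refine hroom z hz _ (fun j => ?_) ((norm_proj_le _).trans ?_)
        · rw [hproj0 _ ζ (hij j), norm_zero]; positivity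
        · rwa [hnorm]
      refine (hC _ hmem).trans (le_of_eq ?_)
      simp only [proj_add, hproj0 _ ζ (hij _), add_zero]
  · -- on a disc of radius `δ |z_{Î_b}| / 2`, `|z_{Î_b}|` changes by a factor between `1 / 2` and `2`, and
    -- the other norms stay the same
    have hij : ∀ j, i ∈ hat I j ↔ j = b := fun j =>
      ⟨fun h => hI.eq_of_mem_hat h hb, fun h => h ▸ hb⟩
    have hir : i ∉ rest I := fun hr => mem_rest.1 hr b (hat_subset b hb)
    refine ⟨2 ^ (m b).natAbs * C / (δ / 2), fun z hz => ?_⟩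
    have hzS := hS'.carrier_subset hI hz
    have hpos := S.norm_proj_pos hI hzS
    have hmem : ∀ ζ : ℂ, ‖ζ‖ ≤ δ / 2 * ‖proj (hat I b) z‖ →
        z + ζ • EuclideanSpace.single i (1 : ℂ) ∈ S''.carrier := fun ζ hζ => by
      refine hroom z hz _ (fun j => ?_) ?_
      · by_cases hj : j = b
        · subst hj
          refine (norm_proj_le _).trans ?_
          rw [hnorm]
          refine hζ.trans ?_
          gcongr
          linarith
        · rw [hproj0 _ ζ fun h => hj ((hij j).1 h), norm_zero]; positivity
      · rw [hproj0 _ ζ hir, norm_zero]; positivity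
    have hkey : ‖fderiv ℂ g z (EuclideanSpace.single i 1)‖ ≤
        (2 ^ (m b).natAbs * (C * ∏ j, ‖proj (hat I j) z‖ ^ m j)) /
          (δ / 2 * ‖proj (hat I b) z‖) := by
      refine norm_fderiv_apply_le S''.isOpen_carrier hg'' (mul_pos (by positivity) (hpos b))
        hmem fun ζ hζ => ?_
      refine (hC _ (hmem ζ hζ)).trans ?_
      have hz' := S''.norm_proj_pos hI (hmem ζ hζ) b
      have hu : ‖proj (hat I b) (ζ • EuclideanSpace.single i (1 : ℂ))‖ ≤
          1 / 2 * ‖proj (hat I b) z‖ := by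
        refine (norm_proj_le _).trans ?_
        rw [hnorm]
        refine hζ.trans ?_
        gcongr
      have hcmp : ‖proj (hat I b) (z + ζ • EuclideanSpace.single i (1 : ℂ))‖ ^ m b ≤
          2 ^ (m b).natAbs * ‖proj (hat I b) z‖ ^ m b := by
        refine zpow_le_of_comparable (hpos b) hz' ?_ ?_ _
        · rw [proj_add]
          have := norm_add_le (proj (hat I b) z)
            (proj (hat I b) (ζ • EuclideanSpace.single i (1 : ℂ)))
          linarith [hpos b]
        · rw [proj_add]
          have := norm_sub_norm_le (proj (hat I b) z)
            (-proj (hat I b) (ζ • EuclideanSpace.single i (1 : ℂ)))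
          rw [sub_neg_eq_add, norm_neg] at this
          linarith [hpos b]
      have hC' : 0 ≤ C := by
        refine nonneg_of_mul_nonneg_left (hC0 _ (hmem ζ hζ)) ?_
        exact Finset.prod_pos fun j _ => zpow_pos (S''.norm_proj_pos hI (hmem ζ hζ) j) _
      rw [← Finset.mul_prod_erase _ _ (Finset.mem_univ b),
        ← Finset.mul_prod_erase _ (fun j => ‖proj (hat I j) z‖ ^ m j) (Finset.mem_univ b)]
      rw [Finset.prod_congr rfl fun j hj => by
        rw [proj_add, hproj0 (hat I j) ζ fun h => Finset.ne_of_mem_erase hj ((hij j).1 h),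
          add_zero]]
      have hP : 0 ≤ ∏ j ∈ Finset.univ.erase b, ‖proj (hat I j) z‖ ^ m j :=
        Finset.prod_nonneg fun j _ => zpow_nonneg (norm_nonneg _) _
      refine (mul_le_mul_of_nonneg_left (mul_le_mul_of_nonneg_right hcmp hP) hC').trans
        (le_of_eq ?_)
      rw [mul_assoc (2 ^ _), mul_left_comm]
    rw [hpd z hz]
    refine hkey.trans (le_of_eq ?_)
    have hprod : ∏ j, ‖proj (hat I j) z‖ ^ (m j - if i ∈ hat I j then 1 else 0) =
        (∏ j, ‖proj (hat I j) z‖ ^ m j) / ‖proj (hat I b) z‖ := by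
      have : ∀ j, ‖proj (hat I j) z‖ ^ (m j - if i ∈ hat I j then 1 else 0) =
          ‖proj (hat I j) z‖ ^ m j * (if j = b then ‖proj (hat I b) z‖⁻¹ else 1) := fun j => by
        by_cases hj : j = b
        · subst hj
          rw [if_pos hb, if_pos rfl, zpow_sub_one₀ (hpos j).ne']
        · rw [if_neg fun h => hj ((hij j).1 h), if_neg hj, sub_zero, mul_one]
      rw [Finset.prod_congr rfl fun j _ => this j, Finset.prod_mul_distrib,
        Finset.prod_ite_eq' Finset.univ b, if_pos (Finset.mem_univ b), div_eq_mul_inv]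
    rw [hprod]
    have := (hpos b).ne'
    field_simp

/-- The weighted bounds for higher derivatives: the exponent of `|z_{Î_j}|` drops by the order of the
derivative in the variables of `Î_j`. -/
theorem WeightedBound.wordDeriv (hI : Admissible I) (hg : DifferentiableOn ℂ g S.carrier)
    {m : Fin ℓ → ℤ} (h : WeightedBound S m g) (L : List (Fin n)) :
    WeightedBound S (fun j => m j - ∑ i ∈ hat I j, (L.count i : ℤ)) (wordDeriv L g) := by
  induction L with
  | nil => simpa using h
  | cons i L ih =>
    have := ih.pderiv hI (differentiableOn_wordDeriv S.isOpen_carrier hg L) i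
    rw [wordDeriv_cons]
    convert! this using 2 with j
    rw [sub_sub]
    congr 1
    have h1 : ∀ k, (List.count k (i :: L) : ℤ) = List.count k L + if k = i then 1 else 0 := by
      intro k
      by_cases hk : k = i
      · subst hk; simp
      · simp [hk, Ne.symm hk]
    simp only [h1, Finset.sum_add_distrib, Finset.sum_ite_eq']

theorem WeightedBound.sub {m : Fin ℓ → ℤ} (hf : WeightedBound S m f) (hg : WeightedBound S m g) :
    WeightedBound S m fun z => f z - g z := by
  intro S' hS'
  obtain ⟨C, hC⟩ := hf S' hS'
  obtain ⟨C', hC'⟩ := hg S' hS'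
  refine ⟨C + C', fun z hz => (norm_sub_le _ _).trans ?_⟩
  rw [add_mul]
  exact add_le_add (hC z hz) (hC' z hz)

/-- All partial derivatives of `g` are bounded on each multi-cone properly contained in `S`. -/
def BoundedDerivs (S : MultiCone I) (g : EuclideanSpace ℂ (Fin n) → ℂ) : Prop :=
  ∀ L : List (Fin n), ∀ S' : MultiCone I, S'.ProperlyContained S →
    ∃ C, ∀ z ∈ S'.carrier, ‖wordDeriv L g z‖ ≤ C

theorem BoundedDerivs.pderiv (hg : BoundedDerivs S g) (i : Fin n) :
    BoundedDerivs S (pderiv i g) := fun L S' hS' => by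
  obtain ⟨C, hC⟩ := hg (L ++ [i]) S' hS'
  refine ⟨C, fun z hz => ?_⟩
  have := hC z hz
  rwa [wordDeriv_append] at this

theorem BoundedDerivs.const_mul (hg : BoundedDerivs S g) (c : ℂ) :
    BoundedDerivs S fun z => c * g z := fun L S' hS' => by
  obtain ⟨C, hC⟩ := hg L S' hS'
  refine ⟨‖c‖ * C, fun z hz => ?_⟩
  rw [wordDeriv_const_mul, norm_mul]
  gcongr
  exact hC z hz

theorem BoundedDerivs.sum (hI : Admissible I) {ι : Type*} {s : Finset ι}
    {f : ι → EuclideanSpace ℂ (Fin n) → ℂ} (hf : ∀ a ∈ s, DifferentiableOn ℂ (f a) S.carrier)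
    (h : ∀ a ∈ s, BoundedDerivs S (f a)) : BoundedDerivs S fun z => ∑ a ∈ s, f a z := by
  intro L S' hS'
  choose! C hC using fun a (ha : a ∈ s) => h a ha L S' hS'
  refine ⟨∑ a ∈ s, C a, fun z hz => ?_⟩
  rw [wordDeriv_sum S.isOpen_carrier hf L (hS'.carrier_subset hI hz)]
  exact (norm_sum_le _ _).trans (Finset.sum_le_sum fun a ha => hC a ha z hz)

theorem BoundedDerivs.mul (hI : Admissible I) (hf : DifferentiableOn ℂ f S.carrier)
    (hg : DifferentiableOn ℂ g S.carrier) (h : BoundedDerivs S f) (h' : BoundedDerivs S g) :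
    BoundedDerivs S fun z => f z * g z := by
  intro L S' hS'
  have hO := S.isOpen_carrier
  induction L using List.reverseRecOn generalizing f g with
  | nil =>
    obtain ⟨C, hC⟩ := h [] S' hS'
    obtain ⟨C', hC'⟩ := h' [] S' hS'
    refine ⟨C * C', fun z hz => ?_⟩
    rw [wordDeriv_nil, norm_mul]
    exact mul_le_mul (hC z hz) (hC' z hz) (norm_nonneg _) ((norm_nonneg _).trans (hC z hz))
  | append_singleton L i ih =>
    have hf' := differentiableOn_pderiv hO hf i
    have hg' := differentiableOn_pderiv hO hg i
    obtain ⟨C, hC⟩ := ih hf hg' h (h'.pderiv i)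
    obtain ⟨C', hC'⟩ := ih hf' hg (h.pderiv i) h'
    refine ⟨C + C', fun z hz => ?_⟩
    have hzS := hS'.carrier_subset hI hz
    have h1 := wordDeriv_congr hO (pderiv_mul hO hf hg i) L hzS
    have h2 := wordDeriv_add hO (hf.fun_mul hg') (hf'.fun_mul hg) L hzS
    have h3 : wordDeriv (L ++ [i]) (fun z => f z * g z) z =
        wordDeriv L (fun z => f z * MultiAsymptotic.pderiv i g z) z +
          wordDeriv L (fun z => MultiAsymptotic.pderiv i f z * g z) z := by
      rw [wordDeriv_append]
      exact h1.trans h2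
    rw [h3]
    exact (norm_add_le _ _).trans (add_le_add (hC z hz) (hC' z hz))

theorem boundedDerivs_eval (p : MvPolynomial (Fin n) ℂ) :
    BoundedDerivs S fun z => MvPolynomial.eval (fun i => z i) p := by
  intro L S' hS'
  rw [wordDeriv_eval]
  obtain ⟨C, hC⟩ := hS'.isCompact_closure_U.exists_bound_of_continuousOn
    (differentiable_eval (L.foldr (fun i => MvPolynomial.pderiv i) p)).continuous.continuousOn
  exact ⟨C, fun z hz => hC z (subset_closure hz.1)⟩

end Bounds

/-! ### Coefficients of a developable function have bounded derivatives -/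

section Developable

variable {n ℓ : ℕ} {I : Fin ℓ → Finset (Fin n)} {S : MultiCone I}
  {f : EuclideanSpace ℂ (Fin n) → ℂ}

/-- `T_J^β(F; z)` as a sum over multi-indices. -/
noncomputable def taylorTerm (F : CoeffFamily I) (J : Finset (Fin ℓ)) (b : Fin ℓ → ℕ)
    (z : EuclideanSpace ℂ (Fin n)) : ℂ :=
  ∑ α ∈ indices I J b, F J α (proj (union I J)ᶜ z) *
    MvPolynomial.eval (fun i => z i) (MvPolynomial.monomial α (∏ i, ((α i).factorial : ℂ))⁻¹)

/-- The definition of `T_J^β(F; z)` by substitution in the polynomial gives the sum over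
multi-indices. -/
theorem tau_taylorPoly (F : CoeffFamily I) (J : Finset (Fin ℓ)) (b : Fin ℓ → ℕ)
    (z : EuclideanSpace ℂ (Fin n)) :
    tau F J (taylorPoly I J b) z = taylorTerm F J b z := by
  have hc : ∀ α, (taylorPoly I J b).coeff α =
      if α ∈ indices I J b then (∏ i, ((α i).factorial : ℂ))⁻¹ else 0 := fun α => by
    rw [taylorPoly, MvPolynomial.coeff_sum]
    simp only [MvPolynomial.coeff_monomial]
    rw [Finset.sum_ite_eq']
  have hsub : (taylorPoly I J b).support ⊆ indices I J b := fun α hα => by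
    rw [MvPolynomial.mem_support_iff, hc] at hα
    by_contra h
    exact hα (if_neg h)
  rw [tau, taylorTerm, Finset.sum_subset hsub fun α _ hα => by
    rw [MvPolynomial.notMem_support_iff.1 hα]; ring]
  refine Finset.sum_congr rfl fun α hα => ?_
  rw [hc, if_pos hα, MvPolynomial.eval_monomial, Finsupp.prod_fintype _ _ (by simp)]
  ring

theorem indices_congr {J : Finset (Fin ℓ)} {b b' : Fin ℓ → ℕ} (h : ∀ j ∈ J, b j = b' j) :
    indices I J b = indices I J b' := by
  ext α
  rw [mem_indices, mem_indices]
  refine and_congr_right fun _ => ?_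
  constructor
  · intro h' j hj; rw [h' j hj, h j hj]
  · intro h' j hj; rw [h' j hj, h j hj]

theorem taylorTerm_congr (F : CoeffFamily I) {J : Finset (Fin ℓ)} {b b' : Fin ℓ → ℕ}
    (h : ∀ j ∈ J, b j = b' j) : taylorTerm F J b = taylorTerm F J b' := by
  funext z
  rw [taylorTerm, taylorTerm, indices_congr h]

/-- The exponents `β` with `β_j = n_j` for `j ∈ J` and `β_j < n_j` for `j ∈ K`. -/
def mixedIndices (J K : Finset (Fin ℓ)) (N : Fin ℓ → ℕ) : Finset (Fin ℓ → ℕ) :=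
  Fintype.piFinset fun j => if j ∈ J then {N j} else if j ∈ K then Finset.range (N j) else {0}

/-- The difference, with respect to the variables `n_j` with `j ∈ J`, of the remainder
`f - App^{<N}`. The term with `K = ∅` is `T_J^N(F; z)`, the other ones only involve the coefficients
`f_{J', α}` with `J' ⊋ J`. -/
noncomputable def remainder (F : CoeffFamily I) (J : Finset (Fin ℓ)) (N : Fin ℓ → ℕ)
    (z : EuclideanSpace ℂ (Fin n)) : ℂ :=
  ∑ K ∈ (Jᶜ).powerset, (-1) ^ K.card * ∑ b ∈ mixedIndices J K N, taylorTerm F (J ∪ K) b z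

/-- The differences are obtained one variable at a time: `R_{J ∪ {j}}(N) = R_J(N) - R_J(N + e_j)`. -/
theorem remainder_insert (F : CoeffFamily I) {J : Finset (Fin ℓ)} {j : Fin ℓ} (hj : j ∉ J)
    (N : Fin ℓ → ℕ) (z : EuclideanSpace ℂ (Fin n)) :
    remainder F (insert j J) N z =
      remainder F J N z - remainder F J (Function.update N j (N j + 1)) z := by
  set N' := Function.update N j (N j + 1) with hN'
  have hN'j : N' j = N j + 1 := Function.update_self ..
  have hN'k : ∀ k, k ≠ j → N' k = N k := fun k hk => Function.update_of_ne hk ..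
  have hcompl : Jᶜ = insert j (insert j J)ᶜ := by
    ext k
    by_cases hk : k = j
    · subst hk; simp [hj]
    · simp [hk]
  have hjc : j ∉ (insert j J)ᶜ := by simp
  simp only [remainder]
  rw [hcompl, Finset.sum_powerset_insert hjc, Finset.sum_powerset_insert hjc,
    ← Finset.sum_add_distrib, ← Finset.sum_add_distrib, ← Finset.sum_sub_distrib]
  refine Finset.sum_congr rfl fun K hK => ?_
  have hjK : j ∉ K := fun h => hjc (Finset.mem_powerset.1 hK h)
  have h1 : mixedIndices J K N' = mixedIndices J K N := by
    unfold mixedIndices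
    congr 1
    funext k
    by_cases hk : k = j
    · subst hk; rw [if_neg hj, if_neg hjK, if_neg hj, if_neg hjK]
    · rw [hN'k k hk]
  -- the exponents with `β_j < n_j + 1` are those with `β_j < n_j` and those with `β_j = n_j`
  have h2 : mixedIndices J (insert j K) N' =
      mixedIndices J (insert j K) N ∪ mixedIndices (insert j J) K N := by
    ext b
    simp only [mixedIndices, Finset.mem_union, Fintype.mem_piFinset]
    have hsplit : ∀ g : Fin ℓ → Finset ℕ, (∀ k, b k ∈ g k) ↔
        b j ∈ g j ∧ ∀ k, k ≠ j → b k ∈ g k := fun g =>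
      ⟨fun h => ⟨h j, fun k _ => h k⟩, fun h k => by
        by_cases hk : k = j
        · exact hk ▸ h.1
        · exact h.2 k hk⟩
    rw [hsplit, hsplit (fun k => if k ∈ J then {N k} else _),
      hsplit (fun k => if k ∈ insert j J then {N k} else _)]
    have ha : (∀ k, k ≠ j → b k ∈ (if k ∈ J then {N' k} else if k ∈ insert j K then
        Finset.range (N' k) else {0} : Finset ℕ)) ↔ ∀ k, k ≠ j → b k ∈ (if k ∈ J then {N k} else
        if k ∈ insert j K then Finset.range (N k) else {0} : Finset ℕ) :=
      forall₂_congr fun k hk => by rw [hN'k k hk]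
    have hb : (∀ k, k ≠ j → b k ∈ (if k ∈ insert j J then {N k} else if k ∈ K then
        Finset.range (N k) else {0} : Finset ℕ)) ↔ ∀ k, k ≠ j → b k ∈ (if k ∈ J then {N k} else
        if k ∈ insert j K then Finset.range (N k) else {0} : Finset ℕ) :=
      forall₂_congr fun k hk => by simp only [Finset.mem_insert, hk, false_or]
    rw [ha, hb, ← or_and_right]
    refine and_congr_left fun _ => ?_
    simp only [hj, if_false, Finset.mem_insert_self, if_true, Finset.mem_range, hN'j,
      Finset.mem_singleton]
    omega
  have h3 : Disjoint (mixedIndices J (insert j K) N) (mixedIndices (insert j J) K N) := by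
    rw [Finset.disjoint_left]
    intro b hb hb'
    have e1 := Fintype.mem_piFinset.1 hb j
    have e2 := Fintype.mem_piFinset.1 hb' j
    simp [hj] at e1 e2
    omega
  have h4 : J ∪ insert j K = insert j J ∪ K := by
    rw [Finset.union_insert, Finset.insert_union]
  rw [h1, h2, Finset.sum_union h3, h4, Finset.card_insert_of_notMem hjK, pow_succ]
  ring

variable (F : CoeffFamily I)

theorem differentiableOn_taylorTerm {J : Finset (Fin ℓ)}
    (hF : ∀ α : Fin n →₀ ℕ, α.support ⊆ union I J →
      DifferentiableOn ℂ (fun z => F J α (proj (union I J)ᶜ z)) S.carrier) (b : Fin ℓ → ℕ) :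
    DifferentiableOn ℂ (taylorTerm F J b) S.carrier :=
  DifferentiableOn.fun_sum fun α hα => (hF α (mem_indices.1 hα).1).fun_mul
    (differentiable_eval _).differentiableOn

theorem boundedDerivs_taylorTerm (hI : Admissible I) {J : Finset (Fin ℓ)}
    (hF : ∀ α : Fin n →₀ ℕ, α.support ⊆ union I J →
      DifferentiableOn ℂ (fun z => F J α (proj (union I J)ᶜ z)) S.carrier)
    (h : ∀ α : Fin n →₀ ℕ, α.support ⊆ union I J →
      BoundedDerivs S fun z => F J α (proj (union I J)ᶜ z)) (b : Fin ℓ → ℕ) :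
    BoundedDerivs S (taylorTerm F J b) :=
  BoundedDerivs.sum hI (fun α hα => (hF α (mem_indices.1 hα).1).fun_mul
    (differentiable_eval _).differentiableOn) fun α hα =>
    BoundedDerivs.mul hI (hF α (mem_indices.1 hα).1) (differentiable_eval _).differentiableOn
      (h α (mem_indices.1 hα).1) (boundedDerivs_eval _)

/-- The derivative `∂^α` singles out the coefficient `f_{J,α}` of `T_J^b`, where `b` is the
multidegree of `α`. -/
theorem wordDeriv_taylorTerm {J : Finset (Fin ℓ)}
    (hF : ∀ α : Fin n →₀ ℕ, α.support ⊆ union I J →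
      DifferentiableOn ℂ (fun z => F J α (proj (union I J)ᶜ z)) S.carrier)
    {α : Fin n →₀ ℕ} (hα : α.support ⊆ union I J) {b : Fin ℓ → ℕ}
    (hb : ∀ j ∈ J, ∑ i ∈ I j, α i = b j) :
    Set.EqOn (wordDeriv (wordOf α) (taylorTerm F J b))
      (fun z => F J α (proj (union I J)ᶜ z)) S.carrier := by
  intro z hz
  have h1 := wordDeriv_sum S.isOpen_carrier (s := indices I J b)
    (f := fun α z => F J α (proj (union I J)ᶜ z) *
      MvPolynomial.eval (fun i => z i) (MvPolynomial.monomial α (∏ i, ((α i).factorial : ℂ))⁻¹))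
    (fun α hα => (hF α (mem_indices.1 hα).1).fun_mul
      (differentiable_eval _).differentiableOn) (wordOf α) hz
  have hL : ∀ i ∈ wordOf α, i ∉ (union I J)ᶜ := fun i hi => by
    rw [Finset.mem_compl, not_not]
    refine hα (Finsupp.mem_support_iff.2 ?_)
    rw [← count_wordOf α i]
    exact (List.count_pos_iff.2 hi).ne'
  refine h1.trans ?_
  have hcount : (Finsupp.equivFunOnFinite.symm fun i => (wordOf α).count i) = α := by
    ext i
    exact count_wordOf α i
  have h2 : ∀ γ : Fin n →₀ ℕ, wordDeriv (wordOf α) (fun z => F J γ (proj (union I J)ᶜ z) *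
      MvPolynomial.eval (fun i => z i) (MvPolynomial.monomial γ (∏ i, ((γ i).factorial : ℂ))⁻¹)) z =
      F J γ (proj (union I J)ᶜ z) * MvPolynomial.eval (fun i => z i)
        (MvPolynomial.monomial (γ - α) ((∏ i, ((γ i).factorial : ℂ))⁻¹ *
          ∏ i, ((γ i).descFactorial (α i) : ℂ))) := fun γ => by
    rw [wordDeriv_mul_of_not_mem _ hL, wordDeriv_eval, foldr_pderiv_monomial, hcount]
    simp only [count_wordOf]
  simp only [h2]
  rw [Finset.sum_eq_single α]
  · have h3 : (∏ i, ((α i).factorial : ℂ)) ≠ 0 :=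
      Finset.prod_ne_zero_iff.2 fun i _ => by exact_mod_cast (α i).factorial_ne_zero
    simp [Nat.descFactorial_self, h3]
  · intro γ hγ hne
    -- as `γ` and `α` have the same multidegree, `γ` is not bounded below by `α`
    obtain ⟨i, hi⟩ : ∃ i, γ i < α i := by
      by_contra! hle
      apply hne
      obtain ⟨hs, hγb⟩ := mem_indices.1 hγ
      ext i
      by_cases hi : i ∈ union I J
      · obtain ⟨j, hj, hij⟩ := mem_union.1 hi
        have := (Finset.sum_eq_sum_iff_of_le (s := I j) fun i _ => hle i).1
          ((hb j hj).trans (hγb j hj).symm)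
        exact (this i hij).symm
      · rw [Finsupp.notMem_support_iff.1 fun h => hi (hs h),
          Finsupp.notMem_support_iff.1 fun h => hi (hα h)]
    have : ∏ i, ((γ i).descFactorial (α i) : ℂ) = 0 :=
      Finset.prod_eq_zero (Finset.mem_univ i)
        (by exact_mod_cast Nat.descFactorial_eq_zero_iff_lt.2 hi)
    rw [this]
    simp
  · intro h
    exact absurd (mem_indices.2 ⟨hα, hb⟩) h

/-- If the differences of the remainders satisfy the weighted bounds, then the coefficients have
bounded derivatives: all derivatives of order `N` of `remainder F J N` are bounded, and up to the
coefficients with a larger `J` they are derivatives of the coefficients. -/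
theorem boundedDerivs_coeff (hI : Admissible I)
    (hF : ∀ J, ∀ α : Fin n →₀ ℕ, α.support ⊆ union I J →
      DifferentiableOn ℂ (fun z => F J α (proj (union I J)ᶜ z)) S.carrier)
    (hQ : ∀ J N, WeightedBound S (fun j => weight I j N) (remainder F J N))
    (J : Finset (Fin ℓ)) (α : Fin n →₀ ℕ) (hα : α.support ⊆ union I J) :
    BoundedDerivs S fun z => F J α (proj (union I J)ᶜ z) := by
  induction hk : (Jᶜ).card using Nat.strong_induction_on generalizing J α with
  | _ k ih =>
  intro L S' hS'
  by_cases hL : ∃ i ∈ L, i ∉ (union I J)ᶜ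
  · rw [wordDeriv_comp_proj_eq_zero _ hL]
    exact ⟨0, fun z _ => by simp⟩
  push Not at hL
  -- `∂^L ∂^α`, and the multidegree `N` for which the weights and the order of this derivative cancel
  let M := L ++ wordOf α
  let N : Fin ℓ → ℕ := fun j => ∑ i ∈ I j, M.count i
  have hN : ∀ j ∈ J, ∑ i ∈ I j, α i = N j := fun j hj => by
    refine Finset.sum_congr rfl fun i hi => ?_
    have : L.count i = 0 := List.count_eq_zero.2 fun h =>
      Finset.mem_compl.1 (hL i h) (mem_union.2 ⟨j, hj, hi⟩)
    simp [M, this, count_wordOf]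
  let R : EuclideanSpace ℂ (Fin n) → ℂ := fun z => ∑ K ∈ (Jᶜ).powerset.erase ∅,
    (-1) ^ K.card * ∑ b ∈ mixedIndices J K N, taylorTerm F (J ∪ K) b z
  have hdecomp : ∀ z, remainder F J N z = taylorTerm F J N z + R z := fun z => by
    rw [remainder, ← Finset.add_sum_erase _ _ (Finset.empty_mem_powerset Jᶜ)]
    congr 1
    have : mixedIndices J ∅ N = {fun j => if j ∈ J then N j else 0} := by
      ext b
      rw [mixedIndices, Fintype.mem_piFinset, Finset.mem_singleton, funext_iff]
      refine forall_congr' fun j => ?_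
      by_cases hj : j ∈ J <;> simp [hj]
    rw [this, Finset.sum_singleton, Finset.card_empty, pow_zero, one_mul, Finset.union_empty]
    exact congrFun (taylorTerm_congr F fun j hj => if_pos hj) z
  have hTd : DifferentiableOn ℂ (taylorTerm F J N) S.carrier :=
    differentiableOn_taylorTerm F (hF J) N
  have hRd : DifferentiableOn ℂ R S.carrier := DifferentiableOn.fun_sum fun K _ =>
    (DifferentiableOn.fun_sum fun b _ => differentiableOn_taylorTerm F (hF (J ∪ K)) b).const_mul _
  have hRb : BoundedDerivs S R := by
    refine BoundedDerivs.sum hI (fun K _ => (DifferentiableOn.fun_sum fun b _ =>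
      differentiableOn_taylorTerm F (hF (J ∪ K)) b).const_mul _) fun K hK => ?_
    refine BoundedDerivs.const_mul (BoundedDerivs.sum hI (fun b _ =>
      differentiableOn_taylorTerm F (hF (J ∪ K)) b) fun b _ => ?_) _
    refine boundedDerivs_taylorTerm F hI (hF (J ∪ K)) (fun γ hγ => ?_) b
    refine ih _ ?_ (J ∪ K) γ hγ rfl
    rw [← hk]
    refine Finset.card_lt_card ?_
    rw [Finset.mem_erase, Finset.mem_powerset] at hK
    obtain ⟨k, hk⟩ := Finset.nonempty_iff_ne_empty.2 hK.1
    rw [Finset.ssubset_iff_of_subset (Finset.compl_subset_compl.2 Finset.subset_union_left)]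
    exact ⟨k, hK.2 hk, by simp [hk]⟩
  obtain ⟨C, hC⟩ := hRb M S' hS'
  have hQd : DifferentiableOn ℂ (remainder F J N) S.carrier :=
    (hTd.fun_add hRd).congr fun z _ => hdecomp z
  obtain ⟨C', hC'⟩ := (hQ J N).wordDeriv hI hQd M S' hS'
  refine ⟨C' + C, fun z hz => ?_⟩
  have hzS := hS'.carrier_subset hI hz
  have hω : ∏ j, ‖proj (hat I j) z‖ ^ (weight I j N - ∑ i ∈ hat I j, (M.count i : ℤ)) = 1 := by
    refine Finset.prod_eq_one fun j _ => ?_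
    rw [hI.weight_sum (fun i => M.count i) j, sub_self, zpow_zero]
  have h1 := hC' z hz
  rw [hω, mul_one] at h1
  have h2 : wordDeriv M (remainder F J N) z = wordDeriv M (taylorTerm F J N) z + wordDeriv M R z :=
    (wordDeriv_congr S.isOpen_carrier (fun z _ => hdecomp z) M hzS).trans
      (wordDeriv_add S.isOpen_carrier hTd hRd M hzS)
  have h3 : wordDeriv M (taylorTerm F J N) z =
      wordDeriv L (fun z => F J α (proj (union I J)ᶜ z)) z := by
    rw [wordDeriv_append]
    exact wordDeriv_congr S.isOpen_carrier (wordDeriv_taylorTerm F (hF J) hα hN) L hzS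
  rw [← h3, eq_sub_of_add_eq h2.symm]
  exact (norm_sub_le _ _).trans (add_le_add h1 (hC z hz))

/-- The family of coefficients `F`, completed by `f_{∅,0} = f`. -/
noncomputable def complete (f : EuclideanSpace ℂ (Fin n) → ℂ) : CoeffFamily I :=
  fun J α w => if J = ∅ then f (incl (union I J)ᶜ w) else F J α w

theorem incl_proj_empty (z : EuclideanSpace ℂ (Fin n)) :
    incl (union I ∅)ᶜ (proj (union I ∅)ᶜ z) = z := by
  ext i
  rw [incl_apply_mem _ _ (by simp [union]), proj_apply]

theorem indices_empty (b : Fin ℓ → ℕ) : indices I ∅ b = {0} := by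
  ext α
  simp [mem_indices, union]

/-- With `f_{∅,0} = f`, the difference for `J = ∅` is the remainder itself. -/
theorem remainder_empty (N : Fin ℓ → ℕ) (z : EuclideanSpace ℂ (Fin n)) :
    remainder (complete F f) ∅ N z = f z - App F N z := by
  have huniv : ((∅ : Finset (Fin ℓ))ᶜ).powerset = Finset.univ := by ext; simp
  have hfilter : Finset.univ.filter (fun J : Finset (Fin ℓ) => J.Nonempty) =
      Finset.univ.erase ∅ := by
    ext J; simp [Finset.nonempty_iff_ne_empty]
  have hmixed : ∀ K : Finset (Fin ℓ), mixedIndices ∅ K N = indicesLT K N := fun K => by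
    simp [mixedIndices, indicesLT]
  rw [remainder, App, hfilter, huniv, ← Finset.add_sum_erase _ _ (Finset.mem_univ ∅),
    sub_eq_add_neg, ← Finset.sum_neg_distrib]
  congr 1
  · have : indicesLT (∅ : Finset (Fin ℓ)) N = {0} := by
      ext b
      simp [indicesLT, funext_iff]
    rw [hmixed, this, Finset.sum_singleton, Finset.union_empty, taylorTerm, indices_empty,
      Finset.sum_singleton, complete, if_pos rfl, incl_proj_empty]
    simp
  · refine Finset.sum_congr rfl fun K hK => ?_
    rw [hmixed, Finset.empty_union, taylorSum, pow_succ, mul_neg_one, neg_mul, neg_neg]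
    congr 1
    refine Finset.sum_congr rfl fun b _ => ?_
    rw [tau_taylorPoly, taylorTerm, taylorTerm]
    simp only [complete, if_neg (Finset.ne_of_mem_erase hK)]

/-- The weighted bounds pass to the differences, as the weight for `N + e_j` is at most a multiple of
the weight for `N`. -/
theorem weightedBound_remainder (hI : Admissible I)
    (h0 : ∀ N, WeightedBound S (fun j => weight I j N) (remainder F ∅ N))
    (J : Finset (Fin ℓ)) (N : Fin ℓ → ℕ) :
    WeightedBound S (fun j => weight I j N) (remainder F J N) := by
  induction J using Finset.induction_on generalizing N with
  | empty => exact h0 N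
  | insert j J hj ih =>
    have h1 : WeightedBound S (fun k => weight I k N)
        (remainder F J (Function.update N j (N j + 1))) := by
      intro S' hS'
      obtain ⟨C, hC⟩ := ih (Function.update N j (N j + 1)) S' hS'
      refine ⟨|C| * max S.ε (S.radius j), fun z hz => (hC z hz).trans ?_⟩
      have hzS := hS'.carrier_subset hI hz
      have h2 := MultiCone.prod_weight_update_le hI hzS N j
      have h3 : 0 ≤ ∏ k, ‖proj (hat I k) z‖ ^ weight I k (Function.update N j (N j + 1)) :=
        Finset.prod_nonneg fun k _ => zpow_nonneg (norm_nonneg _) _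
      rw [mul_assoc]
      exact (mul_le_mul_of_nonneg_right (le_abs_self C) h3).trans
        (mul_le_mul_of_nonneg_left h2 (abs_nonneg C))
    intro S' hS'
    obtain ⟨C, hC⟩ := (ih N).sub h1 S' hS'
    exact ⟨C, fun z hz => by rw [remainder_insert F hj]; exact hC z hz⟩

/-- Developable functions have bounded derivatives: the case `J = ∅` of `boundedDerivs_coeff`. -/
theorem Developable.derivativesBounded (hI : Admissible I) (hf : DifferentiableOn ℂ f S.carrier)
    (h : Developable S f) : DerivativesBounded S f := by
  obtain ⟨F, hF, hbound⟩ := h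
  have hF' : ∀ J, ∀ α : Fin n →₀ ℕ, α.support ⊆ union I J → DifferentiableOn ℂ
      (fun z => complete F f J α (proj (union I J)ᶜ z)) S.carrier := by
    intro J α hα
    rcases J.eq_empty_or_nonempty with rfl | hJ
    · simpa only [complete, if_true, incl_proj_empty] using hf
    · simp only [complete, if_neg hJ.ne_empty]
      refine (hF J hJ α hα).comp (projL (union I J)ᶜ).differentiable.differentiableOn fun z hz => ?_
      rw [S.face_eq_image hI J]
      exact ⟨z, hz, rfl⟩
  have h0 : ∀ N, WeightedBound S (fun j => weight I j N) (remainder (complete F f) ∅ N) := by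
    intro N S' hS'
    obtain ⟨C, hC, hb⟩ := hbound S' hS' N
    obtain ⟨C', -, hC'⟩ := S'.prod_infDist_comparable hI fun j => weight I j N
    refine ⟨C * C', fun z hz => ?_⟩
    rw [remainder_empty, mul_assoc]
    exact (hb z hz).trans (mul_le_mul_of_nonneg_left (hC' z hz).1 hC.le)
  have hmain := boundedDerivs_coeff (complete F f) hI hF' (weightedBound_remainder _ hI h0)
    ∅ 0 (by simp)
  simp only [complete, if_true, incl_proj_empty] at hmain
  intro S' hS' α
  obtain ⟨C, hC⟩ := hmain (wordOf α) S' hS'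
  exact ⟨C, fun z hz => by rw [mixedPartial_eq_wordDeriv]; exact hC z hz⟩

end Developable

/-! ### Taylor remainders in several real variables -/

section DirDeriv

variable {E F : Type} [NormedAddCommGroup E] [NormedSpace ℝ E]
    [NormedAddCommGroup F] [NormedSpace ℝ F] {h h' : E → F}

theorem contDiff_iterate_dirDeriv (hh : ContDiff ℝ ∞ h) (v : E) (p : ℕ) :
    ContDiff ℝ ∞ ((dirDeriv v)^[p] h) := by
  rw [← contDiffOn_univ] at hh ⊢
  exact contDiffOn_iterate_dirDeriv isOpen_univ hh v p

theorem hasDerivAt_line (hh : ContDiff ℝ ∞ h) (x v : E) (t : ℝ) :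
    HasDerivAt (fun t : ℝ => h (x + t • v)) (dirDeriv v h (x + t • v)) t := by
  have h1 : HasDerivAt (fun t : ℝ => x + t • v) v t := by
    simpa using ((hasDerivAt_id t).smul_const v).const_add x
  exact ((hh.differentiable (by simp)) _).hasFDerivAt.comp_hasDerivAt t h1

theorem dirDeriv_eq_deriv (hh : ContDiff ℝ ∞ h) (x v : E) :
    dirDeriv v h x = deriv (fun t : ℝ => h (x + t • v)) 0 := by
  rw [(hasDerivAt_line hh x v 0).deriv]
  simp

theorem iteratedDeriv_line (hh : ContDiff ℝ ∞ h) (x v : E) (p : ℕ) :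
    iteratedDeriv p (fun t : ℝ => h (x + t • v)) =
      fun t => (dirDeriv v)^[p] h (x + t • v) := by
  induction p with
  | zero => simp
  | succ p ih =>
    funext t
    rw [iteratedDeriv_succ, ih, Function.iterate_succ_apply',
      (hasDerivAt_line (contDiff_iterate_dirDeriv hh v p) x v t).deriv]

theorem dirDeriv_comm (hh : ContDiff ℝ ∞ h) (v w : E) :
    dirDeriv v (dirDeriv w h) = dirDeriv w (dirDeriv v h) := by
  funext x
  have h1 := fderiv_dirDeriv isOpen_univ hh.contDiffOn w (Set.mem_univ x)
  have hd : DifferentiableAt ℝ (fderiv ℝ h) x :=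
    ((hh.fderiv_right (m := ∞) (by simp)).differentiable (by simp)) x
  have h2 : dirDeriv w (dirDeriv v h) x = fderiv ℝ (fderiv ℝ h) x w v := by
    change fderiv ℝ (fun y => fderiv ℝ h y v) x w = _
    rw [fderiv_clm_apply hd (differentiableAt_const _)]
    simp
  rw [h2, dirDeriv, h1]
  rfl

theorem dirDeriv_iterate_comm (hh : ContDiff ℝ ∞ h) (v w : E) (p : ℕ) :
    dirDeriv v ((dirDeriv w)^[p] h) = (dirDeriv w)^[p] (dirDeriv v h) := by
  induction p generalizing h with
  | zero => rfl
  | succ p ih =>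
    rw [Function.iterate_succ_apply, ih (contDiff_dirDeriv hh w), dirDeriv_comm hh v w,
      Function.iterate_succ_apply]

theorem iterate_dirDeriv_sub (hh : ContDiff ℝ ∞ h) (hh' : ContDiff ℝ ∞ h') (v : E) (p : ℕ) (x : E) :
    (dirDeriv v)^[p] (fun x => h x - h' x) x =
      (dirDeriv v)^[p] h x - (dirDeriv v)^[p] h' x := by
  induction p generalizing h h' with
  | zero => rfl
  | succ p ih =>
    have : dirDeriv v (fun x => h x - h' x) = fun x => dirDeriv v h x - dirDeriv v h' x := by
      funext x
      change fderiv ℝ (fun x => h x - h' x) x v = _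
      rw [fderiv_fun_sub ((hh.differentiable (by simp)) x) ((hh'.differentiable (by simp)) x)]
      rfl
    rw [Function.iterate_succ_apply, this, ih (contDiff_dirDeriv hh v) (contDiff_dirDeriv hh' v)]
    rfl

theorem iterate_dirDeriv_sum {ι : Type*} (s : Finset ι) (c : ι → ℝ) {h : ι → E → F}
    (hh : ∀ a ∈ s, ContDiff ℝ ∞ (h a)) (v : E) (p : ℕ) :
    (dirDeriv v)^[p] (fun x => ∑ a ∈ s, c a • h a x) =
      fun x => ∑ a ∈ s, c a • (dirDeriv v)^[p] (h a) x := by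
  induction p generalizing h with
  | zero => rfl
  | succ p ih =>
    have : dirDeriv v (fun x => ∑ a ∈ s, c a • h a x) =
        fun x => ∑ a ∈ s, c a • dirDeriv v (h a) x := by
      funext x
      change fderiv ℝ (fun x => ∑ a ∈ s, c a • h a x) x v = _
      have hd : ∀ a ∈ s, DifferentiableAt ℝ (h a) x := fun a ha =>
        ((hh a ha).differentiable (by simp)) x
      rw [fderiv_fun_sum fun a ha => (hd a ha).fun_const_smul (c a), sum_apply]
      refine Finset.sum_congr rfl fun a ha => ?_
      rw [fderiv_fun_const_smul (hd a ha)]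
      rfl
    rw [Function.iterate_succ_apply, this, ih fun a ha => contDiff_dirDeriv (hh a ha) v]
    rfl

/-- Smooth functions that agree on a set with dense interior have the same derivatives there. -/
theorem iterate_dirDeriv_eqOn {B : Set E} (hB : B ⊆ closure (interior B)) (hh : ContDiff ℝ ∞ h)
    (hh' : ContDiff ℝ ∞ h') (he : Set.EqOn h h' B) (v : E) (p : ℕ) :
    Set.EqOn ((dirDeriv v)^[p] h) ((dirDeriv v)^[p] h') B := by
  have h1 := iterate_dirDeriv_congr isOpen_interior (he.mono interior_subset) v p
  exact (h1.closure (contDiff_iterate_dirDeriv hh v p).continuous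
    (contDiff_iterate_dirDeriv hh' v p).continuous).mono hB

end DirDeriv

section Box

open Set

variable {ℓ : ℕ} {h h' : (Fin ℓ → ℝ) → ℂ}

theorem box_subset_closure_interior :
    Icc (0 : Fin ℓ → ℝ) 1 ⊆ closure (interior (Icc (0 : Fin ℓ → ℝ) 1)) := by
  rw [← pi_univ_Icc, interior_pi_set finite_univ, closure_pi_set]
  refine pi_mono fun i _ => ?_
  rw [interior_Icc, closure_Ioo (by simp)]

theorem update_zero_mem_box {σ : Fin ℓ → ℝ} (hσ : σ ∈ Icc (0 : Fin ℓ → ℝ) 1) (j : Fin ℓ) {t : ℝ}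
    (h0 : 0 ≤ t) (h1 : t ≤ 1) : Function.update σ j t ∈ Icc (0 : Fin ℓ → ℝ) 1 := by
  constructor
  · intro k
    by_cases hk : k = j
    · subst hk; simpa using h0
    · simpa [hk] using hσ.1 k
  · intro k
    by_cases hk : k = j
    · subst hk; simpa using h1
    · simpa [hk] using hσ.2 k

theorem update_eq_add_smul (σ : Fin ℓ → ℝ) (j : Fin ℓ) (t : ℝ) :
    Function.update σ j t = Function.update σ j 0 + t • Pi.single j 1 := by
  ext k
  by_cases hk : k = j
  · subst hk; simp
  · simp [hk]

/-- The Taylor polynomial of degree `< n` in the variable `σ_j` at `σ_j = 0`. -/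
noncomputable def taylorOp (j : Fin ℓ) (n : ℕ) (h : (Fin ℓ → ℝ) → ℂ) (σ : Fin ℓ → ℝ) : ℂ :=
  ∑ m ∈ Finset.range n, (σ j ^ m / (m.factorial : ℝ)) •
    (dirDeriv (Pi.single j (1 : ℝ)))^[m] h (Function.update σ j 0)

/-- The remainder of the Taylor expansion in the variable `σ_j` at `σ_j = 0`. -/
noncomputable def remOp (j : Fin ℓ) (n : ℕ) (h : (Fin ℓ → ℝ) → ℂ) (σ : Fin ℓ → ℝ) : ℂ :=
  h σ - taylorOp j n h σ

theorem contDiff_taylorOp (hh : ContDiff ℝ ∞ h) (j : Fin ℓ) (n : ℕ) :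
    ContDiff ℝ ∞ (taylorOp j n h) := by
  have hu : ContDiff ℝ ∞ fun σ : Fin ℓ → ℝ => Function.update σ j 0 := by
    refine contDiff_pi.2 fun k => ?_
    by_cases hk : k = j
    · subst hk; simpa using contDiff_const
    · simpa [hk] using contDiff_apply ℝ ℝ k
  refine ContDiff.sum fun m _ => ContDiff.fun_smul ?_ ((contDiff_iterate_dirDeriv hh _ m).comp hu)
  exact ((contDiff_apply ℝ ℝ j).pow m).div_const _

theorem contDiff_remOp (hh : ContDiff ℝ ∞ h) (j : Fin ℓ) (n : ℕ) : ContDiff ℝ ∞ (remOp j n h) :=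
  hh.sub (contDiff_taylorOp hh j n)

theorem dirDeriv_taylorOp (hh : ContDiff ℝ ∞ h) {j k : Fin ℓ} (hk : k ≠ j) (n : ℕ) :
    dirDeriv (Pi.single k (1 : ℝ)) (taylorOp j n h) =
      taylorOp j n (dirDeriv (Pi.single k (1 : ℝ)) h) := by
  funext σ
  rw [dirDeriv_eq_deriv (contDiff_taylorOp hh j n)]
  have h1 : ∀ t : ℝ, taylorOp j n h (σ + t • Pi.single k 1) =
      ∑ m ∈ Finset.range n, (σ j ^ m / (m.factorial : ℝ)) •
        (dirDeriv (Pi.single j (1 : ℝ)))^[m] h (Function.update σ j 0 + t • Pi.single k 1) := by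
    intro t
    have e1 : (σ + t • (Pi.single k 1 : Fin ℓ → ℝ)) j = σ j := by simp [hk.symm]
    have e2 : Function.update (σ + t • (Pi.single k 1 : Fin ℓ → ℝ)) j 0 =
        Function.update σ j 0 + t • Pi.single k 1 := by
      ext i
      by_cases hi : i = j
      · subst hi; simp [hk.symm]
      · simp [hi]
    rw [taylorOp, e1, e2]
  simp only [h1]
  have h2 : HasDerivAt (fun t : ℝ => ∑ m ∈ Finset.range n, (σ j ^ m / (m.factorial : ℝ)) •
        (dirDeriv (Pi.single j (1 : ℝ)))^[m] h (Function.update σ j 0 + t • Pi.single k 1))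
      (∑ m ∈ Finset.range n, (σ j ^ m / (m.factorial : ℝ)) • dirDeriv (Pi.single k (1 : ℝ))
        ((dirDeriv (Pi.single j (1 : ℝ)))^[m] h)
          (Function.update σ j 0 + (0 : ℝ) • Pi.single k 1)) 0 :=
    HasDerivAt.fun_sum fun m _ =>
      (hasDerivAt_line (contDiff_iterate_dirDeriv hh _ m) _ _ 0).fun_const_smul _
  rw [h2.deriv, taylorOp]
  simp only [zero_smul, add_zero, dirDeriv_iterate_comm hh]

theorem iterate_dirDeriv_remOp (hh : ContDiff ℝ ∞ h) {j k : Fin ℓ} (hk : k ≠ j) (n p : ℕ) :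
    (dirDeriv (Pi.single k (1 : ℝ)))^[p] (remOp j n h) =
      remOp j n ((dirDeriv (Pi.single k (1 : ℝ)))^[p] h) := by
  induction p generalizing h with
  | zero => rfl
  | succ p ih =>
    rw [Function.iterate_succ_apply, Function.iterate_succ_apply, ← ih (contDiff_dirDeriv hh _)]
    congr 1
    funext σ
    have := iterate_dirDeriv_sub hh (contDiff_taylorOp hh j n) (Pi.single k (1 : ℝ)) 1 σ
    simp only [Function.iterate_one] at this
    change dirDeriv _ (fun σ => h σ - taylorOp j n h σ) σ = _
    rw [this, dirDeriv_taylorOp hh hk]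
    rfl

/-- The Taylor polynomial in terms of derivatives of a function of one variable. -/
theorem taylorOp_eq_iteratedDeriv (hh : ContDiff ℝ ∞ h) (j : Fin ℓ) (n : ℕ) (σ : Fin ℓ → ℝ) :
    taylorOp j n h σ = ∑ m ∈ Finset.range n, (σ j ^ m / (m.factorial : ℝ)) •
      iteratedDeriv m (fun t : ℝ => h (Function.update σ j t)) 0 := by
  rw [taylorOp]
  refine Finset.sum_congr rfl fun m _ => ?_
  have : (fun t : ℝ => h (Function.update σ j t)) =
      fun t => h (Function.update σ j 0 + t • Pi.single j 1) := by
    funext t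
    rw [← update_eq_add_smul]
  rw [this, iteratedDeriv_line hh]
  simp

/-- Taylor's estimate in one of the variables. -/
theorem norm_remOp_le (hh : ContDiff ℝ ∞ h) (j : Fin ℓ) (n : ℕ) {C : ℝ}
    (hC : ∀ σ ∈ Icc (0 : Fin ℓ → ℝ) 1, ‖(dirDeriv (Pi.single j (1 : ℝ)))^[n] h σ‖ ≤ C)
    {σ : Fin ℓ → ℝ} (hσ : σ ∈ Icc (0 : Fin ℓ → ℝ) 1) : ‖remOp j n h σ‖ ≤ C := by
  rcases n with - | n
  · simpa [remOp, taylorOp] using hC σ hσ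
  have hC0 : 0 ≤ C := (norm_nonneg _).trans (hC σ hσ)
  set ψ : ℝ → ℂ := fun t => h (Function.update σ j 0 + t • Pi.single j 1) with hψ
  have hψs : ContDiff ℝ ∞ ψ := hh.comp (by fun_prop)
  have hud := uniqueDiffOn_Icc (zero_lt_one' ℝ)
  have hit : ∀ p, ∀ t ∈ Icc (0 : ℝ) 1, iteratedDerivWithin p ψ (Icc 0 1) t =
      (dirDeriv (Pi.single j (1 : ℝ)))^[p] h (Function.update σ j t) := fun p t ht => by
    rw [iteratedDerivWithin_eq_iteratedDeriv hud
      (hψs.of_le (by exact_mod_cast le_top)).contDiffAt ht, iteratedDeriv_line hh,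
      update_eq_add_smul σ j t]
  have hσj : σ j ∈ Icc (0 : ℝ) 1 := ⟨hσ.1 j, hσ.2 j⟩
  have hb := taylor_mean_remainder_bound (f := ψ) (n := n) (C := C) zero_le_one
    (hψs.of_le (by exact_mod_cast le_top)).contDiffOn hσj fun t ht => by
      rw [hit _ t ht]
      exact hC _ (update_zero_mem_box hσ j ht.1 ht.2)
  have h1 : ψ (σ j) = h σ := by
    rw [hψ]
    simp only
    rw [← update_eq_add_smul, Function.update_eq_self]
  have h2 : taylorWithinEval ψ n (Icc 0 1) 0 (σ j) = taylorOp j (n + 1) h σ := by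
    rw [taylor_within_apply, taylorOp]
    refine Finset.sum_congr rfl fun m _ => ?_
    rw [hit m 0 ⟨le_rfl, zero_le_one⟩, sub_zero, div_eq_inv_mul]
  rw [h1, h2] at hb
  refine hb.trans ?_
  rw [mul_div_assoc]
  refine mul_le_of_le_one_right hC0 ?_
  rw [sub_zero, div_le_one (by positivity)]
  exact (pow_le_one₀ hσj.1 hσj.2).trans (by exact_mod_cast Nat.factorial_pos n)

/-- The composite of the operators `remOp j (N j)` for `j` in a list. -/
noncomputable def remList (N : Fin ℓ → ℕ) (L : List (Fin ℓ)) (h : (Fin ℓ → ℝ) → ℂ) :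
    (Fin ℓ → ℝ) → ℂ :=
  L.foldr (fun j => remOp j (N j)) h

theorem contDiff_remList (N : Fin ℓ → ℕ) (L : List (Fin ℓ)) (hh : ContDiff ℝ ∞ h) :
    ContDiff ℝ ∞ (remList N L h) := by
  induction L with
  | nil => exact hh
  | cons j L ih => exact contDiff_remOp ih j (N j)

theorem iterate_dirDeriv_remList (N : Fin ℓ → ℕ) {L : List (Fin ℓ)} (hh : ContDiff ℝ ∞ h)
    {k : Fin ℓ} (hk : k ∉ L) (p : ℕ) :
    (dirDeriv (Pi.single k (1 : ℝ)))^[p] (remList N L h) =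
      remList N L ((dirDeriv (Pi.single k (1 : ℝ)))^[p] h) := by
  induction L with
  | nil => rfl
  | cons j L ih =>
    rw [List.mem_cons, not_or] at hk
    change (dirDeriv (Pi.single k (1 : ℝ)))^[p] (remOp j (N j) (remList N L h)) = _
    rw [iterate_dirDeriv_remOp (contDiff_remList N L hh) hk.1, ih hk.2]
    rfl

/-- The multiple Taylor remainder is bounded by the mixed derivative of order `N`. -/
theorem norm_remList_le (N : Fin ℓ → ℕ) {L : List (Fin ℓ)} (hL : L.Nodup) (hh : ContDiff ℝ ∞ h)
    {C : ℝ} (hC : ∀ σ ∈ Icc (0 : Fin ℓ → ℝ) 1,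
      ‖L.foldl (fun h j => (dirDeriv (Pi.single j (1 : ℝ)))^[N j] h) h σ‖ ≤ C)
    {σ : Fin ℓ → ℝ} (hσ : σ ∈ Icc (0 : Fin ℓ → ℝ) 1) : ‖remList N L h σ‖ ≤ C := by
  induction L generalizing h σ with
  | nil => exact hC σ hσ
  | cons j L ih =>
    rw [List.nodup_cons] at hL
    refine norm_remOp_le (contDiff_remList N L hh) j (N j) (fun τ hτ => ?_) hσ
    rw [iterate_dirDeriv_remList N hh hL.1]
    exact ih hL.2 (contDiff_iterate_dirDeriv hh _ _) hC hτ

/-- Inclusion-exclusion: if the Taylor polynomial in the variable `σ_j` takes `u_J` to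
`u_{J ∪ {j}}`, then the multiple remainder is the alternating sum of the `u_J`. -/
theorem remList_eq_sum {N : Fin ℓ → ℕ} {u : Finset (Fin ℓ) → (Fin ℓ → ℝ) → ℂ}
    (hu : ∀ J, ContDiff ℝ ∞ (u J))
    (hT : ∀ J, ∀ j ∉ J, EqOn (taylorOp j (N j) (u J)) (u (insert j J)) (Icc 0 1))
    {L : List (Fin ℓ)} (hL : L.Nodup) :
    EqOn (remList N L (u ∅)) (fun σ => ∑ J ∈ L.toFinset.powerset, (-1 : ℝ) ^ J.card • u J σ)
      (Icc 0 1) := by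
  induction L with
  | nil => intro σ _; simp [remList]
  | cons j L ih =>
    rw [List.nodup_cons] at hL
    have hjL : j ∉ L.toFinset := by simpa using hL.1
    intro σ hσ
    have hs := ih hL.2
    have hsmooth : ContDiff ℝ ∞ fun σ => ∑ J ∈ L.toFinset.powerset, (-1 : ℝ) ^ J.card • u J σ :=
      ContDiff.sum fun J _ => (hu J).const_smul _
    have hσ0 := update_zero_mem_box hσ j le_rfl zero_le_one
    have h1 : taylorOp j (N j) (remList N L (u ∅)) σ =
        ∑ J ∈ L.toFinset.powerset, (-1 : ℝ) ^ J.card • taylorOp j (N j) (u J) σ := by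
      simp only [taylorOp, Finset.smul_sum]
      rw [Finset.sum_comm]
      refine Finset.sum_congr rfl fun m _ => ?_
      rw [iterate_dirDeriv_eqOn box_subset_closure_interior (contDiff_remList N L (hu ∅)) hsmooth hs
        _ m hσ0, iterate_dirDeriv_sum _ _ fun J _ => hu J, Finset.smul_sum]
      exact Finset.sum_congr rfl fun J _ => smul_comm _ _ _
    change remList N L (u ∅) σ - taylorOp j (N j) (remList N L (u ∅)) σ = _
    rw [h1, hs hσ]
    simp only
    rw [List.toFinset_cons, Finset.sum_powerset_insert hjL, sub_eq_add_neg,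
      ← Finset.sum_neg_distrib]
    congr 1
    refine Finset.sum_congr rfl fun J hJ => ?_
    have hjJ : j ∉ J := fun h => hjL (Finset.mem_powerset.1 hJ h)
    rw [hT J j hjJ hσ, Finset.card_insert_of_notMem hjJ, pow_succ, mul_neg_one, neg_smul]

end Box

/-! ### Higher directional derivatives of holomorphic functions -/

section Multinomial

variable {m : ℕ} {U : Set (EuclideanSpace ℂ (Fin m))} {f φ : EuclideanSpace ℂ (Fin m) → ℂ}

/-- The constant coefficient differential operator `p(∂)` applied to `f`. -/
noncomputable def polyDeriv (f : EuclideanSpace ℂ (Fin m) → ℂ) :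
    MvPolynomial (Fin m) ℂ →ₗ[ℂ] EuclideanSpace ℂ (Fin m) → ℂ :=
  (MvPolynomial.basisMonomials (Fin m) ℂ).constr ℂ fun γ => mixedPartial γ f

theorem polyDeriv_monomial (γ : Fin m →₀ ℕ) (c : ℂ) :
    polyDeriv f (MvPolynomial.monomial γ c) = c • mixedPartial γ f := by
  have h : MvPolynomial.monomial γ c = c • MvPolynomial.basisMonomials (Fin m) ℂ γ := by
    rw [MvPolynomial.coe_basisMonomials, MvPolynomial.smul_monomial, smul_eq_mul, mul_one]
  rw [h, map_smul, polyDeriv, Module.Basis.constr_basis]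

theorem differentiableOn_mixedPartial (hU : IsOpen U) (hf : DifferentiableOn ℂ f U)
    (γ : Fin m → ℕ) : DifferentiableOn ℂ (mixedPartial γ f) U := by
  rw [mixedPartial_eq_wordDeriv]
  exact differentiableOn_wordDeriv hU hf _

theorem differentiableOn_polyDeriv (hU : IsOpen U) (hf : DifferentiableOn ℂ f U)
    (p : MvPolynomial (Fin m) ℂ) : DifferentiableOn ℂ (polyDeriv f p) U := by
  induction p using MvPolynomial.induction_on' with
  | monomial γ c =>
    rw [polyDeriv_monomial]
    exact (differentiableOn_mixedPartial hU hf γ).const_smul c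
  | add p q hp hq =>
    rw [map_add]
    exact hp.add hq

theorem pderiv_mixedPartial (hU : IsOpen U) (hf : DifferentiableOn ℂ f U) (i : Fin m)
    (γ : Fin m →₀ ℕ) : Set.EqOn (pderiv i (mixedPartial γ f))
      (mixedPartial (γ + Finsupp.single i 1 : Fin m →₀ ℕ) f) U := by
  rw [mixedPartial_eq_wordDeriv, mixedPartial_eq_wordDeriv, ← wordDeriv_cons]
  refine wordDeriv_perm hU hf (List.perm_iff_count.2 fun k => ?_)
  rw [count_wordOf, List.count_cons, count_wordOf]
  by_cases h : i = k
  · subst h; simp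
  · simp [h]

/-- Differentiation in the direction `y` is multiplication of the symbol by the linear form
`∑ y_i X_i`. -/
theorem dirDeriv_polyDeriv (hU : IsOpen U) (hf : DifferentiableOn ℂ f U)
    (y : EuclideanSpace ℂ (Fin m)) (p : MvPolynomial (Fin m) ℂ) :
    Set.EqOn (dirDeriv y (polyDeriv f p))
      (polyDeriv f ((∑ i, MvPolynomial.monomial (Finsupp.single i 1) (y i)) * p)) U := by
  induction p using MvPolynomial.induction_on' with
  | monomial γ c =>
    intro x hx
    have hγ := differentiableOn_mixedPartial hU hf γ
    have hd := differentiableOn_polyDeriv hU hf (MvPolynomial.monomial γ c)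
    rw [dirDeriv_eq_fderiv hU hd y hx]
    simp only [Finset.sum_mul, MvPolynomial.monomial_mul, map_sum, polyDeriv_monomial,
      Finset.sum_apply, Pi.smul_apply, smul_eq_mul]
    rw [fderiv_const_smul (hγ.differentiableAt (hU.mem_nhds hx))]
    conv_lhs => rw [← (EuclideanSpace.basisFun (Fin m) ℂ).sum_repr y]
    rw [map_sum]
    refine Finset.sum_congr rfl fun i _ => ?_
    rw [map_smul, add_comm (Finsupp.single i 1), ← pderiv_mixedPartial hU hf i γ hx,
      pderiv_eq hU hγ i hx]
    simp
    ring
  | add p q hp hq =>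
    intro x hx
    rw [mul_add, map_add, map_add, Pi.add_apply, ← hp hx, ← hq hx]
    change fderiv ℝ (polyDeriv f p + polyDeriv f q) x y = _
    have hd : ∀ p, DifferentiableAt ℝ (polyDeriv f p) x := fun p =>
      ((differentiableOn_polyDeriv hU hf p).differentiableAt (hU.mem_nhds hx)).restrictScalars ℝ
    rw [fderiv_add (hd p) (hd q)]
    rfl

theorem iterate_dirDeriv_polyDeriv (hU : IsOpen U) (hf : DifferentiableOn ℂ f U)
    (y : EuclideanSpace ℂ (Fin m)) (r : ℕ) (p : MvPolynomial (Fin m) ℂ) :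
    Set.EqOn ((dirDeriv y)^[r] (polyDeriv f p))
      (polyDeriv f ((∑ i, MvPolynomial.monomial (Finsupp.single i 1) (y i)) ^ r * p)) U := by
  induction r generalizing p with
  | zero => intro x _; simp
  | succ r ih =>
    rw [Function.iterate_succ_apply, pow_succ, mul_assoc]
    exact (iterate_dirDeriv_congr hU (dirDeriv_polyDeriv hU hf y p) y r).trans (ih _)

/-- The partial derivative `∂^α`, with real derivatives in the directions of the real parts of the
coordinates. -/
noncomputable def realPartial (α : Fin m → ℕ) (φ : EuclideanSpace ℂ (Fin m) → ℂ) :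
    EuclideanSpace ℂ (Fin m) → ℂ :=
  realWordDeriv (wordOf α) φ

theorem contDiff_realPartial (hφ : ContDiff ℝ ∞ φ) (α : Fin m → ℕ) :
    ContDiff ℝ ∞ (realPartial α φ) :=
  contDiff_realWordDeriv hφ _

theorem realPartial_eqOn (hU : IsOpen U) (hf : DifferentiableOn ℂ f U) (h : Set.EqOn φ f U)
    (α : Fin m → ℕ) : Set.EqOn (realPartial α φ) (mixedPartial α f) U := by
  rw [mixedPartial_eq_wordDeriv]
  exact realWordDeriv_eqOn hU hf h _

/-- The multinomial formula for higher directional derivatives. It holds on the closure of the set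
where `φ` is holomorphic. -/
theorem iterate_dirDeriv_realPartial (hU : IsOpen U) (hf : DifferentiableOn ℂ f U)
    (hφ : ContDiff ℝ ∞ φ) (h : Set.EqOn φ f U) {s : Finset (Fin m)}
    {y : EuclideanSpace ℂ (Fin m)} (hy : ∀ i ∉ s, y i = 0) (r : ℕ) (α : Fin m →₀ ℕ) :
    Set.EqOn ((dirDeriv y)^[r] (realPartial α φ))
      (fun x => ∑ γ ∈ Finset.piAntidiag s r,
        (r.factorial * ∏ i ∈ s, y i ^ γ i / ((γ i).factorial : ℂ)) *
          realPartial (α + Finsupp.equivFunOnFinite.symm γ : Fin m →₀ ℕ) φ x) (closure U) := by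
  refine Set.EqOn.closure (fun x hx => ?_)
    (contDiff_iterate_dirDeriv (contDiff_realPartial hφ α) y r).continuous
    (continuous_finsetSum _ fun γ _ => continuous_const.mul (contDiff_realPartial hφ _).continuous)
  have h1 := iterate_dirDeriv_congr hU (realPartial_eqOn hU hf h α) y r hx
  have h2 := iterate_dirDeriv_polyDeriv hU hf y r (MvPolynomial.monomial α 1) hx
  rw [polyDeriv_monomial, one_smul] at h2
  rw [h1, h2]
  have h3 : ∑ i, MvPolynomial.monomial (Finsupp.single i 1) (y i) =
      ∑ i ∈ s, MvPolynomial.monomial (Finsupp.single i 1) (y i) := by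
    symm
    refine Finset.sum_subset (Finset.subset_univ s) fun i _ hi => ?_
    rw [hy i hi, map_zero]
  rw [h3, Finset.sum_pow_eq_sum_piAntidiag, Finset.sum_mul, map_sum, Finset.sum_apply]
  refine Finset.sum_congr rfl fun γ hγ => ?_
  obtain ⟨hsum, hsupp⟩ := Finset.mem_piAntidiag.1 hγ
  have h4 : ∏ i ∈ s, MvPolynomial.monomial (Finsupp.single i 1) (y i) ^ γ i =
      MvPolynomial.monomial (Finsupp.equivFunOnFinite.symm γ) (∏ i ∈ s, y i ^ γ i) := by
    simp only [MvPolynomial.monomial_pow]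
    rw [← MvPolynomial.monomial_sum_prod]
    refine congrArg (fun a => MvPolynomial.monomial a _) ?_
    ext i
    rw [Finsupp.finsetSum_apply]
    by_cases hi : i ∈ s
    · rw [Finset.sum_eq_single i] <;> simp +contextual [hi]
    · have : γ i = 0 := by
        by_contra h0
        exact hi (hsupp i h0)
      rw [Finsupp.equivFunOnFinite_symm_apply_apply, this]
      refine Finset.sum_eq_zero fun k hk => ?_
      have : k ≠ i := fun e => hi (e ▸ hk)
      simp [this]
  have h5 : ((Nat.multinomial s γ : ℕ) : MvPolynomial (Fin m) ℂ) =
      MvPolynomial.monomial 0 (Nat.multinomial s γ : ℂ) := by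
    rw [MvPolynomial.monomial_zero', map_natCast]
  rw [h4, h5, MvPolynomial.monomial_mul, MvPolynomial.monomial_mul, polyDeriv_monomial, zero_add,
    Pi.smul_apply, smul_eq_mul, realPartial_eqOn hU hf h _ hx, mul_one,
    add_comm (Finsupp.equivFunOnFinite.symm γ)]
  congr 1
  have hspec := Nat.multinomial_spec s γ
  rw [hsum] at hspec
  rw [← hspec, Finset.prod_div_distrib]
  have hne : (∏ i ∈ s, ((γ i).factorial : ℂ)) ≠ 0 :=
    Finset.prod_ne_zero_iff.2 fun i _ => by exact_mod_cast (γ i).factorial_ne_zero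
  push_cast
  field_simp

/-- The Taylor coefficients at `0` of `t ^ d ξ(t)` are those of `ξ`, shifted by `d`. -/
theorem iteratedDeriv_pow_mul {ξ : ℝ → ℂ} (hξ : ContDiff ℝ ∞ ξ) (d m : ℕ) :
    iteratedDeriv m (fun t : ℝ => (t : ℂ) ^ d * ξ t) 0 =
      if d ≤ m then (m.factorial : ℂ) / ((m - d).factorial : ℂ) * iteratedDeriv (m - d) ξ 0
      else 0 := by
  have h0 : ∀ k, iteratedDeriv k (fun t : ℝ => (t : ℂ) ^ d) 0 =
      if k = d then (d.factorial : ℂ) else 0 := fun k => by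
    have e : (fun t : ℝ => (t : ℂ) ^ d) = fun t : ℝ => (t ^ d) • (1 : ℂ) := by
      funext t; simp
    rw [e, iteratedDeriv_smul_const (by fun_prop), iteratedDeriv_fun_pow_zero]
    split_ifs <;> simp
  have hp : ContDiff ℝ ∞ fun t : ℝ => (t : ℂ) ^ d := by
    exact Complex.ofRealCLM.contDiff.pow d
  rw [iteratedDeriv_fun_mul (hp.of_le (by exact_mod_cast le_top)).contDiffAt
    (hξ.of_le (by exact_mod_cast le_top)).contDiffAt]
  simp only [h0]
  split_ifs with h
  · rw [Finset.sum_eq_single d]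
    · have h2 : ((m.choose d : ℂ) * d.factorial) = m.factorial / (m - d).factorial := by
        rw [eq_div_iff (by exact_mod_cast (m - d).factorial_ne_zero)]
        exact_mod_cast Nat.choose_mul_factorial_mul_factorial h
      rw [if_pos rfl, h2]
    · intro k _ hk; simp [hk]
    · intro hk; simp at hk; omega
  · rw [Finset.sum_eq_zero]
    intro k hk
    have : k ≠ d := by simp at hk; omega
    simp [this]

end Multinomial

/-! ### Taylor expansions along the multi-scalings -/

section Scaling

variable {n ℓ : ℕ} {I : Fin ℓ → Finset (Fin n)}

theorem contDiff_scale : ContDiff ℝ ∞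
    fun p : (Fin ℓ → ℝ) × EuclideanSpace ℂ (Fin n) => scale I p.1 p.2 := by
  rw [contDiff_piLp 2]
  intro i
  simp only [scale_apply]
  refine ContDiff.mul ?_ ?_
  · have h : ContDiff ℝ ∞ fun p : (Fin ℓ → ℝ) × EuclideanSpace ℂ (Fin n) => p.1 := contDiff_fst
    have h' : ContDiff ℝ ∞ fun p : (Fin ℓ → ℝ) × EuclideanSpace ℂ (Fin n) =>
        ∏ j ∈ Finset.univ.filter (fun j => i ∈ I j), p.1 j :=
      contDiff_prod fun j _ => contDiff_pi.1 h j
    exact Complex.ofRealCLM.contDiff.comp h'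
  · have h : ContDiff ℝ ∞ fun p : (Fin ℓ → ℝ) × EuclideanSpace ℂ (Fin n) => p.2 := contDiff_snd
    exact (contDiff_piLp 2).1 h i

theorem scale_update (σ : Fin ℓ → ℝ) (j : Fin ℓ) (t : ℝ) (z : EuclideanSpace ℂ (Fin n))
    (i : Fin n) : scale I (Function.update σ j t) z i =
      (if i ∈ I j then (t : ℂ) else 1) * scale I (Function.update σ j 1) z i := by
  rw [scale_apply, scale_apply, ← mul_assoc]
  congr 1
  split_ifs with h
  · have hj : j ∈ Finset.univ.filter fun j => i ∈ I j := by simpa using h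
    rw [← Finset.mul_prod_erase _ _ hj, ← Finset.mul_prod_erase _ (Function.update σ j 1) hj,
      Function.update_self, Function.update_self, one_mul, ← Complex.ofReal_mul]
    congr 2
    refine Finset.prod_congr rfl fun k hk => ?_
    rw [Function.update_of_ne (Finset.ne_of_mem_erase hk),
      Function.update_of_ne (Finset.ne_of_mem_erase hk)]
  · rw [one_mul]
    congr 1
    refine Finset.prod_congr rfl fun k hk => ?_
    have : k ≠ j := fun e => h (e ▸ (Finset.mem_filter.1 hk).2)
    rw [Function.update_of_ne this, Function.update_of_ne this]

/-- `σ` with the coordinates in `J` replaced by `0`. -/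
def zeroOn (J : Finset (Fin ℓ)) (σ : Fin ℓ → ℝ) : Fin ℓ → ℝ := fun j => if j ∈ J then 0 else σ j

theorem zeroOn_insert (J : Finset (Fin ℓ)) (j : Fin ℓ) (σ : Fin ℓ → ℝ) :
    zeroOn (insert j J) σ = Function.update (zeroOn J σ) j 0 := by
  funext k
  by_cases hk : k = j
  · subst hk; simp [zeroOn]
  · simp [zeroOn, hk]

theorem zeroOn_update {J : Finset (Fin ℓ)} {j : Fin ℓ} (hj : j ∉ J) (σ : Fin ℓ → ℝ) (t : ℝ) :
    zeroOn J (Function.update σ j t) = Function.update (zeroOn J σ) j t := by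
  funext k
  by_cases hk : k = j
  · subst hk; simp [zeroOn, hj]
  · simp [zeroOn, hk]

variable (I) in
/-- The partial Taylor expansion of `σ ↦ φ(μ(z, σ))` in the variables `σ_j`, `j ∈ J`, of order `N`,
expressed by the partial derivatives of `φ`. -/
noncomputable def scaleTaylor (φ : EuclideanSpace ℂ (Fin n) → ℂ) (z : EuclideanSpace ℂ (Fin n))
    (N : Fin ℓ → ℕ) (J : Finset (Fin ℓ)) (σ : Fin ℓ → ℝ) : ℂ :=
  ∑ b ∈ indicesLT J N, ∑ α ∈ indices I J b, (∏ i, ((α i).factorial : ℂ))⁻¹ *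
    realPartial α φ (scale I (zeroOn J σ) z) * ∏ i, scale I σ z i ^ α i

theorem contDiff_scaleTaylor {φ : EuclideanSpace ℂ (Fin n) → ℂ} (hφ : ContDiff ℝ ∞ φ)
    (z : EuclideanSpace ℂ (Fin n)) (N : Fin ℓ → ℕ) (J : Finset (Fin ℓ)) :
    ContDiff ℝ ∞ (scaleTaylor I φ z N J) := by
  have h0 : ContDiff ℝ ∞ fun σ : Fin ℓ → ℝ => zeroOn J σ := by
    refine contDiff_pi.2 fun k => ?_
    by_cases hk : k ∈ J
    · simpa [zeroOn, hk] using contDiff_const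
    · simpa [zeroOn, hk] using contDiff_apply ℝ ℝ k
  have hs : ContDiff ℝ ∞ fun σ : Fin ℓ → ℝ => scale I σ z :=
    contDiff_scale.comp (contDiff_id.prodMk contDiff_const)
  refine ContDiff.sum fun b _ => ContDiff.sum fun α _ => ContDiff.mul (contDiff_const.mul ?_) ?_
  · exact (contDiff_realPartial hφ α).comp (hs.comp h0)
  · refine contDiff_prod fun i _ => ContDiff.pow ?_ _
    exact ((contDiff_piLp 2).1 hs) i

/-- The exponents for `J ∪ {j}` are those for `J` together with a value of `β_j`. -/
theorem sum_indicesLT_insert {J : Finset (Fin ℓ)} {j : Fin ℓ} (hj : j ∉ J) (N : Fin ℓ → ℕ)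
    (G : (Fin ℓ → ℕ) → ℂ) : ∑ b ∈ indicesLT (insert j J) N, G b =
      ∑ m ∈ Finset.range (N j), ∑ b ∈ indicesLT J N, G (Function.update b j m) := by
  rw [Finset.sum_sigma']
  refine Finset.sum_bij' (fun b _ => ⟨b j, Function.update b j 0⟩)
    (fun x _ => Function.update x.2 j x.1) ?_ ?_ ?_ ?_ ?_
  · intro b hb
    have hb' := Fintype.mem_piFinset.1 hb
    rw [Finset.mem_sigma]
    refine ⟨by simpa using hb' j, Fintype.mem_piFinset.2 fun k => ?_⟩
    by_cases hk : k = j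
    · subst hk; simp [hj]
    · simpa [hk] using hb' k
  · rintro ⟨m, b⟩ hx
    rw [Finset.mem_sigma] at hx
    have hb' := Fintype.mem_piFinset.1 hx.2
    refine Fintype.mem_piFinset.2 fun k => ?_
    by_cases hk : k = j
    · subst hk; simpa using hx.1
    · simpa [hk] using hb' k
  · intro b _; simp
  · rintro ⟨m, b⟩ hx
    rw [Finset.mem_sigma] at hx
    have hb' := Fintype.mem_piFinset.1 hx.2 j
    simp only [hj, if_false, Finset.mem_singleton] at hb'
    simp only [Function.update_self, Function.update_idem]
    rw [← hb', Function.update_eq_self]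
  · intro b _; simp

/-- The values of `σ ↦ μ(z, σ)` on a line in the direction `σ_j`. -/
theorem scale_update_eq_add_smul (τ : Fin ℓ → ℝ) (j : Fin ℓ) (t : ℝ)
    (z : EuclideanSpace ℂ (Fin n)) : scale I (Function.update τ j t) z =
      scale I (Function.update τ j 0) z +
        t • incl (I j) (proj (I j) (scale I (Function.update τ j 1) z)) := by
  ext i
  rw [PiLp.add_apply, PiLp.smul_apply, scale_update, scale_update τ j 0]
  by_cases hi : i ∈ I j
  · rw [if_pos hi, if_pos hi, incl_apply_mem _ _ hi]
    simp
  · rw [if_neg hi, if_neg hi, incl_apply_not_mem _ _ hi]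
    simp

/-- The Taylor expansion in `σ_j` takes the partial Taylor expansion in the variables in `J` to the
one in the variables in `J ∪ {j}`. -/
theorem taylorOp_scaleTaylor {φ : EuclideanSpace ℂ (Fin n) → ℂ} (hφ : ContDiff ℝ ∞ φ)
    {z : EuclideanSpace ℂ (Fin n)} (N : Fin ℓ → ℕ) {J : Finset (Fin ℓ)} {j : Fin ℓ} (hj : j ∉ J)
    {σ : Fin ℓ → ℝ}
    (hmult : ∀ (s : Finset (Fin n)) (y : EuclideanSpace ℂ (Fin n)), (∀ i ∉ s, y i = 0) →
      ∀ (r : ℕ) (α : Fin n →₀ ℕ),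
      (dirDeriv y)^[r] (realPartial α φ) (scale I (zeroOn (insert j J) σ) z) =
        ∑ γ ∈ Finset.piAntidiag s r, (r.factorial * ∏ i ∈ s, y i ^ γ i / ((γ i).factorial : ℂ)) *
          realPartial (α + Finsupp.equivFunOnFinite.symm γ : Fin n →₀ ℕ) φ
            (scale I (zeroOn (insert j J) σ) z)) :
    taylorOp j (N j) (scaleTaylor I φ z N J) σ = scaleTaylor I φ z N (insert j J) σ := by
  -- only the coordinates in `I_j ∖ I_J` vary in `σ_j`, as those in `I_J` are multiplied by `0`
  set s := I j \ union I J with hs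
  set τ := zeroOn J σ with hτ
  set x := scale I (zeroOn (insert j J) σ) z with hx
  have hxτ : x = scale I (Function.update τ j 0) z := by rw [hx, zeroOn_insert]
  set y := incl (I j) (proj (I j) (scale I (Function.update τ j 1) z)) with hy
  set w := scale I (Function.update σ j 1) z with hw
  have hys : ∀ i ∈ s, y i = w i := fun i hi => by
    obtain ⟨hij, hiJ⟩ := Finset.mem_sdiff.1 hi
    rw [hy, incl_apply_mem _ _ hij, proj_apply, hw, scale_apply, scale_apply]
    congr 2
    refine Finset.prod_congr rfl fun k hk => ?_
    have hkJ : k ∉ J := fun h => hiJ (mem_union.2 ⟨k, h, (Finset.mem_filter.1 hk).2⟩)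
    by_cases hkj : k = j
    · subst hkj; simp
    · simp [hkj, hτ, zeroOn, hkJ]
  have hy0 : ∀ i ∉ s, y i = 0 := fun i hi => by
    by_cases hij : i ∈ I j
    · have hiJ : i ∈ union I J := by
        by_contra h
        exact hi (Finset.mem_sdiff.2 ⟨hij, h⟩)
      obtain ⟨k, hk, hik⟩ := mem_union.1 hiJ
      have hkj : k ≠ j := fun e => hj (e ▸ hk)
      rw [hy, incl_apply_mem _ _ hij, proj_apply, scale_apply, Finset.prod_eq_zero (i := k)
        (by simpa using hik) (by simp [hkj, hτ, zeroOn, hk])]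
      simp
    · exact incl_apply_not_mem _ _ hij
  -- powers of the coordinates of `μ(z, σ)` on the line in the direction `σ_j`
  have hmono : ∀ (t : ℝ) (α : Fin n →₀ ℕ), ∏ i, scale I (Function.update σ j t) z i ^ α i =
      (t : ℂ) ^ (∑ i ∈ I j, α i) * ∏ i, w i ^ α i := fun t α => by
    have : ∀ i, scale I (Function.update σ j t) z i ^ α i =
        (if i ∈ I j then (t : ℂ) ^ α i else 1) * w i ^ α i := fun i => by
      rw [scale_update, mul_pow]
      split_ifs <;> simp [hw]
    rw [Finset.prod_congr rfl fun i _ => this i, Finset.prod_mul_distrib, Finset.prod_ite_mem,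
      Finset.univ_inter, Finset.prod_pow_eq_pow_sum]
  have hline : (fun t : ℝ => scaleTaylor I φ z N J (Function.update σ j t)) =
      fun t : ℝ => ∑ b ∈ indicesLT J N, ∑ α ∈ indices I J b,
        ((∏ i, ((α i).factorial : ℂ))⁻¹ * ∏ i, w i ^ α i) *
          ((t : ℂ) ^ (∑ i ∈ I j, α i) * realPartial α φ (x + t • y)) := by
    funext t
    rw [scaleTaylor]
    refine Finset.sum_congr rfl fun b _ => Finset.sum_congr rfl fun α _ => ?_
    rw [hmono, zeroOn_update hj, scale_update_eq_add_smul, ← hτ, ← hxτ]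
    ring
  have hξ : ∀ α : Fin n →₀ ℕ, ContDiff ℝ ∞ fun t : ℝ => realPartial α φ (x + t • y) := fun α =>
    (contDiff_realPartial hφ α).comp (by fun_prop)
  have hpow : ∀ d : ℕ, ContDiff ℝ ∞ fun t : ℝ => (t : ℂ) ^ d := fun d =>
    Complex.ofRealCLM.contDiff.pow d
  have hder : ∀ m, iteratedDeriv m (fun t : ℝ => scaleTaylor I φ z N J (Function.update σ j t)) 0 =
      ∑ b ∈ indicesLT J N, ∑ α ∈ indices I J b,
        ((∏ i, ((α i).factorial : ℂ))⁻¹ * ∏ i, w i ^ α i) *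
          if ∑ i ∈ I j, α i ≤ m then (m.factorial : ℂ) / ((m - ∑ i ∈ I j, α i).factorial : ℂ) *
            (dirDeriv y)^[m - ∑ i ∈ I j, α i] (realPartial α φ) x else 0 := by
    intro m
    have hsm : ∀ α : Fin n →₀ ℕ, ContDiff ℝ ∞ fun t : ℝ =>
        ((∏ i, ((α i).factorial : ℂ))⁻¹ * ∏ i, w i ^ α i) *
          ((t : ℂ) ^ (∑ i ∈ I j, α i) * realPartial α φ (x + t • y)) := fun α =>
      contDiff_const.mul ((hpow _).mul (hξ α))
    rw [hline, iteratedDeriv_fun_sum fun b _ => ((ContDiff.sum fun α _ => hsm α).of_le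
      (by exact_mod_cast le_top)).contDiffAt]
    refine Finset.sum_congr rfl fun b _ => ?_
    rw [iteratedDeriv_fun_sum fun α _ => ((hsm α).of_le (by exact_mod_cast le_top)).contDiffAt]
    refine Finset.sum_congr rfl fun α _ => ?_
    rw [iteratedDeriv_const_mul_field, iteratedDeriv_pow_mul (hξ α),
      iteratedDeriv_line (contDiff_realPartial hφ α)]
    simp
  rw [taylorOp_eq_iteratedDeriv (contDiff_scaleTaylor hφ z N J), scaleTaylor,
    sum_indicesLT_insert hj]
  refine Finset.sum_congr rfl fun m _ => ?_
  rw [hder, Finset.smul_sum]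
  refine Finset.sum_congr rfl fun b _ => ?_
  have hb : ∀ k ∈ J, Function.update b j m k = b k := fun k hk =>
    Function.update_of_ne (ne_of_mem_of_not_mem hk hj) _ _
  rw [sum_indices_insert, indices_congr hb, Finset.smul_sum, Function.update_self]
  refine Finset.sum_congr rfl fun α hα => ?_
  split_ifs with hle
  swap
  · simp
  rw [hmult s y hy0, Finset.mul_sum, Finset.mul_sum, Finset.smul_sum]
  refine Finset.sum_congr rfl fun γ hγ => ?_
  obtain ⟨hsum, hsupp⟩ := Finset.mem_piAntidiag.1 hγ
  have hγ0 : ∀ i ∉ s, γ i = 0 := fun i hi => by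
    by_contra h0
    exact hi (hsupp i h0)
  have hα0 : ∀ i ∈ s, α i = 0 := fun i hi => by
    by_contra h0
    exact (Finset.mem_sdiff.1 hi).2 ((mem_indices.1 hα).1 (Finsupp.mem_support_iff.2 h0))
  have hfac : ∏ i, (((α + Finsupp.equivFunOnFinite.symm γ) i).factorial : ℂ) =
      (∏ i, ((α i).factorial : ℂ)) * ∏ i ∈ s, ((γ i).factorial : ℂ) := by
    rw [Finset.prod_subset (Finset.subset_univ s) fun i _ hi => by rw [hγ0 i hi]; simp,
      ← Finset.prod_mul_distrib]
    refine Finset.prod_congr rfl fun i _ => ?_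
    by_cases hi : i ∈ s
    · simp [hα0 i hi]
    · simp [hγ0 i hi]
  have hdeg : ∑ i ∈ I j, (α + Finsupp.equivFunOnFinite.symm γ) i = m := by
    have h1 : ∑ i ∈ I j, γ i = ∑ i ∈ s, γ i := by
      symm
      exact Finset.sum_subset Finset.sdiff_subset fun i _ hi => hγ0 i hi
    simp only [Finsupp.coe_add, Pi.add_apply, Finsupp.equivFunOnFinite_symm_apply_apply,
      Finset.sum_add_distrib]
    rw [h1, hsum]
    omega
  have hpows : ∏ i, scale I σ z i ^ (α + Finsupp.equivFunOnFinite.symm γ) i =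
      (σ j : ℂ) ^ m * ((∏ i, w i ^ α i) * ∏ i ∈ s, y i ^ γ i) := by
    have h1 := hmono (σ j) (α + Finsupp.equivFunOnFinite.symm γ)
    rw [Function.update_eq_self, hdeg] at h1
    rw [h1]
    congr 1
    rw [Finset.prod_congr (rfl : s = s) fun i hi => by rw [hys i hi],
      Finset.prod_subset (Finset.subset_univ s) fun i _ hi => by rw [hγ0 i hi, pow_zero],
      ← Finset.prod_mul_distrib]
    refine Finset.prod_congr rfl fun i _ => ?_
    simp [pow_add]
  rw [hpows, hfac, Finset.prod_div_distrib, Complex.real_smul, ← hx]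
  have e1 : (m.factorial : ℂ) ≠ 0 := by exact_mod_cast m.factorial_ne_zero
  have e2 : ((m - ∑ i ∈ I j, α i).factorial : ℂ) ≠ 0 := by exact_mod_cast Nat.factorial_ne_zero _
  push_cast
  rw [mul_inv]
  field_simp

end Scaling

/-! ### The blow-up of the multi-scalings -/

section BlowUp

open Set

variable {n ℓ : ℕ} {I : Fin ℓ → Finset (Fin n)}

theorem Admissible.filter_subset_of_parents_empty (hI : Admissible I) {b : Fin ℓ}
    (h : parents I b = ∅) : (Finset.univ.filter fun j => I b ⊆ I j) = {b} := by
  ext j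
  simp only [Finset.mem_filter, Finset.mem_univ, true_and, Finset.mem_singleton]
  refine ⟨fun hbj => ?_, fun e => e ▸ subset_rfl⟩
  by_contra hne
  have hss : I b ⊂ I j := hbj.ssubset_of_ne fun e => hne (hI.injective e).symm
  obtain ⟨k, hk, hmin⟩ := Finset.exists_min_image (Finset.univ.filter fun k => I b ⊂ I k)
    (fun k => (I k).card) ⟨j, by simpa⟩
  simp only [Finset.mem_filter, Finset.mem_univ, true_and] at hk hmin
  have : k ∈ parents I b := by
    rw [mem_parents, mem_children]
    refine ⟨hk, ?_⟩
    rintro ⟨m, hm, hbm⟩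
    exact absurd (hmin m hbm) (by simpa using Finset.card_lt_card hm)
  rw [h] at this
  simp at this

theorem Admissible.filter_subset_of_mem_parents (hI : Admissible I) {b k : Fin ℓ}
    (h : k ∈ parents I b) : (Finset.univ.filter fun j => I b ⊆ I j) =
      insert b (Finset.univ.filter fun j => I k ⊆ I j) := by
  rw [mem_parents, mem_children] at h
  ext j
  simp only [Finset.mem_filter, Finset.mem_univ, true_and, Finset.mem_insert]
  constructor
  · intro hbj
    by_cases hj : j = b
    · exact Or.inl hj
    right
    have hss : I b ⊂ I j := hbj.ssubset_of_ne fun e => hj (hI.injective e).symm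
    by_cases hjk : j = k
    · exact hjk ▸ subset_rfl
    rcases hI.nested j k hjk with h' | h' | h'
    · exact absurd ⟨j, h', hss⟩ h.2
    · exact h'.subset
    · obtain ⟨i, hi⟩ := hI.hat_nonempty b
      exact absurd (h.1.subset (hat_subset b hi))
        (Finset.disjoint_left.1 h' (hbj (hat_subset b hi)))
  · rintro (rfl | hkj)
    · exact subset_rfl
    · exact h.1.subset.trans hkj

/-- The product of the ratios along the chain of the index sets containing `I_b` telescopes. -/
theorem MultiCone.prod_ratio (hI : Admissible I) {S : MultiCone I}
    {z : EuclideanSpace ℂ (Fin n)} (hz : z ∈ S.carrier) (b : Fin ℓ) :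
    ∏ j ∈ Finset.univ.filter (fun j => I b ⊆ I j), ratio I j z = ‖proj (hat I b) z‖ := by
  induction hk : (Finset.univ.filter fun j => I b ⊆ I j).card using Nat.strong_induction_on
    generalizing b with
  | _ k ih =>
  rcases hI.parents_eq_empty_or_singleton b with h | ⟨p, h, hbp⟩
  · rw [hI.filter_subset_of_parents_empty h, Finset.prod_singleton, ratio, h, Finset.prod_empty,
      div_one]
  · have hp : p ∈ parents I b := by rw [h]; exact Finset.mem_singleton_self p
    have hb : b ∉ Finset.univ.filter fun j => I p ⊆ I j := by
      simpa using hbp.not_subset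
    have hf := hI.filter_subset_of_mem_parents hp
    rw [hf, Finset.card_insert_of_notMem hb] at hk
    rw [hf, Finset.prod_insert hb, ih _ (by omega) p rfl, ratio, h, Finset.prod_singleton,
      div_mul_cancel₀ _ (norm_proj_pos hI hz p).ne']

variable (I) in
/-- The point `z` with the coordinates in each `Î_b` divided by `|z_{Î_b}|`. -/
noncomputable def normalized (z : EuclideanSpace ℂ (Fin n)) : EuclideanSpace ℂ (Fin n) :=
  WithLp.toLp 2 fun i =>
    z i / ((∏ b ∈ Finset.univ.filter (fun b => i ∈ hat I b), ‖proj (hat I b) z‖ : ℝ) : ℂ)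

theorem normalized_apply (z : EuclideanSpace ℂ (Fin n)) (i : Fin n) : normalized I z i =
    z i / ((∏ b ∈ Finset.univ.filter (fun b => i ∈ hat I b), ‖proj (hat I b) z‖ : ℝ) : ℂ) := rfl

theorem Admissible.filter_mem_hat (hI : Admissible I) {i : Fin n} {b : Fin ℓ} (hb : i ∈ hat I b) :
    (Finset.univ.filter fun b => i ∈ hat I b) = {b} := by
  ext k
  simp only [Finset.mem_filter, Finset.mem_univ, true_and, Finset.mem_singleton]
  exact ⟨fun h => hI.eq_of_mem_hat h hb, fun e => e ▸ hb⟩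

theorem filter_mem_hat_of_rest {i : Fin n} (hi : i ∈ rest I) :
    (Finset.univ.filter fun b => i ∈ hat I b) = ∅ := by
  ext k
  simpa using fun h => mem_rest.1 hi k (hat_subset k h)

/-- The point `μ(z, σ)` is obtained from a point `z̃` in a bounded set by scaling with the ratios. -/
theorem MultiCone.scale_ratio_normalized (hI : Admissible I) {S : MultiCone I}
    {z : EuclideanSpace ℂ (Fin n)} (hz : z ∈ S.carrier) (σ : Fin ℓ → ℝ) :
    scale I (fun j => ratio I j z * σ j) (normalized I z) = scale I σ z := by
  ext i
  rw [scale_apply, scale_apply, normalized_apply, Finset.prod_mul_distrib]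
  rcases rest_or_hat (I := I) i with hi | ⟨b, hb⟩
  · have : (Finset.univ.filter fun j => i ∈ I j) = ∅ := by
      ext k
      simpa using mem_rest.1 hi k
    simp [this, filter_mem_hat_of_rest hi]
  · have : (Finset.univ.filter fun j => i ∈ I j) = Finset.univ.filter fun j => I b ⊆ I j := by
      ext k
      simp [hI.mem_iff_subset hb k]
    rw [this, prod_ratio hI hz, hI.filter_mem_hat hb, Finset.prod_singleton]
    have hne : ((‖proj (hat I b) z‖ : ℝ) : ℂ) ≠ 0 := by
      exact_mod_cast (norm_proj_pos hI hz b).ne'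
    push_cast
    field_simp

/-- The normalized points are bounded: the coordinates in the `Î_b` are at most `1`. -/
theorem norm_normalized_le (hI : Admissible I) (z : EuclideanSpace ℂ (Fin n)) :
    ‖normalized I z‖ ≤ n * max 1 ‖z‖ := by
  refine (norm_le_sum_apply _).trans ?_
  have : ∀ i ∈ Finset.univ, ‖normalized I z i‖ ≤ max 1 ‖z‖ := fun i _ => by
    rw [normalized_apply, norm_div, Complex.norm_real]
    rcases rest_or_hat (I := I) i with hi | ⟨b, hb⟩
    · rw [filter_mem_hat_of_rest hi]
      simpa using Or.inr (PiLp.norm_apply_le z i)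
    · rw [hI.filter_mem_hat hb, Finset.prod_singleton, norm_norm]
      exact (div_le_one_of_le₀ (norm_apply_le_norm_proj hb z) (norm_nonneg _)).trans
        (le_max_left _ _)
  refine (Finset.sum_le_sum this).trans (le_of_eq ?_)
  simp

section Rescaling

variable {E : Type} [NormedAddCommGroup E] [NormedSpace ℝ E] {Ψ : (Fin ℓ → ℝ) × E → ℂ}

/-- Chain rule for the substitution of `ρ_i σ_i` for `σ_i`. -/
theorem iterate_dirDeriv_rescale (hΨ : ContDiff ℝ ∞ Ψ) (ρ : Fin ℓ → ℝ) (x : E) (j : Fin ℓ)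
    (k : ℕ) (c : ℝ) :
    (dirDeriv (Pi.single j (1 : ℝ)))^[k]
        (fun σ : Fin ℓ → ℝ => c • Ψ (fun i => ρ i * σ i, x)) =
      fun σ => (c * ρ j ^ k) •
        (dirDeriv ((Pi.single j (1 : ℝ) : Fin ℓ → ℝ), (0 : E)))^[k] Ψ (fun i => ρ i * σ i, x) := by
  induction k generalizing Ψ c with
  | zero => simp
  | succ k ih =>
    have hs : ContDiff ℝ ∞ fun σ : Fin ℓ → ℝ => c • Ψ (fun i => ρ i * σ i, x) :=
      (hΨ.comp ((contDiff_pi.2 fun i => contDiff_const.mul (contDiff_apply ℝ ℝ i)).prodMk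
        contDiff_const)).const_smul c
    have h1 : dirDeriv (Pi.single j (1 : ℝ)) (fun σ : Fin ℓ → ℝ => c • Ψ (fun i => ρ i * σ i, x)) =
        fun σ => (c * ρ j) •
          dirDeriv ((Pi.single j (1 : ℝ) : Fin ℓ → ℝ), (0 : E)) Ψ (fun i => ρ i * σ i, x) := by
      funext σ
      rw [dirDeriv_eq_deriv hs]
      have h2 : (fun t : ℝ => c • Ψ (fun i => ρ i * (σ + t • (Pi.single j 1 : Fin ℓ → ℝ)) i, x)) =
          fun t => c • Ψ ((fun i => ρ i * σ i, x) +
            t • (ρ j • ((Pi.single j (1 : ℝ) : Fin ℓ → ℝ), (0 : E)))) := by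
        funext t
        congr 2
        refine Prod.ext ?_ (by simp)
        funext i
        by_cases hi : i = j
        · subst hi; simp; ring
        · simp [hi]
      rw [h2, ((hasDerivAt_line hΨ _ _ 0).fun_const_smul c).deriv, zero_smul, add_zero, mul_smul]
      congr 1
      exact map_smul _ _ _
    rw [Function.iterate_succ_apply, h1, ih (contDiff_dirDeriv hΨ _)]
    funext σ
    rw [Function.iterate_succ_apply, pow_succ', mul_assoc]

theorem foldl_dirDeriv_rescale (hΨ : ContDiff ℝ ∞ Ψ) (ρ : Fin ℓ → ℝ) (x : E) (N : Fin ℓ → ℕ)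
    (L : List (Fin ℓ)) (c : ℝ) :
    L.foldl (fun h j => (dirDeriv (Pi.single j (1 : ℝ)))^[N j] h)
        (fun σ : Fin ℓ → ℝ => c • Ψ (fun i => ρ i * σ i, x)) =
      fun σ => (c * (L.map fun j => ρ j ^ N j).prod) •
        L.foldl (fun h j => (dirDeriv ((Pi.single j (1 : ℝ) : Fin ℓ → ℝ), (0 : E)))^[N j] h) Ψ
          (fun i => ρ i * σ i, x) := by
  induction L generalizing Ψ c with
  | nil => simp
  | cons j L ih =>
    rw [List.foldl_cons, iterate_dirDeriv_rescale hΨ, ih (contDiff_iterate_dirDeriv hΨ _ _)]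
    funext σ
    rw [List.map_cons, List.prod_cons, List.foldl_cons, mul_assoc]

theorem contDiff_foldl_dirDeriv (hΨ : ContDiff ℝ ∞ Ψ) (N : Fin ℓ → ℕ) (L : List (Fin ℓ)) :
    ContDiff ℝ ∞ (L.foldl (fun h j =>
      (dirDeriv ((Pi.single j (1 : ℝ) : Fin ℓ → ℝ), (0 : E)))^[N j] h) Ψ) := by
  induction L generalizing Ψ with
  | nil => exact hΨ
  | cons j L ih => exact ih (contDiff_iterate_dirDeriv hΨ _ _)

end Rescaling

/-- The mixed derivative of order `N` of `σ ↦ φ(μ(z, σ))` on the unit box is bounded by the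
monomial of order `N` in the ratios, uniformly for `z` in a multi-cone. -/
theorem MultiCone.norm_foldl_dirDeriv_scale_le (hI : Admissible I) {S : MultiCone I}
    (hS : IsCompact (closure S.U)) {φ : EuclideanSpace ℂ (Fin n) → ℂ} (hφ : ContDiff ℝ ∞ φ)
    (N : Fin ℓ → ℕ) : ∃ C, ∀ z ∈ S.carrier, ∀ σ ∈ Icc (0 : Fin ℓ → ℝ) 1,
      ‖(List.finRange ℓ).foldl (fun h j => (dirDeriv (Pi.single j (1 : ℝ)))^[N j] h)
        (fun σ => φ (scale I σ z)) σ‖ ≤ C * ∏ j, ratio I j z ^ N j := by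
  obtain ⟨R, hR⟩ := hS.isBounded.exists_norm_le
  let Ψ : (Fin ℓ → ℝ) × EuclideanSpace ℂ (Fin n) → ℂ := fun p => φ (scale I p.1 p.2)
  have hΨ : ContDiff ℝ ∞ Ψ := hφ.comp contDiff_scale
  let D := (List.finRange ℓ).foldl (fun h j =>
    (dirDeriv ((Pi.single j (1 : ℝ) : Fin ℓ → ℝ), (0 : EuclideanSpace ℂ (Fin n))))^[N j] h) Ψ
  have hD : Continuous D := (contDiff_foldl_dirDeriv hΨ N _).continuous
  let M : Fin ℓ → ℝ := fun j => max S.ε (S.radius j)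
  obtain ⟨C, hC⟩ := ((isCompact_Icc (a := (0 : Fin ℓ → ℝ)) (b := M)).prod
    (isCompact_closedBall (0 : EuclideanSpace ℂ (Fin n)) (n * max 1 R))).exists_bound_of_continuousOn
      hD.continuousOn
  refine ⟨C, fun z hz σ hσ => ?_⟩
  have hρ := fun j => ratio_pos hI hz j
  have h1 : (fun σ => φ (scale I σ z)) =
      fun σ : Fin ℓ → ℝ => (1 : ℝ) • Ψ (fun j => ratio I j z * σ j, normalized I z) := by
    funext σ
    simp only [Ψ, one_smul, scale_ratio_normalized hI hz]
  rw [h1, foldl_dirDeriv_rescale hΨ, one_mul, norm_smul, ← Fin.prod_univ_def,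
    Real.norm_of_nonneg (Finset.prod_nonneg fun j _ => pow_nonneg (hρ j).le _), mul_comm]
  refine mul_le_mul_of_nonneg_right (hC _ ⟨⟨fun j => ?_, fun j => ?_⟩, ?_⟩)
    (Finset.prod_nonneg fun j _ => pow_nonneg (hρ j).le _)
  · exact mul_nonneg (hρ j).le (hσ.1 j)
  · exact (mul_le_of_le_one_right (hρ j).le (hσ.2 j)).trans (ratio_le hI hz j)
  · rw [mem_closedBall_zero_iff]
    refine (norm_normalized_le hI z).trans ?_
    gcongr
    exact hR z (subset_closure hz.1)

end BlowUp

/-! ### Boundary values and the multi-asymptotic expansion -/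

section BoundaryValues

variable {m : ℕ} {U : Set (EuclideanSpace ℂ (Fin m))} {f φ : EuclideanSpace ℂ (Fin m) → ℂ}

/-- If a smooth function is holomorphic on an open set, then its real derivative is complex linear
also at the boundary points. -/
theorem fderiv_I_smul (hU : IsOpen U) (hf : DifferentiableOn ℂ f U) (hφ : ContDiff ℝ ∞ φ)
    (h : Set.EqOn φ f U) (v : EuclideanSpace ℂ (Fin m)) :
    Set.EqOn (fun x => fderiv ℝ φ x (Complex.I • v)) (fun x => Complex.I * fderiv ℝ φ x v)
      (closure U) := by
  have hc : ∀ v, Continuous fun x => fderiv ℝ φ x v := fun v => (contDiff_dirDeriv hφ v).continuous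
  refine Set.EqOn.closure (fun x hx => ?_) (hc _) (continuous_const.mul (hc _))
  have h1 : ∀ v, fderiv ℝ φ x v = fderiv ℂ f x v := fun v =>
    (dirDeriv_congr hU h v hx).trans (dirDeriv_eq_fderiv hU hf v hx)
  simp only [h1, map_smul, smul_eq_mul]

/-- The Cauchy-Riemann equations: a real differentiable function with complex linear derivative is
complex differentiable. -/
theorem differentiableAt_complex_of_I_smul {E : Type} [NormedAddCommGroup E] [NormedSpace ℂ E]
    {g : E → ℂ} {x : E} {g' : E →L[ℝ] ℂ} (hg : HasFDerivAt g g' x)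
    (hI : ∀ v, g' (Complex.I • v) = Complex.I * g' v) : DifferentiableAt ℂ g x := by
  let L : E →L[ℂ] ℂ :=
    { toFun := g'
      map_add' := g'.map_add
      map_smul' := fun c v => by
        have h1 : ∀ (r : ℝ) (w : E), g' ((r : ℂ) • w) = r * g' w := fun r w => by
          rw [Complex.coe_smul, map_smul, Complex.real_smul]
        conv_lhs => rw [← Complex.re_add_im c, add_smul, mul_smul, map_add, h1, h1, hI]
        conv_rhs => rw [← Complex.re_add_im c]
        simp only [RingHom.id_apply, smul_eq_mul]
        ring
      cont := g'.cont }
  have : HasFDerivAt g L x := hasFDerivAt_of_restrictScalars ℝ hg (by ext v; rfl)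
  exact this.differentiableAt

end BoundaryValues

section Expansion

open Set

variable {n ℓ : ℕ} {I : Fin ℓ → Finset (Fin n)} {S : MultiCone I}
  {f : EuclideanSpace ℂ (Fin n) → ℂ}

/-- The multi-cones properly contained in `S` form a directed family. -/
theorem MultiCone.exists_common (hI : Admissible I) {S' S'' : MultiCone I}
    (h' : S'.ProperlyContained S) (h'' : S''.ProperlyContained S) :
    ∃ T : MultiCone I, T.ProperlyContained S ∧ S'.carrier ⊆ T.carrier ∧
      S''.carrier ⊆ T.carrier := by
  obtain ⟨s, hs, hsS, hcof, -⟩ := exists_exhaustion hI S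
  obtain ⟨k, hk⟩ := hcof S' h'
  obtain ⟨l, hl⟩ := hcof S'' h''
  refine ⟨s (max k l + 1), hsS _, ?_, ?_⟩
  · exact (hk.carrier_subset hI).trans ((hs k _ (by omega)).carrier_subset hI)
  · exact (hl.carrier_subset hI).trans ((hs l _ (by omega)).carrier_subset hI)

/-- The derivatives of the smooth extensions define boundary values of the derivatives of `f` that
do not depend on the extension. -/
theorem SmoothlyExtendable.exists_boundaryValues (hI : Admissible I)
    (hf : DifferentiableOn ℂ f S.carrier) (h : SmoothlyExtendable S f) :
    ∃ G : (Fin n →₀ ℕ) → EuclideanSpace ℂ (Fin n) → ℂ,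
      ∀ S' : MultiCone I, S'.ProperlyContained S → ∃ φ, ContDiff ℝ ∞ φ ∧ EqOn φ f S'.carrier ∧
        ∀ α : Fin n →₀ ℕ, EqOn (G α) (realPartial α φ) (closure S'.carrier) := by
  classical
  choose φ hφ hφf using h
  have key : ∀ (T S' : MultiCone I) (hT : T.ProperlyContained S) (h' : S'.ProperlyContained S),
      S'.carrier ⊆ T.carrier → ∀ α : Fin n →₀ ℕ, EqOn (realPartial α (φ S' h'))
        (realPartial α (φ T hT)) (closure S'.carrier) := by
    intro T S' hT h' hsub α
    have hf' := hf.mono (h'.carrier_subset hI)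
    have h1 := realPartial_eqOn S'.isOpen_carrier hf' (hφf S' h') α
    have h2 := realPartial_eqOn S'.isOpen_carrier hf' ((hφf T hT).mono hsub) α
    exact (h1.trans h2.symm).closure (contDiff_realPartial (hφ S' h') α).continuous
      (contDiff_realPartial (hφ T hT) α).continuous
  let G : (Fin n →₀ ℕ) → EuclideanSpace ℂ (Fin n) → ℂ := fun α x =>
    if hx : ∃ S' : MultiCone I, ∃ _ : S'.ProperlyContained S, x ∈ closure S'.carrier then
      realPartial α (φ hx.choose hx.choose_spec.choose) x else 0
  refine ⟨G, fun S' h' => ⟨φ S' h', hφ S' h', hφf S' h', fun α x hx => ?_⟩⟩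
  have hex : ∃ S' : MultiCone I, ∃ _ : S'.ProperlyContained S, x ∈ closure S'.carrier := ⟨S', h', hx⟩
  have hG : G α x = realPartial α (φ hex.choose hex.choose_spec.choose) x := dif_pos hex
  obtain ⟨T, hT, hs', hs''⟩ := MultiCone.exists_common hI h' hex.choose_spec.choose
  rw [hG, key T _ hT _ hs'' α hex.choose_spec.choose_spec, key T S' hT h' hs' α hx]

/-- The boundary values of the derivatives are holomorphic on the faces, by the Cauchy-Riemann
equations in the closure of the multi-cones. -/
theorem isTotalFamily_boundaryValues (hI : Admissible I) (hf : DifferentiableOn ℂ f S.carrier)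
    {G : (Fin n →₀ ℕ) → EuclideanSpace ℂ (Fin n) → ℂ}
    (hG : ∀ S' : MultiCone I, S'.ProperlyContained S → ∃ φ, ContDiff ℝ ∞ φ ∧
      EqOn φ f S'.carrier ∧ ∀ α : Fin n →₀ ℕ, EqOn (G α) (realPartial α φ) (closure S'.carrier)) :
    IsTotalFamily S fun J α w => G α (incl (union I J)ᶜ w) := by
  intro J _ α _ w hw
  refine DifferentiableAt.differentiableWithinAt ?_
  rw [S.face_eq_image hI J] at hw
  obtain ⟨z, hz, rfl⟩ := hw
  obtain ⟨s, -, hsS, -, hcover⟩ := MultiCone.exists_exhaustion hI S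
  obtain ⟨k, hk⟩ := hcover z hz
  obtain ⟨φ, hφ, hφf, hGφ⟩ := hG (s k) (hsS k)
  have hf' := hf.mono ((hsS k).carrier_subset hI)
  have hmem : proj (union I J)ᶜ z ∈ (s k).face J := by
    rw [(s k).face_eq_image hI J]
    exact ⟨z, hk, rfl⟩
  have hopen : IsOpen ((s k).face J) := isOpen_interior
  have hcl : ∀ w ∈ (s k).face J, incl (union I J)ᶜ w ∈ closure (s k).carrier := fun w hw => by
    have h := interior_subset hw
    exact h
  have heq : (fun w => G α (incl (union I J)ᶜ w)) =ᶠ[nhds (proj (union I J)ᶜ z)]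
      fun w => realPartial α φ (incl (union I J)ᶜ w) := by
    filter_upwards [hopen.mem_nhds hmem] with w hw
    exact hGφ α (hcl w hw)
  refine DifferentiableAt.congr_of_eventuallyEq ?_ heq
  have hψ := contDiff_realPartial hφ (α : Fin n → ℕ)
  set x := incl (union I J)ᶜ (proj (union I J)ᶜ z) with hx
  have hd : HasFDerivAt (fun w => realPartial α φ (incl (union I J)ᶜ w))
      ((fderiv ℝ (realPartial α φ) x).comp ((inclL (union I J)ᶜ).restrictScalars ℝ))
      (proj (union I J)ᶜ z) := by
    have h1 : HasFDerivAt (realPartial α φ) (fderiv ℝ (realPartial α φ) x) x :=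
      ((hψ.differentiable (by simp)) x).hasFDerivAt
    exact h1.comp (proj (union I J)ᶜ z) ((inclL (union I J)ᶜ).restrictScalars ℝ).hasFDerivAt
  refine differentiableAt_complex_of_I_smul hd fun v => ?_
  have h2 := fderiv_I_smul (s k).isOpen_carrier
    (differentiableOn_mixedPartial (s k).isOpen_carrier hf' α) hψ
    (realPartial_eqOn (s k).isOpen_carrier hf' hφf α) (inclL (union I J)ᶜ v) (hcl _ hmem)
  rw [ContinuousLinearMap.comp_apply, ContinuousLinearMap.comp_apply]
  simp only [ContinuousLinearMap.coe_restrictScalars', map_smul]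
  exact h2

theorem wordOf_zero : wordOf (fun _ : Fin n => 0) = [] := by
  simp [wordOf]

theorem scaleTaylor_empty (φ : EuclideanSpace ℂ (Fin n) → ℂ) (z : EuclideanSpace ℂ (Fin n))
    (N : Fin ℓ → ℕ) : scaleTaylor I φ z N ∅ = fun σ => φ (scale I σ z) := by
  have h1 : indicesLT (∅ : Finset (Fin ℓ)) N = {0} := by
    ext b
    simp [indicesLT, funext_iff]
  have h2 : realPartial (⇑(0 : Fin n →₀ ℕ)) φ = φ := by
    rw [realPartial, Finsupp.coe_zero]
    change realWordDeriv (wordOf fun _ => 0) φ = φ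
    rw [wordOf_zero]
    rfl
  funext σ
  have h3 : zeroOn ∅ σ = σ := by
    funext j
    simp [zeroOn]
  rw [scaleTaylor, h1, Finset.sum_singleton, indices_empty, Finset.sum_singleton, h2, h3]
  simp

/-- The remainder `f - App^{<N}` is the multiple Taylor remainder of `σ ↦ φ(μ(z, σ))` at
`σ = (1, …, 1)`. -/
theorem sub_App_eq_sum {φ : EuclideanSpace ℂ (Fin n) → ℂ}
    {G : (Fin n →₀ ℕ) → EuclideanSpace ℂ (Fin n) → ℂ} {z : EuclideanSpace ℂ (Fin n)}
    (hz : φ z = f z) (hG : ∀ (J : Finset (Fin ℓ)) (α : Fin n →₀ ℕ),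
      G α (scale I (zeroOn J 1) z) = realPartial α φ (scale I (zeroOn J 1) z)) (N : Fin ℓ → ℕ) :
    f z - App (fun J α w => G α (incl (union I J)ᶜ w)) N z =
      ∑ J : Finset (Fin ℓ), (-1 : ℝ) ^ J.card • scaleTaylor I φ z N J 1 := by
  have h1 : scale I (1 : Fin ℓ → ℝ) z = z := by
    ext i
    simp
  have hfilter : Finset.univ.filter (fun J : Finset (Fin ℓ) => J.Nonempty) =
      Finset.univ.erase ∅ := by
    ext J; simp [Finset.nonempty_iff_ne_empty]
  rw [App, hfilter, ← Finset.add_sum_erase _ (fun J => (-1 : ℝ) ^ J.card • scaleTaylor I φ z N J 1)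
    (Finset.mem_univ ∅), scaleTaylor_empty, sub_eq_add_neg, ← Finset.sum_neg_distrib]
  congr 1
  · simp only [h1, hz, Finset.card_empty, pow_zero, one_smul]
  · refine Finset.sum_congr rfl fun J _ => ?_
    have h2 : taylorSum (fun J α w => G α (incl (union I J)ᶜ w)) J N z =
        scaleTaylor I φ z N J 1 := by
      rw [taylorSum, scaleTaylor]
      refine Finset.sum_congr rfl fun b _ => ?_
      rw [tau_taylorPoly, taylorTerm]
      refine Finset.sum_congr rfl fun α _ => ?_
      have h3 : incl (union I J)ᶜ (proj (union I J)ᶜ z) = scale I (zeroOn J 1) z :=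
        incl_proj_eq_scale J z
      rw [h3, hG, h1, MvPolynomial.eval_monomial, Finsupp.prod_fintype _ _ (by simp)]
      ring
    rw [h2, pow_succ, mul_neg_one, neg_mul, neg_neg, Complex.real_smul]
    push_cast
    rfl

/-- Extendable functions are developable, the coefficients being the boundary values of the
derivatives. -/
theorem SmoothlyExtendable.developable (hI : Admissible I)
    (hf : DifferentiableOn ℂ f S.carrier) (h : SmoothlyExtendable S f) : Developable S f := by
  obtain ⟨G, hG⟩ := h.exists_boundaryValues hI hf
  refine ⟨_, isTotalFamily_boundaryValues hI hf hG, fun S' hS' N => ?_⟩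
  obtain ⟨φ, hφ, hφf, hGφ⟩ := hG S' hS'
  have hf' := hf.mono (hS'.carrier_subset hI)
  obtain ⟨C, hC⟩ := S'.norm_foldl_dirDeriv_scale_le hI hS'.isCompact_closure_U hφ N
  obtain ⟨C', hC'0, hC'⟩ := S'.prod_infDist_comparable hI fun j => weight I j N
  refine ⟨(|C| + 1) * C', by positivity, fun z hz => ?_⟩
  have hzero : ∀ (J : Finset (Fin ℓ)) {σ : Fin ℓ → ℝ}, σ ∈ Icc (0 : Fin ℓ → ℝ) 1 →
      scale I (zeroOn J σ) z ∈ closure S'.carrier := fun J σ hσ => by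
    refine S'.scale_mem_closure hI hz (fun j => ?_) fun j => ?_
    · rw [zeroOn]; split_ifs
      exacts [le_rfl, hσ.1 j]
    · rw [zeroOn]; split_ifs
      exacts [zero_le_one, hσ.2 j]
  have h1mem : (1 : Fin ℓ → ℝ) ∈ Icc (0 : Fin ℓ → ℝ) 1 := ⟨zero_le_one, le_rfl⟩
  -- the multinomial formula holds at the scaled points because they are in the closure of `S'`
  have hrem := remList_eq_sum (N := N) (u := scaleTaylor I φ z N)
    (fun J => contDiff_scaleTaylor hφ z N J) (fun J j hj σ hσ => taylorOp_scaleTaylor hφ N hj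
      fun s y hy r α => iterate_dirDeriv_realPartial S'.isOpen_carrier hf' hφ hφf hy r α
        (hzero (insert j J) hσ)) (List.nodup_finRange ℓ) h1mem
  have huniv : (List.finRange ℓ).toFinset.powerset = Finset.univ := by
    ext J
    simp
  rw [huniv] at hrem
  rw [sub_App_eq_sum (φ := φ) (hφf hz) fun J α => hGφ α (hzero J h1mem)]
  simp only at hrem
  rw [← hrem, scaleTaylor_empty]
  have hs : ContDiff ℝ ∞ fun σ : Fin ℓ → ℝ => φ (scale I σ z) :=
    hφ.comp (contDiff_scale.comp (contDiff_id.prodMk contDiff_const))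
  refine (norm_remList_le N (List.nodup_finRange ℓ) hs (hC z hz) h1mem).trans ?_
  have hω := S'.prod_norm_zpow_weight hI hz N
  have hpos : 0 ≤ ∏ j, ratio I j z ^ N j :=
    Finset.prod_nonneg fun j _ => pow_nonneg (S'.ratio_pos hI hz j).le _
  calc C * ∏ j, ratio I j z ^ N j ≤ (|C| + 1) * ∏ j, ratio I j z ^ N j := by
        gcongr
        linarith [le_abs_self C]
    _ ≤ (|C| + 1) * (C' * ∏ j, Metric.infDist z (Z I j) ^ weight I j N) := by
        rw [← hω]
        gcongr
        exact (hC' z hz).2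
    _ = _ := by ring

end Expansion

end MultiAsymptotic

theorem theorem7p13 {n ℓ : ℕ} (I : Fin ℓ → Finset (Fin n)) (hI : MultiAsymptotic.Admissible I)
    (S : MultiAsymptotic.MultiCone I) (f : EuclideanSpace ℂ (Fin n) → ℂ)
    (hf : DifferentiableOn ℂ f S.carrier) :
    List.TFAE [MultiAsymptotic.Developable S f,
      MultiAsymptotic.DerivativesBounded S f,
      MultiAsymptotic.SmoothlyExtendable S f] := by
  tfae_have 1 → 2 := fun h => h.derivativesBounded hI hf
  tfae_have 2 → 3 := fun h => h.smoothlyExtendable hI hf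
  tfae_have 3 → 1 := fun h => h.developable hI hf
  tfae_finish
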